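/- All limits are for $T\to\infty$. Let $p=p(T)\to\infty$ subexponentially, in the sense that $\log p(T)=O(\sqrt T)$, let $0\le s_1<\dots<s_p\le 1$ be sampling points (depending on $T$), and let $$y_{tj}=X_t(s_j)+u_{tj},\qquad 1\le t\le T,\ 1\le j\le p .$$ *Noise.* The vectors $u_t=(u_{t1},\dots,u_{tp})$, $t\ge 1$, are i.i.d., Gaussian, centered, independent of $(X_t)$, with $\mathrm{Cov}(u_{ti},u_{tj})=\gamma^u(i-j)$ and $\sum_{h\in\mathbb Z}|\gamma^u(h)|<\infty$. *Signal.* $(X_t)_{t\ge1}$ is a sequence of random curves on $[0,1]$ with: $EX_t(s)=0$; $X_t=g(\delta_t,\delta_{t-1},\dots)$ with $g$ measurable and $(\delta_t)$ i.i.d., and $\sum_{m\ge1}\big(E\|X_t-g(\delta_t,\dots,\delta_{t-m},\delta'_{t-m-1},\delta'_{t-m-2},\dots)\|^4\big)^{1/4}\le K<\infty$, where $(\delta'_t)$ is an independent copy of $(\delta_t)$ and $\|\cdot\|$ is the $L^2[0,1]$ norm; $\sup_sEX_1(s)^4\le C_X<\infty$; $\Gamma(s,s')=\mathrm{Cov}(X_1(s),X_1(s'))$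 is continuous; $E\sup_sX_1(s)^2\le C_S<\infty$; almost surely all $X_t$ lie in an $L$-dimensional function space, and the covariance operator has eigenvalues $\lambda_1\ge\dots\ge\lambda_L>0$ with orthonormal eigenfunctions $\varphi_1,\dots,\varphi_L$, for which $\max_{k,\ell\le L}\big|p^{-1}\sum_{i=1}^p\varphi_k(s_i)\varphi_\ell(s_i)\big|=O(1)$. Put $f_t=\big(\langle X_t,\varphi_\ell\rangle/\sqrt{\lambda_\ell}\big)_{\ell\le L}$. *Estimator.* Let $Y=(y_1,\dots,y_T)\in\mathbb R^{p\times T}$, let $\hat\gamma_1\ge\hat\gamma_2\ge\cdots$ be the eigenvalues of $T^{-1}Y^\top Y$ with corresponding orthonormal eigenvectors $\hat e_1,\hat e_2,\dots$ (any choice), and for $K\in\mathbb N$ let $\hat X_t(s_j|K)$ be the $(j,t)$ entry of $Y\hat E\hat E^\top$, $\hat E=(\hat e_1,\dots,\hat e_K)$. Let $\hat L$ be a random variable with values in $\mathbb N$ such that $P(\hat L=L)\to1$, and write $\hat X_t(s_j)=\hat X_t(s_j|\hat L)$ and $r_T=T^{-1/4}+T^{1/4}p^{-1/2}$. (1) *Fixed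 $L\ge1$* (and a signal process not depending on $T$). If $p/\hat\gamma_L=O_P(1)$, then, uniformly in the choice of $t\le T$, $$\max_{j\le p}|\hat X_t(s_j)-X_t(s_j)|=O_P(r_T);$$ hence the estimator is consistent (the left side tends to $0$ in probability) if $\sqrt T/p\to0$. Moreover, $$\max_{j\le p}\max_{t\le T}|\hat X_t(s_j)-X_t(s_j)|=O_P\Big(\max_{t\le T}\|f_t\|\; r_T\Big).$$ (2) *Diverging $L$.* Let $L=L(T)\to\infty$ with $L=o(T^{\varepsilon})$ for every $\varepsilon>0$. The signal process, $\lambda_\ell$ and $\varphi_\ell$ may depend on $T$; the constants $K,C_X,C_S$ do not. Suppose that for some $\nu,\rho,\beta>0$ not depending on $T$ we have $\lambda_j\ge\rho j^{-\nu}$ for $1\le j\le L$ and $p/\hat\gamma_L=O_P(L^\beta)$. Then, uniformly in the choice of $t\le T$, $$\max_{j\le p}|\hat X_t(s_j)-X_t(s_j)|=O_P\big(L^{2\beta+5/2+\nu/2}\,r_T\big).$$ Moreover, if $E\|X_1\|^q$ is bounded in $T$ for some $q>4$, then for all $0<q'<q$ $$\max_{t\le T}\max_{j\le p}|\hat X_t(s_j)-X_t(s_j)|=o_P\big(L^{2\beta+5/2+\nu}\,T^{1/q'}\,r_T\big).$$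 -/

import Mathlib

open MeasureTheory ProbabilityTheory Filter Topology
open scoped ENNReal NNReal

universe w v

noncomputable section

namespace NoisyFDA

variable {Ω : Type w} [MeasurableSpace Ω]

/-! Convergence rates in probability. All limits are for the sample size `T → ∞`.
`P` of a set that is not measurable is its outer probability. -/

/-- `Z_T = O_P(R_T)`; the normalisation `R_T` may be random. -/
def IsBigOP (P : Measure Ω) (Z R : ℕ → Ω → ℝ) : Prop :=
  ∀ ε : ℝ≥0∞, 0 < ε → ∃ M : ℝ, ∀ᶠ T in atTop, P {ω | M * R T ω < |Z T ω|} ≤ ε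

/-- `Z_{T,t} = O_P(r_T)`, uniformly in the choice of the time point `t ≤ T`. -/
def IsBigOPForEach (P : Measure Ω) (Z : (T : ℕ) → Fin T → Ω → ℝ) (r : ℕ → ℝ) : Prop :=
  ∀ ε : ℝ≥0∞, 0 < ε → ∃ M : ℝ, ∀ᶠ T in atTop, ∀ t : Fin T, P {ω | M * r T < |Z T t ω|} ≤ ε

/-- `Z_T = o_P(r_T)`. -/
def IsLittleOP (P : Measure Ω) (Z : ℕ → Ω → ℝ) (r : ℕ → ℝ) : Prop :=
  ∀ c : ℝ, 0 < c → Tendsto (fun T => P {ω | c * r T < |Z T ω|}) atTop (𝓝 0)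

/-- `Z_{T,t} → 0` in probability, uniformly in the choice of the time point `t ≤ T`. -/
def TendstoZeroInProbForEach (P : Measure Ω) (Z : (T : ℕ) → Fin T → Ω → ℝ) : Prop :=
  ∀ c : ℝ, 0 < c → ∀ ε : ℝ≥0∞, 0 < ε →
    ∀ᶠ T in atTop, ∀ t : Fin T, P {ω | c < |Z T t ω|} ≤ ε

/-- `a_T / D_T = O_P(r_T)` for positive `a_T` and random `D_T ≥ 0`; the ratio counts as `+∞` where
`D_T = 0`. -/
def RatioIsBigOP (P : Measure Ω) (a : ℕ → ℝ) (D : ℕ → Ω → ℝ) (r : ℕ → ℝ) : Prop :=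
  ∀ ε : ℝ≥0∞, 0 < ε → ∃ M : ℝ, 0 < M ∧ ∀ᶠ T in atTop, P {ω | M * r T * D T ω < a T} ≤ ε

/-! Growth of the number of sampling points and of the number of factors. -/

/-- Subexponential divergence of the number of sampling points. -/
def DivergesSubexponentially (p : ℕ → ℕ) : Prop :=
  Tendsto p atTop atTop ∧
    (fun T => Real.log (p T)) =O[atTop] (fun T : ℕ => √(T : ℝ))

/-- Subpolynomial divergence: to infinity, but slower than every positive power of `T`. -/
def DivergesSubpolynomially (L : ℕ → ℕ) : Prop :=
  Tendsto L atTop atTop ∧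
    ∀ ε : ℝ, 0 < ε → (fun T => (L T : ℝ)) =o[atTop] (fun T : ℕ => (T : ℝ) ^ ε)

/-- The basic rate `T^{-1/4} + T^{1/4} / √p`. -/
def rate (T p : ℕ) : ℝ :=
  1 / (T : ℝ) ^ (1 / 4 : ℝ) + (T : ℝ) ^ (1 / 4 : ℝ) / √(p : ℝ)

/-! Curves on `[0,1]`. A curve is a function `ℝ → ℝ` of which only the values on `[0,1]` matter.
A functional time series is `X : ℕ → Ω → ℝ → ℝ`; `X t ω` is the curve number `t + 1`. -/

/-- Lebesgue measure on `[0,1]`. -/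
abbrev unitVol : Measure ℝ := volume.restrict (Set.Icc (0 : ℝ) 1)

/-- The `L²[0,1]` norm, with values in `[0,∞]`. -/
def l2norm (f : ℝ → ℝ) : ℝ≥0∞ := eLpNorm f 2 unitVol

/-- The score `⟨x, φ⟩` in `L²[0,1]`. -/
def score (x φ : ℝ → ℝ) : ℝ := ∫ r, x r * φ r ∂unitVol

/-- The covariance kernel `Γ(r, r') = Cov(X_1(r), X_1(r'))`. -/
def covKernel (P : Measure Ω) (X : ℕ → Ω → ℝ → ℝ) (r r' : ℝ) : ℝ :=
  cov[fun ω => X 0 ω r, fun ω => X 0 ω r'; P]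

/-- `L⁴`-`m`-approximability with constant `K`: almost surely
`X_t = g(δ_t, δ_{t-1}, …)` as curves, with i.i.d. innovations `δ`, and
`∑_{m ≥ 1} (E ‖X_t - g(δ_t, …, δ_{t-m}, δ'_{t-m-1}, δ'_{t-m-2}, …)‖⁴)^{1/4} ≤ K`,
where `δ'` is an independent copy of `δ`. The pair `(δ, δ')` is realised on `Ω × Ω`; the expectation
does not depend on `t` and is written down for `t = 0`. -/
def IsL4mApproximable (P : Measure Ω) (X : ℕ → Ω → ℝ → ℝ) (K : ℝ≥0) : Prop :=
  ∃ (S : Type v) (_ : MeasurableSpace S) (δ : ℤ → Ω → S) (g : (ℕ → S) → ℝ → ℝ),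
    (∀ i, Measurable (δ i)) ∧
    iIndepFun δ P ∧
    (∀ i, IdentDistrib (δ i) (δ 0) P P) ∧
    Measurable (fun z : (ℕ → S) × ℝ => g z.1 z.2) ∧
    (∀ t : ℕ, ∀ᵐ ω ∂P, ∀ r ∈ Set.Icc (0 : ℝ) 1,
      X t ω r = g (fun k => δ ((t : ℤ) - (k : ℤ)) ω) r) ∧
    ∑' n : ℕ, (∫⁻ z : Ω × Ω,
        (l2norm (fun r =>
          g (fun k => δ (-(k : ℤ)) z.1) r
            - g (fun k => if k ≤ n + 1 then δ (-(k : ℤ)) z.1 else δ (-(k : ℤ)) z.2) r)) ^ 4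
        ∂(P.prod P)) ^ (1 / 4 : ℝ) ≤ K

/-- `λ_1 ≥ … ≥ λ_L > 0` are eigenvalues, with orthonormal eigenfunctions `φ_1, …, φ_L`, of the
covariance operator with kernel `Γ` on `L²[0,1]`. -/
structure IsEigenSystem (Γ : ℝ → ℝ → ℝ) {L : ℕ} (lam : Fin L → ℝ) (φ : Fin L → ℝ → ℝ) :
    Prop where
  memLp : ∀ k, MemLp (φ k) 2 unitVol
  orthonormal : ∀ k l, score (φ k) (φ l) = if k = l then 1 else 0
  eigen : ∀ k, ∀ r ∈ Set.Icc (0 : ℝ) 1, score (Γ r) (φ k) = lam k * φ k r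
  antitone : Antitone lam
  pos : ∀ k, 0 < lam k

/-- The assumptions on the signal, with explicit constants: zero mean, `L⁴`-`m`-approximability,
bounded fourth moments, continuous covariance kernel, `E sup_r X_1(r)² < ∞`, and curves in an
`L`-dimensional function space, where `λ_ℓ, φ_ℓ`, `ℓ ≤ L`, are the eigenvalues and eigenfunctions
of the covariance operator. -/
structure SignalAssumption (P : Measure Ω) (X : ℕ → Ω → ℝ → ℝ) {L : ℕ}
    (lam : Fin L → ℝ) (φ : Fin L → ℝ → ℝ) (K CX CS : ℝ≥0) : Prop where
  measurable : ∀ t, ∀ r ∈ Set.Icc (0 : ℝ) 1, Measurable (fun ω => X t ω r)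
  mean_zero : ∀ t, ∀ r ∈ Set.Icc (0 : ℝ) 1, ∫ ω, X t ω r ∂P = 0
  approximable : IsL4mApproximable.{w, v} P X K
  fourth_moment : ∀ r ∈ Set.Icc (0 : ℝ) 1, ∫⁻ ω, ‖X 0 ω r‖ₑ ^ 4 ∂P ≤ CX
  continuous_cov : ContinuousOn (fun z : ℝ × ℝ => covKernel P X z.1 z.2)
    (Set.Icc (0 : ℝ) 1 ×ˢ Set.Icc (0 : ℝ) 1)
  sup_moment : ∫⁻ ω, ⨆ r ∈ Set.Icc (0 : ℝ) 1, ‖X 0 ω r‖ₑ ^ 2 ∂P ≤ CS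
  eigenSystem : IsEigenSystem (covKernel P X) lam φ
  finite_dim : ∃ V : Submodule ℝ (Lp ℝ 2 unitVol), Module.finrank ℝ V = L ∧
    ∀ t, ∀ᵐ ω ∂P, ∃ v ∈ V, (fun r => X t ω r) =ᵐ[unitVol] v

/-- The standardised score vector `f_t = (x_{t1}/√λ_1, …, x_{tL}/√λ_L)` of a curve. -/
def factor {L : ℕ} (lam : Fin L → ℝ) (φ : Fin L → ℝ → ℝ) (x : ℝ → ℝ) :
    EuclideanSpace ℝ (Fin L) :=
  WithLp.toLp 2 (fun l => score x (φ l) / √(lam l))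

/-- The assumptions on the noise vectors `u_t ∈ ℝ^p`: independent over `t`, Gaussian with mean zero
and `Cov(u_{ti}, u_{tj}) = γ(i - j)` (so that they are identically distributed), and independent of
the signals. -/
structure NoiseAssumption (P : Measure Ω) (X : ℕ → Ω → ℝ → ℝ) {p : ℕ}
    (u : ℕ → Ω → Fin p → ℝ) (γ : ℤ → ℝ) : Prop where
  measurable : ∀ t, Measurable (u t)
  indep : iIndepFun u P
  gaussian : ∀ t, HasGaussianLaw (u t) P
  mean_zero : ∀ t i, ∫ ω, u t ω i ∂P = 0
  cov_eq : ∀ t i j, cov[fun ω => u t ω i, fun ω => u t ω j; P] = γ ((i : ℤ) - (j : ℤ))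
  indep_signal : IndepFun
    (fun ω => fun q : ℕ × Set.Icc (0 : ℝ) 1 => X q.1 ω (q.2 : ℝ))
    (fun ω => fun t : ℕ => u t ω) P

/-- Sampling points `0 ≤ s_1 < ⋯ < s_p ≤ 1`. -/
def IsGrid {p : ℕ} (s : Fin p → ℝ) : Prop :=
  StrictMono s ∧ ∀ j, s j ∈ Set.Icc (0 : ℝ) 1

/-- The `p × T` data matrix `Y = (y_1, …, y_T)` with `y_{tj} = X_t(s_j) + u_{tj}`. -/
def dataMatrix {p : ℕ} (X : ℕ → Ω → ℝ → ℝ) (u : ℕ → Ω → Fin p → ℝ) (s : Fin p → ℝ)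
    (T : ℕ) (ω : Ω) : Matrix (Fin p) (Fin T) ℝ :=
  Matrix.of fun j t => X t ω (s j) + u t ω j

/-- `g 0 ≥ g 1 ≥ …` are the eigenvalues of `Yᵀ Y / T`, and `e 0, e 1, …` corresponding orthonormal
eigenvectors. -/
structure IsPCA {p T : ℕ} (Y : Matrix (Fin p) (Fin T) ℝ) (g : Fin T → ℝ)
    (e : Fin T → EuclideanSpace ℝ (Fin T)) : Prop where
  orthonormal : Orthonormal ℝ e
  eigen : ∀ k, ((1 / (T : ℝ)) • (Y.transpose * Y)).mulVec (e k).ofLp = g k • (e k).ofLp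
  antitone : Antitone g

/-- The `k`-th largest eigenvalue, for `1 ≤ k ≤ T`. -/
def kthEigenvalue {T : ℕ} (g : Fin T → ℝ) (k : ℕ) : ℝ :=
  if h : k - 1 < T then g ⟨k - 1, h⟩ else 0

/-- The estimator `Y Ê Êᵀ` of the matrix `(X_t(s_j))_{j,t}`, where the columns of `Ê` are the
first `K` eigenvectors. -/
def signalEstimator {p T : ℕ} (Y : Matrix (Fin p) (Fin T) ℝ)
    (e : Fin T → EuclideanSpace ℝ (Fin T)) (K : ℕ) : Matrix (Fin p) (Fin T) ℝ :=
  let E : Matrix (Fin T) {k : Fin T // (k : ℕ) < K} ℝ := Matrix.of fun t k => e k.1 t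
  Y * E * E.transpose

/-- `max_{j ≤ p} |X̂_t(s_j | K) - X_t(s_j)|`. -/
def errorAt {p T : ℕ} (X : ℕ → Ω → ℝ → ℝ) (u : ℕ → Ω → Fin p → ℝ) (s : Fin p → ℝ)
    (e : Fin T → EuclideanSpace ℝ (Fin T)) (K : ℕ) (t : Fin T) (ω : Ω) : ℝ :=
  ⨆ j : Fin p, |signalEstimator (dataMatrix X u s T ω) e K j t - X t ω (s j)|

/-- `max_{t ≤ T} max_{j ≤ p} |X̂_t(s_j | K) - X_t(s_j)|`. -/
def errorUnif {p T : ℕ} (X : ℕ → Ω → ℝ → ℝ) (u : ℕ → Ω → Fin p → ℝ) (s : Fin p → ℝ)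
    (e : Fin T → EuclideanSpace ℝ (Fin T)) (K : ℕ) (ω : Ω) : ℝ :=
  ⨆ t : Fin T, errorAt X u s e K t ω

end NoisyFDA

end

open NoisyFDA

/-! ### Reconstruction error on an abstract subspace: deterministic bounds. -/

section SubspacePerturbation

open scoped InnerProductSpace

set_option linter.unusedSectionVars false

variable {E G : Type*} [NormedAddCommGroup E] [InnerProductSpace ℝ E] [FiniteDimensional ℝ E]
  [NormedAddCommGroup G] [InnerProductSpace ℝ G] [FiniteDimensional ℝ G]

/-! Regard the data matrix as an operator Y = X + U and let S be the span of its L leading right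
singular vectors, so that the estimator is Y P_S. Two facts about S carry the argument: Y is bounded
below on S by any a ≥ 0 with a² ≤ T γ̂_L, and Y maps S and Sᗮ to orthogonal spaces, so that Q Y = Y
P_S for the projection Q onto Y(S). No eigenvector is compared with a population counterpart, and no
spectral gap enters.

With h = P_S e_t, the error in row j is ⟨u_j, h⟩ - (X(e_t - h))_j, where u_j is the j-th row of U.
The first term is ⟨P_S u_j, h⟩, and a‖P_S u_j‖ ≤ ‖Y u_j‖. For the second, rank X ≤ L = dim S; if ‖U‖
≤ a/2, then X is injective on S, hence X(e_t - h) = X k with k in S, and k is controlled through Q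
X(e_t - h) = -Q U(e_t - h). Finally a‖Q U e_t‖ ≤ ‖Y* U e_t‖. This is
`subspace_reconstruction_bound`, translated to matrices by `pca_reconstruction_bound`.

It remains to bound, with high probability, the operator norm of U, the rows of X and U, and the
products X u_j and Y* U e_t. These bounds form `IsRegularSample`. Gaussian tails and a union bound
handle the rows, using log p = O(√T); fourth and eighth moments and a union bound over t handle the
columns; a Frobenius estimate of U Uᵀ minus its mean handles the norm. With a of order √(Tp)/Λ,
where p/γ̂_L = O_P(Λ²), the dominant quantity ‖Y* U e_t‖/a has order Λ √p r_T. Altogether the error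
is at most a constant times Λ³ r_T (m + 1), where m = max_j |X_t(s_j)|
(`IsRegularSample.reconstruction_le`). Taking Λ = 1 or Λ = L^{β/2} gives the pointwise rates, since
m = O_P(1).

The rank condition requires the Karhunen–Loève expansion at every sampling point, not merely at
almost every point. The residual variance Γ(r,r) - ∑ λ_k φ_k(r)² is continuous and vanishes almost
everywhere, hence everywhere. This also gives ∑ λ_k φ_k(r)² = Γ(r,r), so |X_t(r)| ≤ const · ‖f_t‖.

For the uniform rates, m is replaced by a multiple of max_t ‖f_t‖. In the fixed case the additive 1
is absorbed because a large γ̂_L forces some signal value to stay away from zero; in the diverging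
case max_t ‖X_t‖ = O_P(T^{1/q}), and the gap between 1/q and 1/q' absorbs all constants. -/

theorem starProjection_map_comp {S : Submodule ℝ E} {Y : E →ₗ[ℝ] G}
    (horth : ∀ h ∈ S, ∀ v ∈ Sᗮ, ⟪Y h, Y v⟫_ℝ = 0) (v : E) :
    (S.map Y).starProjection (Y v) = Y (S.starProjection v) := by
  refine Submodule.eq_starProjection_of_mem_orthogonal
    (Submodule.mem_map_of_mem (S.starProjection_apply_mem v)) ?_
  rw [Submodule.mem_orthogonal]
  rintro _ ⟨h, hh, rfl⟩
  rw [← map_sub]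
  exact horth h hh _ (S.sub_starProjection_mem_orthogonal v)

theorem norm_starProjection_le' (S : Submodule ℝ E) (v : E) : ‖S.starProjection v‖ ≤ ‖v‖ :=
  (S.starProjection.le_opNorm v).trans
    (mul_le_of_le_one_left (norm_nonneg _) S.starProjection_norm_le)

/-- The part of v outside S cannot cancel in Y v, because Y v has projection Y P_S v onto Y(S).
Applied to a noise row. -/
theorem mul_norm_starProjection_le {S : Submodule ℝ E} {Y : E →ₗ[ℝ] G} {a : ℝ}
    (hlow : ∀ h ∈ S, a * ‖h‖ ≤ ‖Y h‖)
    (horth : ∀ h ∈ S, ∀ v ∈ Sᗮ, ⟪Y h, Y v⟫_ℝ = 0) (v : E) :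
    a * ‖S.starProjection v‖ ≤ ‖Y v‖ := by
  refine (hlow _ (S.starProjection_apply_mem v)).trans ?_
  rw [← starProjection_map_comp horth]
  exact norm_starProjection_le' _ _

/-- Write w = Y h for the projection of u. Then ‖w‖² = ⟨Y h, u⟩ = ⟨h, Y* u⟩, while a‖h‖ ≤ ‖w‖. This
replaces the noise norm by the much smaller correlation of noise with data. -/
theorem mul_norm_starProjection_map_le {S : Submodule ℝ E} {Y : E →ₗ[ℝ] G} {a : ℝ}
    (hlow : ∀ h ∈ S, a * ‖h‖ ≤ ‖Y h‖) (ha : 0 ≤ a) (u : G) :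
    a * ‖(S.map Y).starProjection u‖ ≤ ‖LinearMap.adjoint Y u‖ := by
  obtain ⟨h, hh, hw⟩ := (S.map Y).starProjection_apply_mem u
  set w := (S.map Y).starProjection u with hwdef
  have h1 : ‖w‖ ^ 2 ≤ ‖h‖ * ‖LinearMap.adjoint Y u‖ := by
    calc ‖w‖ ^ 2 = ⟪w, u⟫_ℝ := by
          rw [← real_inner_self_eq_norm_sq]
          have := Submodule.starProjection_inner_eq_zero (K := S.map Y) u w
            ((S.map Y).starProjection_apply_mem u)
          rw [inner_sub_left, ← hwdef] at this
          rw [real_inner_comm u w]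
          linarith
      _ = ⟪h, LinearMap.adjoint Y u⟫_ℝ := by rw [LinearMap.adjoint_inner_right, hw]
      _ ≤ _ := real_inner_le_norm _ _
  have h2 := hlow h hh
  rw [hw] at h2
  rcases eq_or_lt_of_le (norm_nonneg w) with h0 | h0
  · rw [← h0]; simp
  · have h3 : a * ‖w‖ ^ 2 ≤ ‖w‖ * ‖LinearMap.adjoint Y u‖ := by
      calc a * ‖w‖ ^ 2 ≤ a * (‖h‖ * ‖LinearMap.adjoint Y u‖) := by gcongr
        _ = (a * ‖h‖) * ‖LinearMap.adjoint Y u‖ := by ring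
        _ ≤ _ := by gcongr
    nlinarith

/-- If `X` has rank at most `dim S` and is a small perturbation of `X + U`, which is bounded below
on `S`, then `X` takes on `S` each of its values. -/
theorem exists_mem_map_eq_of_rank_le {S : Submodule ℝ E} {X U : E →ₗ[ℝ] G} {a N : ℝ}
    (hlow : ∀ h ∈ S, a * ‖h‖ ≤ ‖(X + U) h‖)
    (horth : ∀ h ∈ S, ∀ v ∈ Sᗮ, ⟪(X + U) h, (X + U) v⟫_ℝ = 0)
    (hU : ∀ v, ‖U v‖ ≤ N * ‖v‖) (hN : N ≤ a / 2) (ha : 0 < a)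
    (hrank : Module.finrank ℝ (LinearMap.range X) ≤ Module.finrank ℝ S) {v : E} (hv : v ∈ Sᗮ) :
    ∃ h ∈ S, X h = X v ∧ a / 2 * ‖h‖ ≤ ‖(S.map (X + U)).starProjection (U v)‖ := by
  set A := S.map (X + U)
  -- On S the projection fixes Y h, so Q X h = Y h - Q U h, and the noise takes away at most half of
  -- the lower bound.
  have hproj : ∀ h ∈ S, a / 2 * ‖h‖ ≤ ‖A.starProjection (X h)‖ := by
    intro h hh
    have h1 : A.starProjection ((X + U) h) = (X + U) h :=
      Submodule.starProjection_eq_self_iff.2 (Submodule.mem_map_of_mem hh)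
    have h2 : A.starProjection (X h) = (X + U) h - A.starProjection (U h) := by
      rw [← h1, LinearMap.add_apply, map_add]; abel
    have h3 : ‖A.starProjection (U h)‖ ≤ a / 2 * ‖h‖ :=
      (norm_starProjection_le' _ _).trans ((hU h).trans (by gcongr))
    have h4 := hlow h hh
    have h5 := norm_sub_norm_le ((X + U) h) (A.starProjection (U h))
    rw [h2]
    linarith
  have hinj : Function.Injective (X.domRestrict S) := by
    rw [injective_iff_map_eq_zero]
    intro h hh
    have h1 := hproj h h.2
    rw [LinearMap.domRestrict_apply] at hh
    rw [hh, map_zero, norm_zero] at h1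
    have : ‖(h : E)‖ ≤ 0 := by nlinarith [norm_nonneg (h : E)]
    simpa using this
  -- Injectivity on S gives X(S) dimension dim S, which is at least rank X, so X(S) is the entire
  -- range.
  have hrange : LinearMap.range (X.domRestrict S) = LinearMap.range X := by
    apply Submodule.eq_of_le_of_finrank_le
    · rintro _ ⟨h, rfl⟩
      exact ⟨h, rfl⟩
    · rw [LinearMap.finrank_range_of_inj hinj]
      exact hrank
  have hmem : X v ∈ LinearMap.range (X.domRestrict S) := by
    rw [hrange]; exact ⟨v, rfl⟩
  obtain ⟨h, hh⟩ := hmem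
  rw [LinearMap.domRestrict_apply] at hh
  refine ⟨h, h.2, hh, (hproj h h.2).trans ?_⟩
  rw [hh]
  -- Q Y v = Y P_S v = 0 for v in Sᗮ, so signal and noise cancel under Q. The large vector X v
  -- thereby becomes a noise term.
  have h1 : A.starProjection ((X + U) v) = 0 := by
    rw [starProjection_map_comp horth]
    rw [(Submodule.starProjection_apply_eq_zero_iff S).2 hv, map_zero]
  rw [LinearMap.add_apply, map_add] at h1
  rw [eq_neg_of_add_eq_zero_left h1, norm_neg]

/-- Deterministic bound for the two parts of the reconstruction error. -/
theorem subspace_reconstruction_bound {S : Submodule ℝ E} {X U : E →ₗ[ℝ] G} {a N : ℝ}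
    (hlow : ∀ h ∈ S, a * ‖h‖ ≤ ‖(X + U) h‖)
    (horth : ∀ h ∈ S, ∀ v ∈ Sᗮ, ⟪(X + U) h, (X + U) v⟫_ℝ = 0)
    (hU : ∀ v, ‖U v‖ ≤ N * ‖v‖) (hN : 0 ≤ N) (ha : 0 < a)
    (hrank : Module.finrank ℝ (LinearMap.range X) ≤ Module.finrank ℝ S)
    (x u : E) (η ξ ζ ω m y : ℝ) (e : E) (f : G →ₗ[ℝ] ℝ)
    (hx : ∀ v, f (X v) = ⟪x, v⟫_ℝ) (hu : ∀ v, f (U v) = ⟪u, v⟫_ℝ)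
    (hη : ‖u‖ ≤ η) (hξ : ‖x‖ ≤ ξ) (hζ : ‖X u‖ ≤ ζ)
    (hω : ‖LinearMap.adjoint (X + U) (U e)‖ ≤ ω) (hm : |f (X e)| ≤ m) (hy : ‖X e‖ ≤ y) :
    |f ((X + U) (S.starProjection e)) - f (X e)| ≤
      (ζ + N * η) / a * ((y + ω / a) / a) +
        2 / a * (ξ * (ω / a) + 2 * (N * ξ * ((y + ω / a) / a)) + N * m) := by
  set h := S.starProjection e
  set A := S.map (X + U)
  have hη0 := (norm_nonneg _).trans hη
  have hξ0 := (norm_nonneg _).trans hξ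
  have hζ0 := (norm_nonneg _).trans hζ
  have hω0 := (norm_nonneg _).trans hω
  have hy0 := (norm_nonneg _).trans hy
  have hm0 := (abs_nonneg _).trans hm
  have hA : ‖A.starProjection (U e)‖ ≤ ω / a := by
    rw [le_div_iff₀ ha, mul_comm]
    exact (mul_norm_starProjection_map_le hlow ha.le _).trans hω
  have hh : ‖h‖ ≤ (y + ω / a) / a := by
    rw [le_div_iff₀ ha, mul_comm]
    refine (hlow _ (S.starProjection_apply_mem e)).trans ?_
    rw [← starProjection_map_comp horth, LinearMap.add_apply, map_add]
    exact (norm_add_le _ _).trans (add_le_add ((norm_starProjection_le' _ _).trans hy) hA)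
  set b := (y + ω / a) / a
  have hb0 : 0 ≤ b := (norm_nonneg _).trans hh
  have hHu : ‖S.starProjection u‖ ≤ (ζ + N * η) / a := by
    rw [le_div_iff₀ ha, mul_comm]
    refine (mul_norm_starProjection_le hlow horth u).trans ?_
    rw [LinearMap.add_apply]
    exact (norm_add_le _ _).trans (add_le_add hζ ((hU u).trans (by gcongr)))
  have h1 : |f (U h)| ≤ (ζ + N * η) / a * b := by
    -- As h lies in S, only the projection of the noise row onto S contributes.
    have h2 : f (U h) = ⟪S.starProjection u, h⟫_ℝ := by
      rw [hu, Submodule.inner_starProjection_left_eq_right,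
        Submodule.starProjection_eq_self_iff.2 (S.starProjection_apply_mem e)]
    rw [h2]
    refine (abs_real_inner_le_norm _ _).trans ?_
    gcongr
  have h2 : |f (X (e - h))| ≤ 2 / a * (ξ * (ω / a) + 2 * (N * ξ * b) + N * m) := by
    -- When the noise is too large for the rank argument, the trivial bound m + ξ b suffices: then 2
    -- N / a ≥ 1, and the claimed bound dominates it.
    rcases le_or_gt N (a / 2) with hNa | hNa
    · obtain ⟨k, -, hk, hk'⟩ := exists_mem_map_eq_of_rank_le hlow horth hU hNa ha hrank
        (S.sub_starProjection_mem_orthogonal e)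
      rw [← hk, hx]
      have h3 : ‖A.starProjection (U (e - h))‖ ≤ ω / a + N * b := by
        rw [map_sub, map_sub]
        refine (norm_sub_le _ _).trans (add_le_add hA ?_)
        exact (norm_starProjection_le' _ _).trans ((hU h).trans (by gcongr))
      have h4 : ‖k‖ ≤ 2 / a * (ω / a + N * b) := by
        have := hk'.trans h3
        rw [div_mul_eq_mul_div, le_div_iff₀ ha]
        linarith
      calc |⟪x, k⟫_ℝ| ≤ ‖x‖ * ‖k‖ := abs_real_inner_le_norm _ _
        _ ≤ ξ * (2 / a * (ω / a + N * b)) := by gcongr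
        _ = 2 / a * (ξ * (ω / a) + N * ξ * b) := by ring
        _ ≤ _ := by
          refine mul_le_mul_of_nonneg_left ?_ (by positivity)
          have : 0 ≤ N * ξ * b := by positivity
          have : 0 ≤ N * m := by positivity
          linarith
    · have h3 : |f (X (e - h))| ≤ m + ξ * b := by
        rw [map_sub, map_sub, hx h]
        refine (abs_sub _ _).trans (add_le_add hm ?_)
        exact (abs_real_inner_le_norm _ _).trans (by gcongr)
      refine h3.trans ?_
      have h4 : 1 ≤ 2 / a * N := by
        rw [div_mul_eq_mul_div, le_div_iff₀ ha]; linarith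
      calc m + ξ * b = 1 * (m + ξ * b) := by ring
        _ ≤ (2 / a * N) * (m + ξ * b) := by gcongr
        _ = 2 / a * (N * ξ * b + N * m) := by ring
        _ ≤ _ := by
          refine mul_le_mul_of_nonneg_left ?_ (by positivity)
          have : 0 ≤ N * ξ * b := by positivity
          have : 0 ≤ ξ * (ω / a) := by positivity
          linarith
  have h3 : f ((X + U) h) - f (X e) = f (U h) - f (X (e - h)) := by
    simp only [LinearMap.add_apply, map_add, map_sub]; ring
  rw [h3]
  exact (abs_sub _ _).trans (add_le_add h1 h2)

end SubspacePerturbation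

/-! ### The deterministic bounds for matrices and their leading eigenvectors. -/

section PrincipalComponents

open scoped InnerProductSpace

theorem norm_toEuclideanLin_sq {p T : ℕ} (A : Matrix (Fin p) (Fin T) ℝ)
    (v : EuclideanSpace ℝ (Fin T)) :
    ‖A.toEuclideanLin v‖ ^ 2 = ∑ j, (∑ t, A j t * v t) ^ 2 := by
  rw [EuclideanSpace.norm_sq_eq]
  simp [Matrix.toLpLin_apply, Matrix.mulVec, dotProduct]

theorem adjoint_toEuclideanLin {p T : ℕ} (A : Matrix (Fin p) (Fin T) ℝ) :
    LinearMap.adjoint A.toEuclideanLin = A.transpose.toEuclideanLin := by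
  rw [← Matrix.toEuclideanLin_conjTranspose_eq_adjoint, Matrix.conjTranspose_eq_transpose_of_trivial]

/-- The span of the leading eigenvectors. -/
theorem exists_leading_eigenspace {p T L : ℕ} {Y : Matrix (Fin p) (Fin T) ℝ} {g : Fin T → ℝ}
    {e : Fin T → EuclideanSpace ℝ (Fin T)} (h : IsPCA Y g e) (hL : 1 ≤ L) (hLT : L ≤ T) {a : ℝ}
    (hag : a ^ 2 ≤ T * kthEigenvalue g L) :
    ∃ S : Submodule ℝ (EuclideanSpace ℝ (Fin T)), Module.finrank ℝ S = L ∧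
      (∀ h ∈ S, a * ‖h‖ ≤ ‖Y.toEuclideanLin h‖) ∧
      (∀ h ∈ S, ∀ v ∈ Sᗮ, ⟪Y.toEuclideanLin h, Y.toEuclideanLin v⟫_ℝ = 0) ∧
      ∀ j t, signalEstimator Y e L j t =
        Y.toEuclideanLin (S.starProjection (EuclideanSpace.single t 1)) j := by
  have hT : (T : ℝ) ≠ 0 := by
    have : 0 < T := by omega
    positivity
  set f : {k : Fin T // (k : ℕ) < L} → EuclideanSpace ℝ (Fin T) := fun k => e k.1
  have hf : Orthonormal ℝ f := h.orthonormal.comp _ Subtype.val_injective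
  -- The eigenvectors are those of Yᵀ Y / T, hence the factor T in the squared singular values of Y.
  have hadj : ∀ k, LinearMap.adjoint Y.toEuclideanLin (Y.toEuclideanLin (e k)) =
      ((T : ℝ) * g k) • e k := by
    intro k
    have h1 := h.eigen k
    rw [Matrix.smul_mulVec, one_div, inv_smul_eq_iff₀ hT, ← Matrix.mulVec_mulVec] at h1
    rw [adjoint_toEuclideanLin]
    ext i
    have := congrFun h1 i
    simpa [Matrix.toLpLin_apply, mul_assoc] using this
  have hinner : ∀ k v, ⟪Y.toEuclideanLin (e k), Y.toEuclideanLin v⟫_ℝ = T * g k * ⟪e k, v⟫_ℝ := by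
    intro k v
    rw [← LinearMap.adjoint_inner_left, hadj, real_inner_smul_left]
  have hglow : ∀ k : {k : Fin T // (k : ℕ) < L}, a ^ 2 ≤ T * g k.1 := by
    intro k
    refine hag.trans ?_
    have h1 : L - 1 < T := by omega
    -- Ranks are counted from 1 and indices from 0; L ≤ T excludes the default value 0.
    rw [kthEigenvalue, dif_pos h1]
    refine mul_le_mul_of_nonneg_left (h.antitone ?_) (by positivity)
    rw [Fin.le_def]
    have := k.2
    simp only
    omega
  refine ⟨Submodule.span ℝ (Set.range f), ?_, ?_, ?_, ?_⟩
  · rw [finrank_span_eq_card hf.linearIndependent]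
    rw [Fintype.card_subtype, Fin.card_filter_val_lt]
    omega
  · intro x hx
    obtain ⟨c, rfl⟩ := (Submodule.mem_span_range_iff_exists_fun ℝ).1 hx
    have h1 : ‖∑ i, c i • f i‖ ^ 2 = ∑ i, c i ^ 2 := by
      rw [← real_inner_self_eq_norm_sq, hf.inner_sum]
      simp [sq]
    have h2 : ‖Y.toEuclideanLin (∑ i, c i • f i)‖ ^ 2 = ∑ i, T * g i.1 * c i ^ 2 := by
      rw [← real_inner_self_eq_norm_sq]
      conv_lhs => rw [map_sum, sum_inner]
      refine Finset.sum_congr rfl fun i _ => ?_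
      rw [← map_sum, map_smul, real_inner_smul_left, hinner]
      have h3 : ⟪e i.1, ∑ i, c i • f i⟫_ℝ = c i := hf.inner_right_fintype c i
      rw [h3]
      ring
    refine le_of_sq_le_sq ?_ (norm_nonneg _)
    rw [mul_pow, h1, h2, Finset.mul_sum]
    exact Finset.sum_le_sum fun i _ => mul_le_mul_of_nonneg_right (hglow i) (sq_nonneg _)
  · intro x hx v hv
    obtain ⟨c, rfl⟩ := (Submodule.mem_span_range_iff_exists_fun ℝ).1 hx
    rw [map_sum, sum_inner]
    refine Finset.sum_eq_zero fun i _ => ?_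
    rw [map_smul, real_inner_smul_left, hinner,
      (Submodule.mem_orthogonal _ _).1 hv (e i.1) (Submodule.subset_span ⟨i, rfl⟩)]
    ring
  · intro j t
    have h1 : (Submodule.span ℝ (Set.range f)).starProjection (EuclideanSpace.single t 1) =
        ∑ i, e i.1 t • f i := by
      refine Submodule.eq_starProjection_of_mem_orthogonal ?_ ?_
      · exact Submodule.sum_mem _ fun i _ => Submodule.smul_mem _ _ (Submodule.subset_span ⟨i, rfl⟩)
      · rw [Submodule.mem_orthogonal]
        intro x hx
        induction hx using Submodule.span_induction with
        | mem x hx =>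
          obtain ⟨i, rfl⟩ := hx
          rw [inner_sub_right, hf.inner_right_fintype (fun i => e i.1 t) i]
          simp [f, EuclideanSpace.inner_single_right]
        | zero => simp
        | add x y _ _ hx hy => rw [inner_add_left, hx, hy, add_zero]
        | smul c x _ hx => rw [real_inner_smul_left, hx, mul_zero]
    rw [h1, signalEstimator, Matrix.mul_assoc]
    simp only [Matrix.mul_apply, Matrix.toLpLin_apply, Matrix.mulVec, dotProduct, f,
      Matrix.transpose_apply, Matrix.of_apply, WithLp.ofLp_sum, WithLp.ofLp_smul, Finset.sum_apply,
      Pi.smul_apply, smul_eq_mul]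
    refine Finset.sum_congr rfl fun s _ => ?_
    congr 1
    exact Finset.sum_congr rfl fun i _ => mul_comm _ _

/-- Deterministic bound for the reconstruction error of principal components. -/
theorem pca_reconstruction_bound {p T L : ℕ} {X U : Matrix (Fin p) (Fin T) ℝ} {g : Fin T → ℝ}
    {e : Fin T → EuclideanSpace ℝ (Fin T)} (h : IsPCA (X + U) g e) (hL : 1 ≤ L) (hLT : L ≤ T)
    {a : ℝ} (ha : 0 < a) (hag : a ^ 2 ≤ T * kthEigenvalue g L)
    (hrank : ∃ (B : Matrix (Fin p) (Fin L) ℝ) (F : Matrix (Fin L) (Fin T) ℝ), X = B * F)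
    {N η ξ ζ ω₁ ω₂ m y : ℝ} (hN : 0 ≤ N) (hη0 : 0 ≤ η) (hξ0 : 0 ≤ ξ) (hζ0 : 0 ≤ ζ)
    (hω₁0 : 0 ≤ ω₁) (hω₂0 : 0 ≤ ω₂) (hy0 : 0 ≤ y)
    (hU : ∀ v : Fin T → ℝ, ∑ j, (∑ t, U j t * v t) ^ 2 ≤ N ^ 2 * ∑ t, v t ^ 2)
    (j : Fin p) (t : Fin T)
    (hη : ∑ s, U j s ^ 2 ≤ η ^ 2) (hξ : ∑ s, X j s ^ 2 ≤ ξ ^ 2)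
    (hζ : ∑ i, (∑ s, X i s * U j s) ^ 2 ≤ ζ ^ 2)
    (hω₁ : ∑ s, (∑ i, X i s * U i t) ^ 2 ≤ ω₁ ^ 2)
    (hω₂ : ∑ s, (∑ i, U i s * U i t) ^ 2 ≤ ω₂ ^ 2)
    (hm : |X j t| ≤ m) (hy : ∑ i, X i t ^ 2 ≤ y ^ 2) :
    |signalEstimator (X + U) e L j t - X j t| ≤
      (ζ + N * η) / a * ((y + (ω₁ + ω₂) / a) / a) +
        2 / a * (ξ * ((ω₁ + ω₂) / a) + 2 * (N * ξ * ((y + (ω₁ + ω₂) / a) / a)) + N * m) := by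
  obtain ⟨S, hS, hlow, horth, hest⟩ := exists_leading_eigenspace h hL hLT hag
  have hsingle : ∀ A : Matrix (Fin p) (Fin T) ℝ, ∀ i,
      A.toEuclideanLin (EuclideanSpace.single t 1) i = A i t := by
    intro A i
    simp [Matrix.toLpLin_apply]
  have hinner : ∀ A : Matrix (Fin p) (Fin T) ℝ, ∀ v : EuclideanSpace ℝ (Fin T),
      A.toEuclideanLin v j = ⟪(WithLp.toLp 2 (A j) : EuclideanSpace ℝ (Fin T)), v⟫_ℝ := by
    intro A v
    simp [Matrix.toLpLin_apply, Matrix.mulVec, dotProduct, PiLp.inner_apply, mul_comm]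
  rw [map_add] at hlow horth hest
  have hrank' : Module.finrank ℝ (LinearMap.range X.toEuclideanLin) ≤ Module.finrank ℝ S := by
    obtain ⟨B, F, rfl⟩ := hrank
    rw [hS, Matrix.toLpLin_mul (p := 2) (q := 2) (r := 2)]
    refine (Submodule.finrank_mono (LinearMap.range_comp_le_range _ _)).trans ?_
    refine (LinearMap.finrank_range_le _).trans ?_
    simp
  have key := subspace_reconstruction_bound (N := N) (η := η) (ξ := ξ) (ζ := ζ) (ω := ω₁ + ω₂)
    (m := m) (y := y) hlow horth ?_ hN ha hrank' (WithLp.toLp 2 (X j)) (WithLp.toLp 2 (U j))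
    (EuclideanSpace.single t 1) (EuclideanSpace.proj j).toLinearMap (hinner X) (hinner U)
    ?_ ?_ ?_ ?_ ?_ ?_
  · rw [hest]
    have : X j t = X.toEuclideanLin (EuclideanSpace.single t 1) j := (hsingle X j).symm
    rw [this]
    exact key
  · intro v
    refine le_of_sq_le_sq ?_ (by positivity)
    rw [norm_toEuclideanLin_sq, mul_pow, EuclideanSpace.norm_sq_eq]
    simpa using hU v
  · refine le_of_sq_le_sq ?_ hη0
    rw [EuclideanSpace.norm_sq_eq]
    simpa using hη
  · refine le_of_sq_le_sq ?_ hξ0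
    rw [EuclideanSpace.norm_sq_eq]
    simpa using hξ
  · refine le_of_sq_le_sq ?_ hζ0
    rw [norm_toEuclideanLin_sq]
    exact hζ
  · rw [← map_add, adjoint_toEuclideanLin, Matrix.transpose_add, map_add, LinearMap.add_apply]
    refine (norm_add_le _ _).trans (add_le_add ?_ ?_)
    · refine le_of_sq_le_sq ?_ hω₁0
      rw [norm_toEuclideanLin_sq]
      simpa [hsingle] using hω₁
    · refine le_of_sq_le_sq ?_ hω₂0
      rw [norm_toEuclideanLin_sq]
      simpa [hsingle] using hω₂
  · exact (congrArg abs (hsingle X j)).trans_le hm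
  · refine le_of_sq_le_sq ?_ hy0
    rw [EuclideanSpace.norm_sq_eq]
    simpa [hsingle] using hy

/-- A large `L`-th eigenvalue forces the signal to be large. -/
theorem le_frobenius_add_of_kthEigenvalue {p T L : ℕ} {X U : Matrix (Fin p) (Fin T) ℝ}
    {g : Fin T → ℝ} {e : Fin T → EuclideanSpace ℝ (Fin T)} (h : IsPCA (X + U) g e) (hL : 1 ≤ L)
    (hLT : L ≤ T) {a N : ℝ} (hN : 0 ≤ N) (hag : a ^ 2 ≤ T * kthEigenvalue g L)
    (hU : ∀ v : Fin T → ℝ, ∑ j, (∑ t, U j t * v t) ^ 2 ≤ N ^ 2 * ∑ t, v t ^ 2) :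
    a ≤ √(∑ j, ∑ t, X j t ^ 2) + N := by
  obtain ⟨S, hS, hlow, -, -⟩ := exists_leading_eigenspace h hL hLT hag
  -- A single nonzero vector of S is enough: a‖v‖ ≤ ‖X v‖ + ‖U v‖, with the Frobenius norm bounding
  -- the first term.
  have hne : S ≠ ⊥ := by
    rintro rfl
    rw [finrank_bot] at hS
    omega
  obtain ⟨v, hv, hv0⟩ := Submodule.exists_mem_ne_zero_of_ne_bot hne
  have hv0' : 0 < ‖v‖ := norm_pos_iff.2 hv0
  have h1 := hlow v hv
  rw [map_add, LinearMap.add_apply] at h1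
  have h2 : ‖U.toEuclideanLin v‖ ≤ N * ‖v‖ := by
    refine le_of_sq_le_sq ?_ (by positivity)
    rw [norm_toEuclideanLin_sq, mul_pow, EuclideanSpace.norm_sq_eq]
    simpa using hU v
  have h3 : ‖X.toEuclideanLin v‖ ≤ √(∑ j, ∑ t, X j t ^ 2) * ‖v‖ := by
    refine le_of_sq_le_sq ?_ (by positivity)
    rw [norm_toEuclideanLin_sq, mul_pow, Real.sq_sqrt (by positivity), EuclideanSpace.norm_sq_eq,
      Finset.sum_mul]
    simp only [Real.norm_eq_abs, sq_abs]
    exact Finset.sum_le_sum fun j _ => Finset.sum_mul_sq_le_sq_mul_sq _ _ _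
  have h4 := h1.trans (norm_add_le _ _)
  nlinarith

end PrincipalComponents

/-! ### Exponential moments, even moments and tails of a centered Gaussian variable. -/

section Gaussian

/-- The integral is (1 - 2cσ)^{-1/2} for variance σ, at most √2 when 4cσ ≤ 1; the weaker constant 2
keeps later products simple. -/
theorem lintegral_exp_mul_sq_gaussianReal_le {σ : ℝ≥0} {c : ℝ} (hc : 4 * c * σ ≤ 1) :
    ∫⁻ x, ENNReal.ofReal (Real.exp (c * x ^ 2)) ∂(gaussianReal 0 σ) ≤ 2 := by
  rcases eq_or_ne σ 0 with rfl | hσ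
  · rw [gaussianReal_zero_var, lintegral_dirac]
    simp
  have hσ' : (0 : ℝ) < σ := by positivity
  set b : ℝ := 1 / (2 * σ) - c
  have hb : 1 / (4 * σ) ≤ b := by
    simp only [b]
    rw [le_sub_iff_add_le, div_add' _ _ _ (by positivity), div_le_div_iff₀ (by positivity)
      (by positivity)]
    nlinarith
  have hb0 : 0 < b := lt_of_lt_of_le (by positivity) hb
  rw [gaussianReal_of_var_ne_zero _ hσ,
    lintegral_withDensity_eq_lintegral_mul _ (measurable_gaussianPDF 0 σ) (by fun_prop)]
  have h1 : ∀ x : ℝ, (gaussianPDF 0 σ * fun x => ENNReal.ofReal (Real.exp (c * x ^ 2))) x =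
      ENNReal.ofReal ((√(2 * Real.pi * σ))⁻¹ * Real.exp (-b * x ^ 2)) := by
    intro x
    rw [Pi.mul_apply, gaussianPDF, ← ENNReal.ofReal_mul (gaussianPDFReal_nonneg 0 σ x),
      gaussianPDFReal, mul_assoc, ← Real.exp_add]
    congr 3
    simp only [b]
    field_simp
    ring
  simp_rw [h1]
  rw [← ofReal_integral_eq_lintegral_ofReal ((integrable_exp_neg_mul_sq hb0).const_mul _)
    (ae_of_all _ fun x => by positivity), integral_const_mul, integral_gaussian]
  rw [ENNReal.ofReal_le_iff_le_toReal (by simp), ENNReal.toReal_ofNat, inv_mul_le_iff₀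
    (by positivity)]
  refine Real.sqrt_le_iff.2 ⟨by positivity, ?_⟩
  rw [mul_pow, Real.sq_sqrt (by positivity), div_le_iff₀ hb0]
  have h2 : 1 ≤ b * (4 * σ) := by
    rwa [div_le_iff₀ (by positivity)] at hb
  nlinarith [Real.pi_pos, mul_le_mul_of_nonneg_left h2 Real.pi_pos.le]

variable {Ω : Type w} [MeasurableSpace Ω] {P : Measure Ω}

theorem lintegral_exp_mul_sq_le {Z : Ω → ℝ} {σ : ℝ≥0} (hZm : Measurable Z)
    (hZ : P.map Z = gaussianReal 0 σ) {c : ℝ} (hc : 4 * c * σ ≤ 1) :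
    ∫⁻ ω, ENNReal.ofReal (Real.exp (c * Z ω ^ 2)) ∂P ≤ 2 := by
  have h := lintegral_exp_mul_sq_gaussianReal_le hc
  rwa [← hZ, lintegral_map (by fun_prop) hZm] at h

/-- Integrate xⁿ/n! ≤ eˣ at x = Z²/(4C). -/
theorem lintegral_pow_two_mul_le {Z : Ω → ℝ} {σ : ℝ≥0} (hZm : Measurable Z)
    (hZ : P.map Z = gaussianReal 0 σ) {C : ℝ} (hC : 0 < C) (hσ : σ ≤ C) (n : ℕ) :
    ∫⁻ ω, ENNReal.ofReal (Z ω ^ (2 * n)) ∂P ≤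
      ENNReal.ofReal (2 * n.factorial * (4 * C) ^ n) := by
  have h1 : ∀ ω, ENNReal.ofReal (Z ω ^ (2 * n)) ≤ ENNReal.ofReal (n.factorial * (4 * C) ^ n) *
      ENNReal.ofReal (Real.exp ((1 / (4 * C)) * Z ω ^ 2)) := by
    intro ω
    rw [← ENNReal.ofReal_mul (by positivity)]
    refine ENNReal.ofReal_le_ofReal ?_
    have h2 := Real.pow_div_factorial_le_exp (x := 1 / (4 * C) * Z ω ^ 2) (by positivity) n
    rw [div_le_iff₀ (by positivity), mul_pow, one_div, inv_pow, inv_mul_le_iff₀ (by positivity),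
      ← pow_mul] at h2
    rw [one_div]
    linarith
  refine (lintegral_mono h1).trans ?_
  rw [lintegral_const_mul _ (by fun_prop)]
  refine (mul_le_mul_right (lintegral_exp_mul_sq_le hZm hZ ?_) _).trans ?_
  · rw [one_div, mul_assoc, mul_comm, mul_assoc, inv_mul_le_iff₀ (by positivity)]
    linarith
  · rw [← ENNReal.ofReal_ofNat 2, ← ENNReal.ofReal_mul (by positivity)]
    refine ENNReal.ofReal_le_ofReal (le_of_eq (by ring))

/-- Gaussian tail bound. -/
theorem measure_lt_sq_le {Z : Ω → ℝ} {σ : ℝ≥0} (hZm : Measurable Z)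
    (hZ : P.map Z = gaussianReal 0 σ) {C q : ℝ} (hC : 0 < C) (hq : 0 ≤ q) (hσ : σ ≤ C * q)
    (s : ℝ) :
    P {ω | s * q < Z ω ^ 2} ≤ ENNReal.ofReal (2 * Real.exp (-(s / (4 * C)))) := by
  -- For q = 0 the exponent 1/(4Cq) below is meaningless, but then Z vanishes almost surely and the
  -- strict inequality fails.
  rcases eq_or_lt_of_le hq with rfl | hq
  · have h0 : σ = 0 := by
      rw [mul_zero] at hσ
      exact le_antisymm (by exact_mod_cast hσ) zero_le
    rw [h0, gaussianReal_zero_var] at hZ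
    have hm : MeasurableSet {z : ℝ | s * 0 < z ^ 2} :=
      measurableSet_lt measurable_const (measurable_id.pow_const 2)
    have h1 : P {ω | s * 0 < Z ω ^ 2} = (P.map Z) {z | s * 0 < z ^ 2} :=
      (Measure.map_apply hZm hm).symm
    rw [h1, hZ, Measure.dirac_apply' _ hm]
    simp
  set c : ℝ := 1 / (4 * C * q)
  have h1 : {ω | s * q < Z ω ^ 2} ⊆ {ω | ENNReal.ofReal (Real.exp (s / (4 * C))) ≤
      ENNReal.ofReal (Real.exp (c * Z ω ^ 2))} := by
    intro ω hω
    refine ENNReal.ofReal_le_ofReal (Real.exp_le_exp.2 ?_)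
    simp only [c]
    rw [div_mul_eq_mul_div, one_mul, div_le_div_iff₀ (by positivity) (by positivity)]
    simp only [Set.mem_ofPred_eq] at hω
    nlinarith
  refine (measure_mono h1).trans ?_
  refine (meas_ge_le_lintegral_div (by fun_prop) (by simp [Real.exp_pos]) (by simp)).trans ?_
  rw [ENNReal.div_le_iff_le_mul (by simp [Real.exp_pos]) (by simp),
    ← ENNReal.ofReal_mul (by positivity), mul_assoc, ← Real.exp_add]
  simp only [neg_add_cancel, Real.exp_zero, mul_one]
  rw [ENNReal.ofReal_ofNat]
  refine lintegral_exp_mul_sq_le hZm hZ ?_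
  simp only [c]
  rw [mul_one_div, div_mul_eq_mul_div, div_le_one (by positivity)]
  linarith

end Gaussian

/-! ### Freezing one of two independent variables. -/

section Conditioning

variable {Ω : Type w} [MeasurableSpace Ω] {P : Measure Ω} [IsProbabilityMeasure P]
  {α β : Type*} [MeasurableSpace α] [MeasurableSpace β]

/-- By independence the joint law is a product, so Tonelli permits bounding the inner integral with
A fixed. Later this makes noise sums Gaussian with the signal or another noise column frozen. -/
theorem lintegral_le_of_indepFun {A : Ω → α} {B : Ω → β} (hAB : IndepFun A B P)
    (hA : Measurable A) (hB : Measurable B) {F : α × β → ℝ≥0∞} (hF : Measurable F)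
    {G : α → ℝ≥0∞} (h : ∀ a, ∫⁻ ω, F (a, B ω) ∂P ≤ G a) :
    ∫⁻ ω, F (A ω, B ω) ∂P ≤ ∫⁻ ω, G (A ω) ∂P := by
  have h1 : ∫⁻ ω, F (A ω, B ω) ∂P = ∫⁻ z, F z ∂(P.map fun ω => (A ω, B ω)) :=
    (lintegral_map hF (hA.prodMk hB)).symm
  have := Measure.isProbabilityMeasure_map (μ := P) hB.aemeasurable
  rw [h1, (indepFun_iff_map_prod_eq_prod_map_map hA.aemeasurable hB.aemeasurable).1 hAB,
    lintegral_prod _ hF.aemeasurable]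
  calc ∫⁻ a, ∫⁻ b, F (a, b) ∂(P.map B) ∂(P.map A) ≤ ∫⁻ a, G a ∂(P.map A) := by
        refine lintegral_mono fun a => ?_
        rw [lintegral_map (f := fun b => F (a, b)) (hF.comp measurable_prodMk_left) hB]
        exact h a
    _ ≤ _ := lintegral_map_le _ _

theorem measure_le_of_indepFun {A : Ω → α} {B : Ω → β} (hAB : IndepFun A B P)
    (hA : Measurable A) (hB : Measurable B) {D : Set (α × β)} (hD : MeasurableSet D)
    {ε : ℝ≥0∞} (h : ∀ a, P {ω | (a, B ω) ∈ D} ≤ ε) :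
    P {ω | (A ω, B ω) ∈ D} ≤ ε := by
  have h1 := lintegral_le_of_indepFun hAB hA hB (F := D.indicator 1)
    (measurable_one.indicator hD) (G := fun _ => ε) ?_
  · rw [lintegral_const, measure_univ, mul_one] at h1
    refine le_trans (le_of_eq ?_) h1
    exact (lintegral_indicator_one (hD.preimage (hA.prodMk hB))).symm
  · intro a
    refine le_trans (le_of_eq ?_) (h a)
    exact lintegral_indicator_one (hD.preimage (measurable_const.prodMk hB))

end Conditioning

/-! ### Linear combinations and rows of the Gaussian noise. -/

section Noise

set_option linter.unusedSectionVars false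

/-- Schur's test: every row and column of the Toeplitz matrix γ(i - j) has absolute sum at most C,
and |a_i a_j| ≤ (a_i² + a_j²)/2. Hence the noise covariance has operator norm at most C for every p.
-/
theorem abs_sum_mul_le_of_summable {γ : ℤ → ℝ} (hγ : Summable fun h => |γ h|) {C : ℝ}
    (hC : ∑' h, |γ h| ≤ C) {p : ℕ} (a : Fin p → ℝ) :
    |∑ i, ∑ j, a i * a j * γ ((i : ℤ) - (j : ℤ))| ≤ C * ∑ i, a i ^ 2 := by
  have hinj : ∀ f : Fin p → ℤ, Function.Injective f → ∑ j, |γ (f j)| ≤ C := by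
    intro f hf
    have h1 := hγ.sum_le_tsum (Finset.univ.map ⟨f, hf⟩) fun _ _ => abs_nonneg _
    rw [Finset.sum_map] at h1
    exact h1.trans hC
  have hrow : ∀ i : Fin p, ∑ j : Fin p, |γ ((i : ℤ) - (j : ℤ))| ≤ C := by
    intro i
    refine hinj _ fun j k h => ?_
    have : (j : ℤ) = k := by simpa using h
    exact Fin.ext (by exact_mod_cast this)
  have hcol : ∀ j : Fin p, ∑ i : Fin p, |γ ((i : ℤ) - (j : ℤ))| ≤ C := by
    intro j
    refine hinj _ fun i k h => ?_
    have : (i : ℤ) = k := by simpa using h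
    exact Fin.ext (by exact_mod_cast this)
  have hterm : ∀ i j : Fin p, |a i * a j * γ ((i : ℤ) - (j : ℤ))| ≤
      a i ^ 2 / 2 * |γ ((i : ℤ) - (j : ℤ))| + a j ^ 2 / 2 * |γ ((i : ℤ) - (j : ℤ))| := by
    intro i j
    rw [abs_mul, ← add_mul]
    refine mul_le_mul_of_nonneg_right ?_ (abs_nonneg _)
    rw [abs_le]
    constructor <;> nlinarith [sq_nonneg (a i - a j), sq_nonneg (a i + a j)]
  calc |∑ i, ∑ j, a i * a j * γ ((i : ℤ) - (j : ℤ))|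
      ≤ ∑ i, ∑ j, |a i * a j * γ ((i : ℤ) - (j : ℤ))| :=
        (Finset.abs_sum_le_sum_abs _ _).trans
          (Finset.sum_le_sum fun i _ => Finset.abs_sum_le_sum_abs _ _)
    _ ≤ ∑ i : Fin p, ∑ j : Fin p, (a i ^ 2 / 2 * |γ ((i : ℤ) - (j : ℤ))| +
          a j ^ 2 / 2 * |γ ((i : ℤ) - (j : ℤ))|) :=
        Finset.sum_le_sum fun i _ => Finset.sum_le_sum fun j _ => hterm i j
    _ = ∑ i : Fin p, a i ^ 2 / 2 * ∑ j : Fin p, |γ ((i : ℤ) - (j : ℤ))| +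
          ∑ j : Fin p, a j ^ 2 / 2 * ∑ i : Fin p, |γ ((i : ℤ) - (j : ℤ))| := by
        simp_rw [Finset.sum_add_distrib, Finset.mul_sum]
        congr 1
        exact Finset.sum_comm
    _ ≤ ∑ i, a i ^ 2 / 2 * C + ∑ j, a j ^ 2 / 2 * C := by
        gcongr with i _ j _
        · exact hrow i
        · exact hcol j
    _ = _ := by
        rw [← Finset.sum_add_distrib, Finset.mul_sum]
        exact Finset.sum_congr rfl fun i _ => by ring

variable {Ω : Type w} [MeasurableSpace Ω] {P : Measure Ω} [IsProbabilityMeasure P]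
  {X : ℕ → Ω → ℝ → ℝ} {p : ℕ} {u : ℕ → Ω → Fin p → ℝ} {γ : ℤ → ℝ}

namespace NoisyFDA.NoiseAssumption

theorem measurable_apply (hu : NoiseAssumption P X u γ) (t : ℕ) (i : Fin p) :
    Measurable fun ω => u t ω i :=
  (measurable_pi_apply i).comp (hu.measurable t)

theorem memLp (hu : NoiseAssumption P X u γ) (t : ℕ) (i : Fin p) :
    MemLp (fun ω => u t ω i) 2 P :=
  ((hu.gaussian t).eval i).memLp_two

theorem map_linear (hu : NoiseAssumption P X u γ) (hγ : Summable fun h => |γ h|) {C : ℝ}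
    (hC : ∑' h, |γ h| ≤ C) (t : ℕ) (a : Fin p → ℝ) :
    ∃ σ : ℝ≥0, P.map (fun ω => ∑ i, a i * u t ω i) = gaussianReal 0 σ ∧
      σ ≤ C * ∑ i, a i ^ 2 := by
  have h1 : HasGaussianLaw (fun ω => ∑ i, a i * u t ω i) P := by
    have := (hu.gaussian t).map_fun
      (∑ i, a i • (ContinuousLinearMap.proj i : (Fin p → ℝ) →L[ℝ] ℝ))
    simpa [sum_apply] using this
  have hmean : ∫ ω, ∑ i, a i * u t ω i ∂P = 0 := by
    rw [integral_finsetSum _ fun i _ => ((hu.memLp t i).integrable (by norm_num)).const_mul _]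
    simp [integral_const_mul, hu.mean_zero]
  have hvar : Var[fun ω => ∑ i, a i * u t ω i; P] =
      ∑ i, ∑ j, a i * a j * γ ((i : ℤ) - (j : ℤ)) := by
    rw [variance_fun_sum fun i => (hu.memLp t i).const_mul (a i)]
    refine Finset.sum_congr rfl fun i _ => Finset.sum_congr rfl fun j _ => ?_
    rw [covariance_const_mul_left, covariance_const_mul_right, hu.cov_eq]
    ring
  refine ⟨_, by rw [h1.map_eq_gaussianReal, hmean], ?_⟩
  rw [Real.coe_toNNReal _ (variance_nonneg _ _), hvar]
  exact (le_abs_self _).trans (abs_sum_mul_le_of_summable hγ hC a)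

theorem map_apply (hu : NoiseAssumption P X u γ) (hγ : Summable fun h => |γ h|) {C : ℝ}
    (hC : ∑' h, |γ h| ≤ C) (t : ℕ) (i : Fin p) :
    ∃ σ : ℝ≥0, P.map (fun ω => u t ω i) = gaussianReal 0 σ ∧ σ ≤ C := by
  obtain ⟨σ, h1, h2⟩ := hu.map_linear hγ hC t (Pi.single i 1)
  refine ⟨σ, ?_, ?_⟩
  · rw [← h1]
    simp [Pi.single_apply]
  · simpa [Pi.single_apply, ite_pow] using h2

/-- Here the sum runs over time at a fixed coordinate, so the variance is γ(0) ∑ x_t² by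
independence. `map_linear` is the counterpart along coordinates, where the full covariance matters.
-/
theorem map_weighted_sum (hu : NoiseAssumption P X u γ) (hγ : Summable fun h => |γ h|) {C : ℝ}
    (hC : ∑' h, |γ h| ≤ C) {T : ℕ} (x : Fin T → ℝ) (j : Fin p) :
    ∃ σ : ℝ≥0, P.map (fun ω => ∑ t, x t * u t ω j) = gaussianReal 0 σ ∧
      σ ≤ C * ∑ t, x t ^ 2 := by
  have hind : iIndepFun (fun (t : Fin T) ω => x t * u t ω j) P := by
    have h1 : iIndepFun (fun t : Fin T => u t) P :=
      hu.indep.precomp (g := fun t : Fin T => (t : ℕ)) Fin.val_injective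
    exact h1.comp (fun t z => x t * z j) fun t => by fun_prop
  have hL2 : ∀ t : Fin T, MemLp (fun ω => x t * u t ω j) 2 P := fun t =>
    (hu.memLp t j).const_mul _
  have h1 : HasGaussianLaw (fun ω => ∑ t : Fin T, x t * u t ω j) P := by
    refine hind.hasGaussianLaw_fun_sum fun t => ?_
    simpa using ((hu.gaussian t).eval j).fun_smul (x t)
  have hmean : ∫ ω, ∑ t : Fin T, x t * u t ω j ∂P = 0 := by
    rw [integral_finsetSum _ fun t _ => (hL2 t).integrable (by norm_num)]
    simp [integral_const_mul, hu.mean_zero]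
  have hvar : Var[fun ω => ∑ t : Fin T, x t * u t ω j; P] = γ 0 * ∑ t, x t ^ 2 := by
    have h2 := IndepFun.variance_sum (s := Finset.univ) (fun t _ => hL2 t)
      (fun s _ t _ hst => hind.indepFun hst)
    have h3 : (∑ t : Fin T, fun ω => x t * u t ω j) = fun ω => ∑ t : Fin T, x t * u t ω j := by
      ext; simp
    rw [h3] at h2
    rw [h2, Finset.mul_sum]
    refine Finset.sum_congr rfl fun t _ => ?_
    rw [variance_const_mul, ← covariance_self (hu.memLp t j).aemeasurable, hu.cov_eq, sub_self,
      mul_comm]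
  have hγ0 : γ 0 ≤ C := (le_abs_self _).trans ((hγ.le_tsum 0 fun _ _ => abs_nonneg _).trans hC)
  refine ⟨_, by rw [h1.map_eq_gaussianReal, hmean], ?_⟩
  rw [Real.coe_toNNReal _ (variance_nonneg _ _), hvar]
  gcongr

theorem lintegral_pow_le (hu : NoiseAssumption P X u γ) (hγ : Summable fun h => |γ h|) {C : ℝ}
    (hC : ∑' h, |γ h| ≤ C) (hC0 : 0 < C) (t : ℕ) (i : Fin p) (n : ℕ) :
    ∫⁻ ω, ENNReal.ofReal (u t ω i ^ (2 * n)) ∂P ≤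
      ENNReal.ofReal (2 * n.factorial * (4 * C) ^ n) := by
  obtain ⟨σ, h1, h2⟩ := hu.map_apply hγ hC t i
  exact lintegral_pow_two_mul_le (hu.measurable_apply t i) h1 hC0 h2 n

/-- Uniform bound for the rows of the noise matrix. -/
theorem measure_exists_row_le (hu : NoiseAssumption P X u γ) (hγ : Summable fun h => |γ h|) {C : ℝ}
    (hC : ∑' h, |γ h| ≤ C) (hC0 : 0 < C) (T : ℕ) (M : ℝ) :
    P {ω | ∃ j, M * T < ∑ t : Fin T, u t ω j ^ 2} ≤
      ENNReal.ofReal (p * (2 * Real.exp (-(M / (4 * C)))) ^ T) := by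
  have h1 : ∀ j, P {ω | M * T < ∑ t : Fin T, u t ω j ^ 2} ≤
      ENNReal.ofReal ((2 * Real.exp (-(M / (4 * C)))) ^ T) := by
    intro j
    -- Chernoff bound: each factor has mean at most 2 by the choice of exponent 1/(4C), and the
    -- factors are independent over time.
    set F : Fin T → Ω → ℝ≥0∞ := fun t ω => ENNReal.ofReal (Real.exp (1 / (4 * C) * u t ω j ^ 2))
    have hFm : ∀ t, Measurable (F t) := fun t => by
      have := hu.measurable_apply t j
      fun_prop
    have hind : iIndepFun F P := by
      have h1 : iIndepFun (fun t : Fin T => u t) P :=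
        hu.indep.precomp (g := fun t : Fin T => (t : ℕ)) Fin.val_injective
      exact h1.comp (fun t z => ENNReal.ofReal (Real.exp (1 / (4 * C) * z j ^ 2))) fun t => by
        fun_prop
    have hprod : ∫⁻ ω, ∏ t, F t ω ∂P ≤ 2 ^ T := by
      rw [lintegral_prod_eq_prod_lintegral_of_indepFun Finset.univ F hind hFm]
      calc ∏ t, ∫⁻ ω, F t ω ∂P ≤ ∏ _t : Fin T, 2 := by
            refine Finset.prod_le_prod' fun t _ => ?_
            obtain ⟨σ, h1, h2⟩ := hu.map_apply hγ hC t j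
            refine lintegral_exp_mul_sq_le (hu.measurable_apply t j) h1 ?_
            rw [mul_one_div, div_mul_eq_mul_div, div_le_one (by positivity)]
            linarith
        _ = 2 ^ T := by simp
    have hsub : {ω | M * T < ∑ t : Fin T, u t ω j ^ 2} ⊆
        {ω | ENNReal.ofReal (Real.exp (M / (4 * C) * T)) ≤ ∏ t, F t ω} := by
      intro ω hω
      simp only [Set.mem_ofPred_eq, F] at hω ⊢
      rw [← ENNReal.ofReal_prod_of_nonneg fun t _ => (Real.exp_pos _).le, ← Real.exp_sum,
        ← Finset.mul_sum]
      refine ENNReal.ofReal_le_ofReal (Real.exp_le_exp.2 ?_)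
      rw [div_mul_eq_mul_div, div_mul_eq_mul_div, one_mul]
      gcongr
    refine (measure_mono hsub).trans ?_
    refine (meas_ge_le_lintegral_div (Finset.aemeasurable_fun_prod _ fun t _ => (hFm t).aemeasurable)
      (by simp [Real.exp_pos]) (by simp)).trans ?_
    rw [ENNReal.div_le_iff_le_mul (by simp [Real.exp_pos]) (by simp),
      ← ENNReal.ofReal_mul (by positivity)]
    refine hprod.trans (le_of_eq ?_)
    rw [mul_pow, ← Real.exp_nat_mul, mul_assoc, ← Real.exp_add]
    have : (T : ℝ) * -(M / (4 * C)) + M / (4 * C) * T = 0 := by ring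
    rw [this, Real.exp_zero, mul_one, ENNReal.ofReal_pow (by norm_num), ENNReal.ofReal_ofNat]
  have h2 : {ω | ∃ j, M * T < ∑ t : Fin T, u t ω j ^ 2} =
      ⋃ j, {ω | M * T < ∑ t : Fin T, u t ω j ^ 2} := by
    ext; simp
  rw [h2]
  refine (measure_iUnion_fintype_le _ _).trans ((Finset.sum_le_sum fun j _ => h1 j).trans ?_)
  rw [Finset.sum_const, Finset.card_univ, Fintype.card_fin, nsmul_eq_mul,
    ENNReal.ofReal_mul (by positivity), ENNReal.ofReal_natCast]

end NoisyFDA.NoiseAssumption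

end Noise

/-! ### The operator norm of the noise matrix. -/

section NoiseMatrix

/-- The operator norm of `U` from the entries of `U Uᵀ`. -/
theorem sum_mulVec_sq_le {γ : ℤ → ℝ} (hγ : Summable fun h => |γ h|) {C : ℝ}
    (hC : ∑' h, |γ h| ≤ C) {p T : ℕ} (U : Fin p → Fin T → ℝ) {Q : ℝ} (hQ : 0 ≤ Q)
    (hD : ∑ i, ∑ j, (∑ t, U i t * U j t - T * γ ((i : ℤ) - (j : ℤ))) ^ 2 ≤ Q ^ 2)
    (v : Fin T → ℝ) :
    ∑ j, (∑ t, U j t * v t) ^ 2 ≤ (T * C + Q) * ∑ t, v t ^ 2 := by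
  set w : Fin p → ℝ := fun j => ∑ t, U j t * v t
  set z : Fin T → ℝ := fun t => ∑ j, U j t * w j
  set A : ℝ := ∑ j, w j ^ 2
  have hA0 : 0 ≤ A := by positivity
  have hA : A = ∑ t, v t * z t := by
    simp only [A, z, Finset.mul_sum, sq]
    rw [Finset.sum_comm]
    refine Finset.sum_congr rfl fun j _ => ?_
    rw [← sq, sq]
    conv_lhs => rw [show w j = ∑ t, U j t * v t from rfl]
    rw [Finset.sum_mul]
    exact Finset.sum_congr rfl fun t _ => by simp only [w]; ring
  -- With w = U v and z = Uᵀ w, A = ‖w‖² equals ⟨v, z⟩. Bounding ‖z‖² = ⟨w, U Uᵀ w⟩ by (TC + Q) A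
  -- and cancelling one factor A gives the claim; Q is the Frobenius distance of U Uᵀ from its mean.
  have hA2 : A ^ 2 ≤ (∑ t, v t ^ 2) * ∑ t, z t ^ 2 := by
    rw [hA]
    exact Finset.sum_mul_sq_le_sq_mul_sq _ _ _
  have hz : ∑ t, z t ^ 2 = ∑ i, ∑ j, w i * w j * ∑ t, U i t * U j t := by
    have : ∀ t, z t ^ 2 = ∑ i, ∑ j, w i * w j * (U i t * U j t) := by
      intro t
      rw [sq, Finset.sum_mul_sum]
      exact Finset.sum_congr rfl fun i _ => Finset.sum_congr rfl fun j _ => by ring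
    simp_rw [this, Finset.mul_sum]
    rw [Finset.sum_comm]
    exact Finset.sum_congr rfl fun i _ => Finset.sum_comm
  have hz2 : ∑ t, z t ^ 2 = ∑ i, ∑ j, w i * w j *
      (∑ t, U i t * U j t - T * γ ((i : ℤ) - (j : ℤ))) +
      T * ∑ i, ∑ j, w i * w j * γ ((i : ℤ) - (j : ℤ)) := by
    rw [hz, Finset.mul_sum, ← Finset.sum_add_distrib]
    refine Finset.sum_congr rfl fun i _ => ?_
    rw [Finset.mul_sum, ← Finset.sum_add_distrib]
    exact Finset.sum_congr rfl fun j _ => by ring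
  have h1 : ∑ i, ∑ j, w i * w j * (∑ t, U i t * U j t - T * γ ((i : ℤ) - (j : ℤ))) ≤ A * Q := by
    refine le_of_sq_le_sq ?_ (by positivity)
    rw [← Fintype.sum_prod_type' (f := fun i j => w i * w j *
      (∑ t, U i t * U j t - T * γ ((i : ℤ) - (j : ℤ))))]
    refine (Finset.sum_mul_sq_le_sq_mul_sq _ _ _).trans ?_
    rw [mul_pow]
    refine mul_le_mul ?_ ?_ (by positivity) (by positivity)
    · rw [Fintype.sum_prod_type' (f := fun i j => (w i * w j) ^ 2)]
      simp only [A, sq (∑ j, w j ^ 2), Finset.sum_mul_sum, mul_pow]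
      exact le_rfl
    · rw [Fintype.sum_prod_type' (f := fun i j =>
        (∑ t, U i t * U j t - T * γ ((i : ℤ) - (j : ℤ))) ^ 2)]
      exact hD
  have h2 : T * ∑ i, ∑ j, w i * w j * γ ((i : ℤ) - (j : ℤ)) ≤ T * (C * A) := by
    gcongr
    exact (le_abs_self _).trans (abs_sum_mul_le_of_summable hγ hC w)
  rcases eq_or_lt_of_le hA0 with h0 | h0
  · rw [← h0]
    have hC0 : 0 ≤ C := le_trans (tsum_nonneg fun _ => abs_nonneg _) hC
    positivity
  · have h3 : A * A ≤ ((T * C + Q) * ∑ t, v t ^ 2) * A := by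
      calc A * A = A ^ 2 := (sq A).symm
        _ ≤ (∑ t, v t ^ 2) * ∑ t, z t ^ 2 := hA2
        _ ≤ (∑ t, v t ^ 2) * (A * Q + T * (C * A)) := by
          rw [hz2]
          gcongr
        _ = _ := by ring
    exact le_of_mul_le_mul_right h3 h0

set_option linter.unusedSectionVars false

variable {Ω : Type w} [MeasurableSpace Ω] {P : Measure Ω} [IsProbabilityMeasure P]
  {X : ℕ → Ω → ℝ → ℝ} {p : ℕ} {u : ℕ → Ω → Fin p → ℝ} {γ : ℤ → ℝ}

namespace NoisyFDA.NoiseAssumption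

theorem memLp_mul (hu : NoiseAssumption P X u γ) (t : ℕ) (i j : Fin p) :
    MemLp (fun ω => u t ω i * u t ω j) 2 P := by
  have h : ∀ k, MemLp (fun ω => u t ω k) 4 P := fun k =>
    ((hu.gaussian t).eval k).memLp (by norm_num)
  have : ENNReal.HolderTriple 4 4 2 := ⟨by
    rw [← two_mul, show (4 : ℝ≥0∞) = 2 * 2 by norm_num,
      ENNReal.mul_inv (Or.inl (by norm_num)) (Or.inl (by norm_num)), ← mul_assoc,
      ENNReal.mul_inv_cancel (by norm_num) (by norm_num), one_mul]⟩
  exact (h j).mul (h i)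

/-- The left side is the variance of a sum of T independent products. Each product has variance at
most E(u_i u_j)² ≤ (E u_i⁴ + E u_j⁴)/2, and 64 C² = 2 · 2! · (4C)² is the fourth moment bound. -/
theorem lintegral_sq_sampleCov_sub_le (hu : NoiseAssumption P X u γ)
    (hγ : Summable fun h => |γ h|) {C : ℝ} (hC : ∑' h, |γ h| ≤ C) (hC0 : 0 < C) (T : ℕ)
    (i j : Fin p) :
    ∫⁻ ω, ENNReal.ofReal ((∑ t : Fin T, u t ω i * u t ω j - T * γ ((i : ℤ) - (j : ℤ))) ^ 2) ∂P ≤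
      ENNReal.ofReal (T * (64 * C ^ 2)) := by
  have hind : iIndepFun (fun (t : Fin T) ω => u t ω i * u t ω j) P := by
    have h1 : iIndepFun (fun t : Fin T => u t) P :=
      hu.indep.precomp (g := fun t : Fin T => (t : ℕ)) Fin.val_injective
    exact h1.comp (fun t z => z i * z j) fun t => by fun_prop
  have hmean : ∫ ω, ∑ t : Fin T, u t ω i * u t ω j ∂P = T * γ ((i : ℤ) - (j : ℤ)) := by
    rw [integral_finsetSum _ fun (t : Fin T) _ =>
      (hu.memLp_mul t i j).integrable (by norm_num)]
    have : ∀ t : Fin T, ∫ ω, u t ω i * u t ω j ∂P = γ ((i : ℤ) - (j : ℤ)) := by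
      intro t
      have := covariance_eq_sub (hu.memLp t i) (hu.memLp t j)
      rw [hu.cov_eq, hu.mean_zero, zero_mul, sub_zero] at this
      exact this.symm
    simp [this]
  have hvar : Var[fun ω => ∑ t : Fin T, u t ω i * u t ω j; P] =
      ∑ t : Fin T, Var[fun ω => u t ω i * u t ω j; P] := by
    have h2 := IndepFun.variance_sum (s := Finset.univ) (fun (t : Fin T) _ => hu.memLp_mul t i j)
      (fun s _ t _ hst => hind.indepFun hst)
    rw [← h2]
    congr 1
    ext; simp
  have hvar1 : ∀ t : Fin T, Var[fun ω => u t ω i * u t ω j; P] ≤ 64 * C ^ 2 := by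
    intro t
    refine (variance_le_expectation_sq (hu.memLp_mul t i j).aestronglyMeasurable).trans ?_
    change ∫ ω, (u t ω i * u t ω j) ^ 2 ∂P ≤ _
    rw [integral_eq_lintegral_of_nonneg_ae (ae_of_all _ fun ω => sq_nonneg _)
      ((hu.memLp_mul t i j).aestronglyMeasurable.pow 2)]
    refine ENNReal.toReal_le_of_le_ofReal (by positivity) ?_
    have h4 : ∀ k, ∫⁻ ω, ENNReal.ofReal (u t ω k ^ 4) ∂P ≤ ENNReal.ofReal (64 * C ^ 2) := by
      intro k
      refine (hu.lintegral_pow_le hγ hC hC0 t k 2).trans (ENNReal.ofReal_le_ofReal (le_of_eq ?_))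
      norm_num [Nat.factorial]
      ring
    calc ∫⁻ ω, ENNReal.ofReal ((u t ω i * u t ω j) ^ 2) ∂P
        ≤ ∫⁻ ω, (ENNReal.ofReal (1 / 2) * ENNReal.ofReal (u t ω i ^ 4) +
            ENNReal.ofReal (1 / 2) * ENNReal.ofReal (u t ω j ^ 4)) ∂P := by
          refine lintegral_mono fun ω => ?_
          rw [← ENNReal.ofReal_mul (by norm_num), ← ENNReal.ofReal_mul (by norm_num),
            ← ENNReal.ofReal_add (by positivity) (by positivity)]
          refine ENNReal.ofReal_le_ofReal ?_
          nlinarith [sq_nonneg (u t ω i ^ 2 - u t ω j ^ 2)]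
      _ = ENNReal.ofReal (1 / 2) * ∫⁻ ω, ENNReal.ofReal (u t ω i ^ 4) ∂P +
            ENNReal.ofReal (1 / 2) * ∫⁻ ω, ENNReal.ofReal (u t ω j ^ 4) ∂P := by
          have := hu.measurable_apply t i
          have := hu.measurable_apply t j
          rw [lintegral_add_left (by fun_prop), lintegral_const_mul _ (by fun_prop),
            lintegral_const_mul _ (by fun_prop)]
      _ ≤ ENNReal.ofReal (1 / 2) * ENNReal.ofReal (64 * C ^ 2) +
            ENNReal.ofReal (1 / 2) * ENNReal.ofReal (64 * C ^ 2) := by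
          gcongr <;> exact h4 _
      _ = _ := by
          rw [← ENNReal.ofReal_mul (by norm_num),
            ← ENNReal.ofReal_add (by positivity) (by positivity)]
          congr 1
          ring
  have hL2 : MemLp (fun ω => ∑ t : Fin T, u t ω i * u t ω j) 2 P :=
    memLp_finsetSum _ fun t _ => hu.memLp_mul t i j
  have hev : ∫⁻ ω, ENNReal.ofReal
      ((∑ t : Fin T, u t ω i * u t ω j - T * γ ((i : ℤ) - (j : ℤ))) ^ 2) ∂P =
      evariance (fun ω => ∑ t : Fin T, u t ω i * u t ω j) P := by
    rw [evariance_eq_lintegral_ofReal, hmean]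
  rw [hev, ← hL2.ofReal_variance_eq, hvar]
  refine ENNReal.ofReal_le_ofReal ((Finset.sum_le_sum fun t _ => hvar1 t).trans ?_)
  simp

/-- Bound in probability for the operator norm of the noise matrix. -/
theorem measure_exists_mulVec_le (hu : NoiseAssumption P X u γ)
    (hγ : Summable fun h => |γ h|) {C : ℝ} (hC : ∑' h, |γ h| ≤ C) (hC0 : 0 < C) {T : ℕ}
    (hT : 0 < T) (hp : 0 < p) {M : ℝ} (hM : 0 < M) :
    P {ω | ∃ v : Fin T → ℝ, (T * C + M * (p * √T)) * ∑ t, v t ^ 2 <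
        ∑ j, (∑ t : Fin T, u t ω j * v t) ^ 2} ≤ ENNReal.ofReal (64 * C ^ 2 / M ^ 2) := by
  set Q : ℝ := M * (p * √T)
  have hQ : 0 < Q := by positivity
  set D : Ω → Fin p → Fin p → ℝ := fun ω i j =>
    (∑ t : Fin T, u t ω i * u t ω j - T * γ ((i : ℤ) - (j : ℤ))) ^ 2
  have hDm : ∀ i j, Measurable fun ω => ENNReal.ofReal (D ω i j) := by
    intro i j
    have := fun t => hu.measurable_apply t i
    have := fun t => hu.measurable_apply t j
    fun_prop
  have hsub : {ω | ∃ v : Fin T → ℝ, (T * C + Q) * ∑ t, v t ^ 2 <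
        ∑ j, (∑ t : Fin T, u t ω j * v t) ^ 2} ⊆
      {ω | ENNReal.ofReal (Q ^ 2) ≤ ∑ i, ∑ j, ENNReal.ofReal (D ω i j)} := by
    rintro ω ⟨v, hv⟩
    by_contra hcon
    simp only [Set.mem_ofPred_eq, not_le] at hcon
    refine absurd hv (not_lt.2 ?_)
    refine sum_mulVec_sq_le hγ hC (fun j t => u t ω j) hQ.le ?_ v
    have h1 : ∑ i, ∑ j, ENNReal.ofReal (D ω i j) = ENNReal.ofReal (∑ i, ∑ j, D ω i j) := by
      rw [ENNReal.ofReal_sum_of_nonneg fun i _ => Finset.sum_nonneg fun j _ => sq_nonneg _]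
      refine Finset.sum_congr rfl fun i _ => ?_
      rw [ENNReal.ofReal_sum_of_nonneg fun j _ => sq_nonneg _]
    rw [h1] at hcon
    exact ((ENNReal.ofReal_lt_ofReal_iff (by positivity)).1 hcon).le
  refine (measure_mono hsub).trans ((meas_ge_le_lintegral_div ?_ ?_ ?_).trans ?_)
  · exact (Finset.measurable_sum _ fun i _ => Finset.measurable_sum _ fun j _ =>
      hDm i j).aemeasurable
  · simp [hQ.ne']
  · simp
  -- Summing over the p² entries gives expectation of order p² T, matching the square of the
  -- threshold M p √T.
  · have h2 : ∫⁻ ω, ∑ i, ∑ j, ENNReal.ofReal (D ω i j) ∂P ≤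
        ENNReal.ofReal (p * (p * (T * (64 * C ^ 2)))) := by
      rw [lintegral_finsetSum _ fun i _ => Finset.measurable_sum _ fun j _ => hDm i j]
      simp_rw [lintegral_finsetSum _ fun j _ => hDm _ j]
      refine (Finset.sum_le_sum fun i _ => Finset.sum_le_sum fun j _ =>
        hu.lintegral_sq_sampleCov_sub_le hγ hC hC0 T i j).trans (le_of_eq ?_)
      simp only [Finset.sum_const, Finset.card_univ, Fintype.card_fin, nsmul_eq_mul]
      rw [ENNReal.ofReal_mul (Nat.cast_nonneg p), ENNReal.ofReal_mul (Nat.cast_nonneg p),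
        ENNReal.ofReal_natCast]
    refine (ENNReal.div_le_div_right h2 _).trans ?_
    rw [← ENNReal.ofReal_div_of_pos (by positivity)]
    refine ENNReal.ofReal_le_ofReal (le_of_eq ?_)
    simp only [Q]
    rw [mul_pow, mul_pow, Real.sq_sqrt (by positivity)]
    have : (T : ℝ) ≠ 0 := by positivity
    have : (p : ℝ) ≠ 0 := by positivity
    field_simp

end NoisyFDA.NoiseAssumption

end NoiseMatrix

/-! ### Products of the noise with the signal and with itself. -/

section CrossProducts

set_option linter.unusedSectionVars false

variable {Ω : Type w} [MeasurableSpace Ω] {P : Measure Ω} [IsProbabilityMeasure P]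

/-- Markov's inequality for the square of a maximum. -/
theorem measure_exists_lt_le_of_lintegral_sq {ι : Type*} [Fintype ι] {Z : ι → Ω → ℝ}
    (hZm : ∀ i, Measurable (Z i)) {a b : ℝ} (ha : 0 < a)
    (hZ : ∀ i, ∫⁻ ω, ENNReal.ofReal (Z i ω ^ 2) ∂P ≤ ENNReal.ofReal b) :
    P {ω | ∃ i, a < Z i ω} ≤ ENNReal.ofReal (Fintype.card ι * (b / a ^ 2)) := by
  have h1 : ∀ i, P {ω | a < Z i ω} ≤ ENNReal.ofReal (b / a ^ 2) := by
    intro i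
    have hsub : {ω | a < Z i ω} ⊆ {ω | ENNReal.ofReal (a ^ 2) ≤ ENNReal.ofReal (Z i ω ^ 2)} := by
      intro ω hω
      simp only [Set.mem_ofPred_eq] at hω ⊢
      exact ENNReal.ofReal_le_ofReal (by gcongr)
    refine (measure_mono hsub).trans ?_
    have := hZm i
    refine (meas_ge_le_lintegral_div (by fun_prop) (by simp [ha.ne']) (by simp)).trans ?_
    rw [ENNReal.ofReal_div_of_pos (by positivity)]
    exact ENNReal.div_le_div_right (hZ i) _
  have h2 : {ω | ∃ i, a < Z i ω} = ⋃ i, {ω | a < Z i ω} := by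
    ext; simp
  rw [h2]
  refine (measure_iUnion_fintype_le _ _).trans ((Finset.sum_le_sum fun i _ => h1 i).trans ?_)
  rw [Finset.sum_const, Finset.card_univ, nsmul_eq_mul,
    ENNReal.ofReal_mul (by positivity), ENNReal.ofReal_natCast]

variable {X : ℕ → Ω → ℝ → ℝ} {p : ℕ} {u : ℕ → Ω → Fin p → ℝ} {γ : ℤ → ℝ}

namespace NoisyFDA.NoiseAssumption

theorem indepFun_grid (hu : NoiseAssumption P X u γ) {s : Fin p → ℝ}
    (hs : ∀ j, s j ∈ Set.Icc (0 : ℝ) 1) (T : ℕ) :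
    IndepFun (fun ω (t : Fin T) (i : Fin p) => X t ω (s i)) (fun ω (t : ℕ) => u t ω) P := by
  have := hu.indep_signal.comp
    (φ := fun z (t : Fin T) (i : Fin p) => z ((t : ℕ), (⟨s i, hs i⟩ : Set.Icc (0 : ℝ) 1)))
    (ψ := id) (by fun_prop) measurable_id
  exact this

/-- Uniform bound for the products of signal and rows of the noise matrix. -/
theorem measure_exists_signal_mul_row_le (hu : NoiseAssumption P X u γ)
    (hγ : Summable fun h => |γ h|) {C : ℝ} (hC : ∑' h, |γ h| ≤ C) (hC0 : 0 < C) {s : Fin p → ℝ}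
    (hs : ∀ j, s j ∈ Set.Icc (0 : ℝ) 1)
    (hX : ∀ t, ∀ r ∈ Set.Icc (0 : ℝ) 1, Measurable fun ω => X t ω r) (T : ℕ) (q : ℝ) :
    P {ω | ∃ j, q * (∑ i, ∑ t : Fin T, X t ω (s i) ^ 2) <
        ∑ i, (∑ t : Fin T, X t ω (s i) * u t ω j) ^ 2} ≤
      ENNReal.ofReal (p ^ 2 * (2 * Real.exp (-(q / (4 * C))))) := by
  have h1 : ∀ i j, P {ω | q * (∑ t : Fin T, X t ω (s i) ^ 2) <
      (∑ t : Fin T, X t ω (s i) * u t ω j) ^ 2} ≤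
      ENNReal.ofReal (2 * Real.exp (-(q / (4 * C)))) := by
    intro i j
    have h2 := measure_le_of_indepFun (hu.indepFun_grid hs T)
      (measurable_pi_lambda _ fun t => measurable_pi_lambda _ fun i => hX t _ (hs i))
      (measurable_pi_lambda _ hu.measurable)
      (D := {z : (Fin T → Fin p → ℝ) × (ℕ → Fin p → ℝ) | q * (∑ t : Fin T, z.1 t i ^ 2) <
        (∑ t : Fin T, z.1 t i * z.2 t j) ^ 2})
      (measurableSet_lt (by fun_prop) (by fun_prop))
      (ε := ENNReal.ofReal (2 * Real.exp (-(q / (4 * C))))) ?_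
    · exact h2
    · intro a
      obtain ⟨σ, h3, h4⟩ := hu.map_weighted_sum hγ hC (fun t => a t i) j
      refine measure_lt_sq_le ?_ h3 hC0 (by positivity) h4 q
      have := fun t => hu.measurable_apply t j
      fun_prop
  have h2 : {ω | ∃ j, q * (∑ i, ∑ t : Fin T, X t ω (s i) ^ 2) <
        ∑ i, (∑ t : Fin T, X t ω (s i) * u t ω j) ^ 2} ⊆
      ⋃ j, ⋃ i, {ω | q * (∑ t : Fin T, X t ω (s i) ^ 2) <
        (∑ t : Fin T, X t ω (s i) * u t ω j) ^ 2} := by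
    rintro ω ⟨j, hj⟩
    -- If the sum over i exceeds q times the total energy, some single i exceeds q times its own row
    -- energy. The bound is thus relative to the random signal and needs only the conditional
    -- Gaussian tail, over p² pairs.
    rw [Finset.mul_sum] at hj
    obtain ⟨i, -, hi⟩ := Finset.exists_lt_of_sum_lt hj
    exact Set.mem_iUnion.2 ⟨j, Set.mem_iUnion.2 ⟨i, hi⟩⟩
  refine (measure_mono h2).trans ((measure_iUnion_fintype_le _ _).trans ?_)
  refine (Finset.sum_le_sum fun j _ => (measure_iUnion_fintype_le _ _).trans
    (Finset.sum_le_sum fun i _ => h1 i j)).trans (le_of_eq ?_)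
  simp only [Finset.sum_const, Finset.card_univ, Fintype.card_fin, nsmul_eq_mul]
  rw [← ENNReal.ofReal_natCast, ← ENNReal.ofReal_mul (by positivity),
    ← ENNReal.ofReal_mul (by positivity), sq, mul_assoc (p : ℝ)]

/-- With A = a frozen the sum is Gaussian of variance at most C ∑ a_i², so its fourth moment is at
most 64 C² (∑ a_i²)², and (∑ a_i²)² ≤ p ∑ a_i⁴. The result grows like p² rather than p⁴. -/
theorem lintegral_inner_pow_four_le (hu : NoiseAssumption P X u γ)
    (hγ : Summable fun h => |γ h|) {C : ℝ} (hC : ∑' h, |γ h| ≤ C) (hC0 : 0 < C) {t : ℕ}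
    {A : Ω → Fin p → ℝ} (hA : Measurable A) (hind : IndepFun A (u t) P) {Q : ℝ}
    (hAQ : ∀ i, ∫⁻ ω, ENNReal.ofReal (A ω i ^ 4) ∂P ≤ ENNReal.ofReal Q) :
    ∫⁻ ω, ENNReal.ofReal ((∑ i, A ω i * u t ω i) ^ 4) ∂P ≤
      ENNReal.ofReal (64 * C ^ 2 * (p ^ 2 * Q)) := by
  have h1 : ∀ a : Fin p → ℝ, ∫⁻ ω, ENNReal.ofReal ((∑ i, a i * u t ω i) ^ 4) ∂P ≤
      ENNReal.ofReal (64 * C ^ 2 * p) * ∑ i, ENNReal.ofReal (a i ^ 4) := by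
    intro a
    obtain ⟨σ, h2, h3⟩ := hu.map_linear hγ hC t a
    have hm : Measurable fun ω => ∑ i, a i * u t ω i := by
      have := hu.measurable_apply t
      fun_prop
    rcases eq_or_lt_of_le (show 0 ≤ ∑ i, a i ^ 2 by positivity) with h0 | h0
    · have ha : ∀ i, a i = 0 := by
        intro i
        have := (Finset.sum_eq_zero_iff_of_nonneg fun i _ => sq_nonneg (a i)).1 h0.symm i
          (Finset.mem_univ i)
        simpa using this
      simp [ha]
    · refine (lintegral_pow_two_mul_le hm h2 (mul_pos hC0 h0) h3 2).trans ?_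
      rw [← ENNReal.ofReal_sum_of_nonneg fun i _ => by positivity,
        ← ENNReal.ofReal_mul (by positivity)]
      refine ENNReal.ofReal_le_ofReal ?_
      have h4 := sq_sum_le_card_mul_sum_sq (s := Finset.univ) (f := fun i => a i ^ 2)
      simp only [Finset.card_univ, Fintype.card_fin, ← pow_mul] at h4
      norm_num [Nat.factorial] at h4 ⊢
      calc 4 * (4 * (C * ∑ i, a i ^ 2)) ^ 2 = 64 * C ^ 2 * (∑ i, a i ^ 2) ^ 2 := by ring
        _ ≤ 64 * C ^ 2 * (p * ∑ i, a i ^ 4) := by gcongr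
        _ = _ := by ring
  have h2 := lintegral_le_of_indepFun hind hA (hu.measurable t)
    (F := fun z => ENNReal.ofReal ((∑ i, z.1 i * z.2 i) ^ 4)) (by fun_prop) h1
  refine h2.trans ?_
  have hAm : ∀ i, Measurable fun ω => ENNReal.ofReal (A ω i ^ 4) := by
    intro i; fun_prop
  rw [lintegral_const_mul _ (Finset.measurable_fun_sum _ fun i _ => hAm i),
    lintegral_finsetSum _ fun i _ => hAm i]
  refine (mul_le_mul_right (Finset.sum_le_sum fun i _ => hAQ i) _).trans (le_of_eq ?_)
  rw [Finset.sum_const, Finset.card_univ, Fintype.card_fin, nsmul_eq_mul, ← ENNReal.ofReal_natCast,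
    ← ENNReal.ofReal_mul (by positivity), ← ENNReal.ofReal_mul (by positivity)]
  congr 1
  ring

/-- Cauchy–Schwarz over the T terms reduces to fourth moments. Second moments of the squared norm
are what make a union bound over T columns affordable, at the cost of a factor √T in the threshold.
-/
theorem lintegral_sq_sum_inner_sq_le (hu : NoiseAssumption P X u γ)
    (hγ : Summable fun h => |γ h|) {C : ℝ} (hC : ∑' h, |γ h| ≤ C) (hC0 : 0 < C) {t : ℕ} {T : ℕ}
    {A : Fin T → Ω → Fin p → ℝ} (hA : ∀ s, Measurable (A s))
    (hind : ∀ s, IndepFun (A s) (u t) P) {Q : ℝ}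
    (hAQ : ∀ s i, ∫⁻ ω, ENNReal.ofReal (A s ω i ^ 4) ∂P ≤ ENNReal.ofReal Q) :
    ∫⁻ ω, ENNReal.ofReal ((∑ s, (∑ i, A s ω i * u t ω i) ^ 2) ^ 2) ∂P ≤
      ENNReal.ofReal (T ^ 2 * (64 * C ^ 2 * (p ^ 2 * Q))) := by
  have h1 : ∀ ω, ENNReal.ofReal ((∑ s, (∑ i, A s ω i * u t ω i) ^ 2) ^ 2) ≤
      T * ∑ s, ENNReal.ofReal ((∑ i, A s ω i * u t ω i) ^ 4) := by
    intro ω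
    rw [← ENNReal.ofReal_sum_of_nonneg fun i _ => by positivity, ← ENNReal.ofReal_natCast,
      ← ENNReal.ofReal_mul (by positivity)]
    refine ENNReal.ofReal_le_ofReal ?_
    have h4 := sq_sum_le_card_mul_sum_sq (s := Finset.univ)
      (f := fun s => (∑ i, A s ω i * u t ω i) ^ 2)
    simpa only [Finset.card_univ, Fintype.card_fin, ← pow_mul] using h4
  have hm : ∀ s, Measurable fun ω => ENNReal.ofReal ((∑ i, A s ω i * u t ω i) ^ 4) := by
    intro s
    have := hA s
    have := hu.measurable t
    fun_prop
  refine (lintegral_mono h1).trans ?_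
  rw [lintegral_const_mul _ (Finset.measurable_fun_sum _ fun s _ => hm s),
    lintegral_finsetSum _ fun s _ => hm s]
  refine (mul_le_mul_right (Finset.sum_le_sum fun s _ =>
    hu.lintegral_inner_pow_four_le hγ hC hC0 (hA s) (hind s) (hAQ s)) _).trans (le_of_eq ?_)
  rw [Finset.sum_const, Finset.card_univ, Fintype.card_fin, nsmul_eq_mul, ← ENNReal.ofReal_natCast,
    ← ENNReal.ofReal_mul (by positivity), ← ENNReal.ofReal_mul (by positivity)]
  congr 1
  ring

/-- Uniform bound for the products of signal and columns of the noise matrix. -/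
theorem measure_exists_signal_mul_col_le (hu : NoiseAssumption P X u γ)
    (hγ : Summable fun h => |γ h|) {C : ℝ} (hC : ∑' h, |γ h| ≤ C) (hC0 : 0 < C) {s : Fin p → ℝ}
    (hs : ∀ j, s j ∈ Set.Icc (0 : ℝ) 1)
    (hX : ∀ t, ∀ r ∈ Set.Icc (0 : ℝ) 1, Measurable fun ω => X t ω r) {Q : ℝ}
    (hXQ : ∀ t i, ∫⁻ ω, ENNReal.ofReal (X t ω (s i) ^ 4) ∂P ≤ ENNReal.ofReal Q) {T : ℕ}
    (hT : 0 < T) (hp : 0 < p) {K : ℝ} (hK : 0 < K) :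
    P {ω | ∃ t : Fin T, K * (√T * (T * p)) <
        ∑ r : Fin T, (∑ i, X r ω (s i) * u t ω i) ^ 2} ≤
      ENNReal.ofReal (64 * C ^ 2 * Q / K ^ 2) := by
  have hA : ∀ r : Fin T, Measurable fun ω (i : Fin p) => X r ω (s i) := fun r =>
    measurable_pi_lambda _ fun i => hX r _ (hs i)
  refine (measure_exists_lt_le_of_lintegral_sq (b := T ^ 2 * (64 * C ^ 2 * (p ^ 2 * Q))) ?_
    (by positivity) fun t : Fin T => ?_).trans (ENNReal.ofReal_le_ofReal (le_of_eq ?_))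
  · intro t
    have := hu.measurable_apply t
    have := fun r : Fin T => fun i => hX r _ (hs i)
    fun_prop
  · refine hu.lintegral_sq_sum_inner_sq_le hγ hC hC0 (A := fun r ω i => X r ω (s i)) hA ?_
      fun r i => hXQ r i
    intro r
    have h1 : Measurable fun z : Fin T → Fin p → ℝ => z r := measurable_pi_apply r
    have h2 : Measurable fun z : ℕ → Fin p → ℝ => z t := measurable_pi_apply (t : ℕ)
    exact (hu.indepFun_grid hs T).comp h1 h2
  · rw [Fintype.card_fin, mul_pow, mul_pow, Real.sq_sqrt (by positivity)]
    field_simp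

/-- Uniform bound for the inner products of the columns of the noise matrix. -/
theorem measure_exists_col_mul_col_le (hu : NoiseAssumption P X u γ)
    (hγ : Summable fun h => |γ h|) {C : ℝ} (hC : ∑' h, |γ h| ≤ C) (hC0 : 0 < C) {T : ℕ}
    (hT : 0 < T) (hp : 0 < p) {K : ℝ} (hK : 0 < K) :
    P {ω | ∃ t : Fin T, K * (√T * (T * p)) + K * (√T * p ^ 2) <
        ∑ r : Fin T, (∑ i, u r ω i * u t ω i) ^ 2} ≤
      ENNReal.ofReal (16384 * C ^ 4 / K ^ 2) := by
  -- The column u_t is not independent of itself, so the diagonal term is removed and bounded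
  -- separately by eighth moments. It produces the p² part of the threshold.
  set A : Fin T → Fin T → Ω → Fin p → ℝ := fun t r => if r = t then 0 else u r
  have hAm : ∀ t r, Measurable (A t r) := by
    intro t r
    simp only [A]
    split_ifs
    · exact measurable_const
    · exact hu.measurable r
  have h1 : P {ω | ∃ t : Fin T, K * (√T * (T * p)) <
      ∑ r : Fin T, (∑ i, A t r ω i * u t ω i) ^ 2} ≤ ENNReal.ofReal (4096 * C ^ 4 / K ^ 2) := by
    refine (measure_exists_lt_le_of_lintegral_sq
      (b := T ^ 2 * (64 * C ^ 2 * (p ^ 2 * (64 * C ^ 2)))) ?_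
      (by positivity) fun t : Fin T => ?_).trans (ENNReal.ofReal_le_ofReal (le_of_eq ?_))
    · intro t
      have := hu.measurable_apply t
      have := hAm t
      fun_prop
    · refine hu.lintegral_sq_sum_inner_sq_le hγ hC hC0 (hAm t) ?_ ?_
      · intro r
        simp only [A]
        split_ifs with h
        · exact indepFun_const_left 0 _
        · exact hu.indep.indepFun fun h' => h (Fin.ext h')
      · intro r i
        simp only [A]
        split_ifs
        · simp
        · refine (hu.lintegral_pow_le hγ hC hC0 r i 2).trans
            (ENNReal.ofReal_le_ofReal (le_of_eq ?_))
          norm_num [Nat.factorial]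
          ring
    · rw [Fintype.card_fin, mul_pow, mul_pow, Real.sq_sqrt (by positivity)]
      field_simp
      ring
  have h2 : P {ω | ∃ t : Fin T, K * (√T * p ^ 2) < (∑ i, u t ω i ^ 2) ^ 2} ≤
      ENNReal.ofReal (12288 * C ^ 4 / K ^ 2) := by
    refine (measure_exists_lt_le_of_lintegral_sq (b := p ^ 4 * (12288 * C ^ 4)) ?_
      (by positivity) fun t : Fin T => ?_).trans (ENNReal.ofReal_le_ofReal (le_of_eq ?_))
    · intro t
      have := hu.measurable_apply t
      fun_prop
    · have h3 : ∀ ω, ENNReal.ofReal (((∑ i, u t ω i ^ 2) ^ 2) ^ 2) ≤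
          ENNReal.ofReal (p ^ 3) * ∑ i, ENNReal.ofReal (u t ω i ^ (2 * 4)) := by
        intro ω
        rw [← ENNReal.ofReal_sum_of_nonneg fun i _ => by rw [pow_mul]; positivity,
          ← ENNReal.ofReal_mul (by positivity)]
        refine ENNReal.ofReal_le_ofReal ?_
        -- Power mean inequality (∑ x_i)⁴ ≤ p³ ∑ x_i⁴ with x_i = u_{ti}².
        have h5 := pow_sum_div_card_le_sum_pow (s := Finset.univ) (f := fun i => u t ω i ^ 2)
          (n := 3) (fun i _ => sq_nonneg _)
        rw [Finset.card_univ, Fintype.card_fin, div_le_iff₀ (by positivity)] at h5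
        simp only [← pow_mul] at h5 ⊢
        norm_num at h5 ⊢
        linarith
      have hm : ∀ i, Measurable fun ω => ENNReal.ofReal (u t ω i ^ (2 * 4)) := by
        intro i
        have := hu.measurable_apply t i
        fun_prop
      refine (lintegral_mono h3).trans ?_
      rw [lintegral_const_mul _ (Finset.measurable_fun_sum _ fun i _ => hm i),
        lintegral_finsetSum _ fun i _ => hm i]
      refine (mul_le_mul_right (Finset.sum_le_sum fun i _ =>
        hu.lintegral_pow_le hγ hC hC0 t i 4) _).trans (le_of_eq ?_)
      rw [Finset.sum_const, Finset.card_univ, Fintype.card_fin, nsmul_eq_mul,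
        ← ENNReal.ofReal_natCast,
        ← ENNReal.ofReal_mul (by positivity), ← ENNReal.ofReal_mul (by positivity)]
      congr 1
      norm_num [Nat.factorial]
      ring
    · rw [Fintype.card_fin, mul_pow, mul_pow, Real.sq_sqrt (by positivity)]
      field_simp
  have hsub : {ω | ∃ t : Fin T, K * (√T * (T * p)) + K * (√T * p ^ 2) <
        ∑ r : Fin T, (∑ i, u r ω i * u t ω i) ^ 2} ⊆
      {ω | ∃ t : Fin T, K * (√T * (T * p)) < ∑ r : Fin T, (∑ i, A t r ω i * u t ω i) ^ 2} ∪
      {ω | ∃ t : Fin T, K * (√T * p ^ 2) < (∑ i, u t ω i ^ 2) ^ 2} := by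
    rintro ω ⟨t, ht⟩
    have h3 : ∑ r : Fin T, (∑ i, u r ω i * u t ω i) ^ 2 =
        ∑ r : Fin T, (∑ i, A t r ω i * u t ω i) ^ 2 + (∑ i, u t ω i ^ 2) ^ 2 := by
      rw [← Finset.add_sum_erase _ _ (Finset.mem_univ t),
        ← Finset.add_sum_erase (a := t) (f := fun r => (∑ i, A t r ω i * u t ω i) ^ 2) _
          (Finset.mem_univ t)]
      have h4 : ∑ r ∈ Finset.univ.erase t, (∑ i, u r ω i * u t ω i) ^ 2 =
          ∑ r ∈ Finset.univ.erase t, (∑ i, A t r ω i * u t ω i) ^ 2 := by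
        refine Finset.sum_congr rfl fun r hr => ?_
        simp only [A, if_neg (Finset.ne_of_mem_erase hr)]
      rw [h4]
      simp only [A, if_true, Pi.zero_apply, zero_mul, Finset.sum_const_zero, ← sq]
      ring
    rw [h3] at ht
    by_contra hcon
    simp only [Set.mem_union, Set.mem_ofPred_eq, not_or, not_exists, not_lt] at hcon
    linarith [hcon.1 t, hcon.2 t]
  refine (measure_mono hsub).trans ((measure_union_le _ _).trans ((add_le_add h1 h2).trans ?_))
  rw [← ENNReal.ofReal_add (by positivity) (by positivity)]
  refine ENNReal.ofReal_le_ofReal (le_of_eq ?_)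
  ring

end NoisyFDA.NoiseAssumption

end CrossProducts

/-! ### The Karhunen–Loève expansion of a finite-dimensional process, at every point. -/

section KarhunenLoeve

set_option linter.unusedSectionVars false

theorem inner_toLp_eq_score {f g : ℝ → ℝ} (hf : MemLp f 2 unitVol) (hg : MemLp g 2 unitVol) :
    inner ℝ (hf.toLp f) (hg.toLp g) = score f g := by
  rw [L2.inner_def, score]
  refine integral_congr_ae ?_
  filter_upwards [hf.coeFn_toLp, hg.coeFn_toLp] with r h1 h2
  rw [h1, h2]
  simp [mul_comm]

theorem score_comm (f g : ℝ → ℝ) : score f g = score g f := by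
  simp only [score, mul_comm]

theorem score_sq_le {f g : ℝ → ℝ} (hf : MemLp f 2 unitVol) (hg : MemLp g 2 unitVol) :
    score f g ^ 2 ≤ (∫ r, f r ^ 2 ∂unitVol) * ∫ r, g r ^ 2 ∂unitVol := by
  have h1 := real_inner_mul_inner_self_le (hf.toLp f) (hg.toLp g)
  rw [inner_toLp_eq_score, inner_toLp_eq_score, inner_toLp_eq_score] at h1
  simpa [score, sq] using h1

theorem ae_unitVol_mem : ∀ᵐ r ∂unitVol, r ∈ Set.Icc (0 : ℝ) 1 :=
  ae_restrict_mem measurableSet_Icc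

namespace NoisyFDA.IsEigenSystem

variable {Γ : ℝ → ℝ → ℝ} {L : ℕ} {lam : Fin L → ℝ} {φ : Fin L → ℝ → ℝ}

/-- Since λ_k > 0, the eigenvalue equation expresses φ_k as an integral of the continuous kernel,
and dominated convergence applies. The version of φ_k is therefore fixed at every point of [0,1]. -/
theorem continuousOn (h : IsEigenSystem Γ lam φ)
    (hΓ : ContinuousOn (fun z : ℝ × ℝ => Γ z.1 z.2) (Set.Icc (0 : ℝ) 1 ×ˢ Set.Icc (0 : ℝ) 1))
    (k : Fin L) : ContinuousOn (φ k) (Set.Icc 0 1) := by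
  obtain ⟨C, hC⟩ := (isCompact_Icc.prod isCompact_Icc).exists_bound_of_continuousOn hΓ
  have h1 : ContinuousOn (fun r => score (Γ r) (φ k)) (Set.Icc 0 1) := by
    refine continuousOn_of_dominated (bound := fun r => C * ‖φ k r‖) ?_ ?_ ?_ ?_
    · intro r hr
      refine AEStronglyMeasurable.mul ?_ (h.memLp k).aestronglyMeasurable
      refine ContinuousOn.aestronglyMeasurable ?_ measurableSet_Icc
      exact hΓ.comp (f := fun r' => (r, r')) (by fun_prop) fun r' hr' => ⟨hr, hr'⟩
    · intro r hr
      filter_upwards [ae_unitVol_mem] with r' hr'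
      rw [norm_mul]
      exact mul_le_mul_of_nonneg_right (hC (r, r') ⟨hr, hr'⟩) (norm_nonneg _)
    · exact ((h.memLp k).integrable (by norm_num)).norm.const_mul C
    · filter_upwards [ae_unitVol_mem] with r' hr'
      refine ContinuousOn.mul ?_ continuousOn_const
      exact hΓ.comp (f := fun r => (r, r')) (by fun_prop) fun r hr => ⟨hr, hr'⟩
  have h2 : ∀ r ∈ Set.Icc (0 : ℝ) 1, φ k r = (lam k)⁻¹ * score (Γ r) (φ k) := by
    intro r hr
    rw [h.eigen k r hr, inv_mul_cancel_left₀ (h.pos k).ne']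
  exact (continuousOn_const.mul h1).congr h2

end NoisyFDA.IsEigenSystem

variable {Ω : Type w} [MeasurableSpace Ω] {P : Measure Ω} [IsProbabilityMeasure P]
  {G : Ω → ℝ → ℝ}

/-- A measurable process on `[0,1]` with bounded second moments. -/
structure IsL2Process (P : Measure Ω) (G : Ω → ℝ → ℝ) (C : ℝ) : Prop where
  measurable : Measurable fun z : Ω × ℝ => G z.1 z.2
  moment : ∀ r ∈ Set.Icc (0 : ℝ) 1, ∫⁻ ω, ENNReal.ofReal (G ω r ^ 2) ∂P ≤ ENNReal.ofReal C

theorem measurable_score_of_uncurry (h : Measurable fun z : Ω × ℝ => G z.1 z.2) {ψ : ℝ → ℝ}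
    (hψ : Measurable ψ) : Measurable fun ω => score (G ω) ψ := by
  have hm : Measurable fun z : Ω × ℝ => G z.1 z.2 * ψ z.2 := by fun_prop
  exact hm.stronglyMeasurable.integral_prod_right'.measurable

namespace IsL2Process

variable {C : ℝ}

theorem measurable_eval (h : IsL2Process P G C) (r : ℝ) : Measurable fun ω => G ω r :=
  h.measurable.comp measurable_prodMk_right

theorem measurable_path (h : IsL2Process P G C) (ω : Ω) : Measurable (G ω) :=
  h.measurable.comp measurable_prodMk_left

theorem memLp_eval (h : IsL2Process P G C) {r : ℝ} (hr : r ∈ Set.Icc (0 : ℝ) 1) :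
    MemLp (fun ω => G ω r) 2 P := by
  rw [memLp_two_iff_integrable_sq (h.measurable_eval r).aestronglyMeasurable]
  refine ⟨((h.measurable_eval r).pow_const 2).aestronglyMeasurable, ?_⟩
  rw [hasFiniteIntegral_iff_ofReal (ae_of_all _ fun ω => sq_nonneg _)]
  exact (h.moment r hr).trans_lt ENNReal.ofReal_lt_top

theorem integrable_sq (h : IsL2Process P G C) :
    Integrable (fun z : Ω × ℝ => G z.1 z.2 ^ 2) (P.prod unitVol) := by
  refine ⟨(h.measurable.pow_const 2).aestronglyMeasurable, ?_⟩
  rw [hasFiniteIntegral_iff_ofReal (ae_of_all _ fun ω => sq_nonneg _)]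
  have hm : Measurable fun z : Ω × ℝ => ENNReal.ofReal (G z.1 z.2 ^ 2) := by
    have := h.measurable
    fun_prop
  rw [lintegral_prod_symm _ hm.aemeasurable]
  calc ∫⁻ r, ∫⁻ ω, ENNReal.ofReal (G ω r ^ 2) ∂P ∂unitVol
      ≤ ∫⁻ _r, ENNReal.ofReal C ∂unitVol := by
        refine lintegral_mono_ae ?_
        filter_upwards [ae_unitVol_mem] with r hr using h.moment r hr
    _ < ⊤ := by
        rw [lintegral_const]
        exact ENNReal.mul_lt_top ENNReal.ofReal_lt_top (measure_lt_top _ _)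

theorem ae_memLp_path (h : IsL2Process P G C) : ∀ᵐ ω ∂P, MemLp (G ω) 2 unitVol := by
  filter_upwards [h.integrable_sq.prod_right_ae] with ω hω
  rw [memLp_two_iff_integrable_sq (h.measurable_path ω).aestronglyMeasurable]
  exact hω

theorem measurable_score (h : IsL2Process P G C) {ψ : ℝ → ℝ} (hψ : Measurable ψ) :
    Measurable fun ω => score (G ω) ψ :=
  measurable_score_of_uncurry h.measurable hψ

theorem memLp_score (h : IsL2Process P G C) {ψ : ℝ → ℝ} (hψ : Measurable ψ)
    (hψ2 : MemLp ψ 2 unitVol) : MemLp (fun ω => score (G ω) ψ) 2 P := by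
  have hm := h.measurable_score hψ
  rw [memLp_two_iff_integrable_sq hm.aestronglyMeasurable]
  refine Integrable.mono' (h.integrable_sq.integral_prod_left.mul_const
    (∫ r, ψ r ^ 2 ∂unitVol)) (hm.pow_const 2).aestronglyMeasurable ?_
  filter_upwards [h.ae_memLp_path] with ω hω
  rw [Real.norm_of_nonneg (sq_nonneg _)]
  exact score_sq_le hω hψ2

/-- Fubini's theorem for weighted averages of the paths. -/
theorem integral_mul_score (h : IsL2Process P G C) {Z : Ω → ℝ} (hZ : MemLp Z 2 P)
    {ψ : ℝ → ℝ} (hψ2 : MemLp ψ 2 unitVol) :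
    ∫ ω, Z ω * score (G ω) ψ ∂P = ∫ r, (∫ ω, Z ω * G ω r ∂P) * ψ r ∂unitVol := by
  have hint : Integrable (fun z : Ω × ℝ => Z z.1 * G z.1 z.2 * ψ z.2) (P.prod unitVol) := by
    have h1 := hZ.integrable_sq.mul_prod hψ2.integrable_sq
    refine Integrable.mono' (h1.add h.integrable_sq) ?_ (ae_of_all _ fun z => ?_)
    · exact (hZ.aestronglyMeasurable.comp_fst.mul h.measurable.aestronglyMeasurable).mul
        hψ2.aestronglyMeasurable.comp_snd
    · simp only [Pi.add_apply]
      rw [Real.norm_eq_abs, abs_le]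
      constructor <;> nlinarith [sq_nonneg (Z z.1 * ψ z.2 - G z.1 z.2),
        sq_nonneg (Z z.1 * ψ z.2 + G z.1 z.2), sq_nonneg (Z z.1 * ψ z.2), sq_nonneg (G z.1 z.2)]
  have h1 := integral_integral_swap (f := fun ω r => Z ω * G ω r * ψ r) hint
  simp_rw [integral_mul_const] at h1
  rw [← h1]
  refine integral_congr_ae (ae_of_all _ fun ω => ?_)
  simp only [score]
  rw [← integral_const_mul]
  simp only [mul_assoc]

variable {Γ : ℝ → ℝ → ℝ} {L : ℕ} {lam : Fin L → ℝ} {φ : Fin L → ℝ → ℝ}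

theorem integral_eval_mul_score (h : IsL2Process P G C) (hE : IsEigenSystem Γ lam φ)
    (hΓ : ∀ r ∈ Set.Icc (0 : ℝ) 1, ∀ r' ∈ Set.Icc (0 : ℝ) 1, Γ r r' = ∫ ω, G ω r * G ω r' ∂P)
    (k : Fin L) {r : ℝ} (hr : r ∈ Set.Icc (0 : ℝ) 1) :
    ∫ ω, G ω r * score (G ω) (φ k) ∂P = lam k * φ k r := by
  rw [h.integral_mul_score (h.memLp_eval hr) (hE.memLp k), ← hE.eigen k r hr, score]
  refine integral_congr_ae ?_
  filter_upwards [ae_unitVol_mem] with r' hr'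
  rw [hΓ r hr r' hr']

/-- Apply Fubini and the eigenvalue equation. The test function ψ is arbitrary so that it can be
taken orthogonal to the space of the curves. -/
theorem integral_score_mul_score (h : IsL2Process P G C) (hE : IsEigenSystem Γ lam φ)
    (hφ : ∀ k, Measurable (φ k))
    (hΓ : ∀ r ∈ Set.Icc (0 : ℝ) 1, ∀ r' ∈ Set.Icc (0 : ℝ) 1, Γ r r' = ∫ ω, G ω r * G ω r' ∂P)
    (k : Fin L) {ψ : ℝ → ℝ} (hψ2 : MemLp ψ 2 unitVol) :
    ∫ ω, score (G ω) (φ k) * score (G ω) ψ ∂P = lam k * score (φ k) ψ := by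
  rw [h.integral_mul_score (h.memLp_score (hφ k) (hE.memLp k)) hψ2, score, ← integral_const_mul]
  refine integral_congr_ae ?_
  filter_upwards [ae_unitVol_mem] with r hr
  rw [← mul_assoc, ← h.integral_eval_mul_score hE hΓ k hr]
  simp only [mul_comm]

/-- The eigenfunctions span the space of the curves. -/
theorem ae_eq_sum_score (h : IsL2Process P G C) (hE : IsEigenSystem Γ lam φ)
    (hφ : ∀ k, Measurable (φ k))
    (hΓ : ∀ r ∈ Set.Icc (0 : ℝ) 1, ∀ r' ∈ Set.Icc (0 : ℝ) 1, Γ r r' = ∫ ω, G ω r * G ω r' ∂P)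
    (hL : 1 ≤ L) (hV : ∃ V : Submodule ℝ (Lp ℝ 2 unitVol), Module.finrank ℝ V = L ∧
      ∀ᵐ ω ∂P, ∃ v ∈ V, G ω =ᵐ[unitVol] v) :
    ∀ᵐ ω ∂P, ∀ᵐ r ∂unitVol, G ω r = ∑ k, score (G ω) (φ k) * φ k r := by
  obtain ⟨V, hVL, hV⟩ := hV
  have hfin : FiniteDimensional ℝ V := Module.finite_of_finrank_pos (by omega)
  set Φ : Fin L → Lp ℝ 2 unitVol := fun k => (hE.memLp k).toLp (φ k)
  have hon : Orthonormal ℝ Φ := by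
    rw [orthonormal_iff_ite]
    intro k l
    simp only [Φ]
    rw [inner_toLp_eq_score, hE.orthonormal]
  have hinner : ∀ᵐ ω ∂P, ∀ v : Lp ℝ 2 unitVol, G ω =ᵐ[unitVol] v →
      ∀ (f : ℝ → ℝ) (hf : MemLp f 2 unitVol), inner ℝ v (hf.toLp f) = score (G ω) f := by
    filter_upwards [h.ae_memLp_path] with ω hω v hv f hf
    rw [← inner_toLp_eq_score hω hf]
    congr 1
    refine Lp.ext ?_
    filter_upwards [hv, hω.coeFn_toLp] with r h1 h2
    rw [h2, h1]
  -- A function ψ orthogonal to V has zero score almost surely, so λ_k ⟨φ_k, ψ⟩ = 0. Hence φ_k lies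
  -- in Vᗮᗮ = V, and L orthonormal vectors in an L-dimensional space span it.
  have hmem : ∀ k, Φ k ∈ V := by
    intro k
    rw [← Submodule.orthogonal_orthogonal V, Submodule.mem_orthogonal]
    intro ψ hψ
    have hψ2 : MemLp (ψ : ℝ → ℝ) 2 unitVol := Lp.memLp ψ
    have hψ' : hψ2.toLp ψ = ψ := Lp.toLp_coeFn ψ hψ2
    have hzero : ∀ᵐ ω ∂P, score (G ω) ψ = 0 := by
      filter_upwards [hinner, hV] with ω h1 ⟨v, hv, hGv⟩
      rw [← h1 v hGv _ hψ2, hψ']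
      exact (Submodule.mem_orthogonal V ψ).1 hψ v hv
    have h1 := h.integral_score_mul_score hE hφ hΓ k hψ2
    rw [integral_congr_ae (g := fun _ => (0 : ℝ))
      (hzero.mono fun ω hω => by simp only [hω, mul_zero]), integral_zero] at h1
    have h2 := (mul_eq_zero.1 h1.symm).resolve_left (hE.pos k).ne'
    rw [real_inner_comm, ← hψ', ← h2]
    exact inner_toLp_eq_score _ _
  have hspan : Submodule.span ℝ (Set.range Φ) = V := by
    refine Submodule.eq_of_le_of_finrank_eq ?_ ?_
    · rw [Submodule.span_le]
      rintro _ ⟨k, rfl⟩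
      exact hmem k
    · rw [finrank_span_eq_card hon.linearIndependent, Fintype.card_fin, hVL]
  filter_upwards [hinner, hV] with ω h1 ⟨v, hv, hGv⟩
  rw [← hspan] at hv
  obtain ⟨c, hc⟩ := (Submodule.mem_span_range_iff_exists_fun ℝ).1 hv
  have hck : ∀ k, c k = score (G ω) (φ k) := by
    intro k
    rw [← h1 v hGv _ (hE.memLp k), ← hc, real_inner_comm]
    exact (hon.inner_right_fintype c k).symm
  have h2 : (v : ℝ → ℝ) =ᵐ[unitVol] fun r => ∑ k, c k * φ k r := by
    rw [← hc]
    have h3 : ∀ k, (c k • Φ k : Lp ℝ 2 unitVol) =ᵐ[unitVol] fun r => c k * φ k r := by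
      intro k
      filter_upwards [Lp.coeFn_smul (c k) (Φ k), (hE.memLp k).coeFn_toLp] with r h4 h5
      rw [h4, Pi.smul_apply, h5, smul_eq_mul]
    have h4 : ∀ᵐ r ∂unitVol, ∀ k, (c k • Φ k : Lp ℝ 2 unitVol) r = c k * φ k r :=
      ae_all_iff.2 h3
    filter_upwards [Lp.coeFn_finsetSum Finset.univ (fun k => c k • Φ k), h4] with r h5 h6
    rw [h5, Finset.sum_apply]
    exact Finset.sum_congr rfl fun k _ => h6 k
  filter_upwards [hGv, h2] with r h3 h4
  rw [h3, h4]
  simp only [hck]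

/-- The residual variance of the Karhunen--Loève expansion. -/
theorem integral_residual_sq (h : IsL2Process P G C) (hE : IsEigenSystem Γ lam φ)
    (hφ : ∀ k, Measurable (φ k))
    (hΓ : ∀ r ∈ Set.Icc (0 : ℝ) 1, ∀ r' ∈ Set.Icc (0 : ℝ) 1, Γ r r' = ∫ ω, G ω r * G ω r' ∂P)
    {r : ℝ} (hr : r ∈ Set.Icc (0 : ℝ) 1) :
    ∫ ω, (G ω r - ∑ k, score (G ω) (φ k) * φ k r) ^ 2 ∂P = Γ r r - ∑ k, lam k * φ k r ^ 2 := by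
  have hI : ∀ k, MemLp (fun ω => score (G ω) (φ k)) 2 P := fun k =>
    h.memLp_score (hφ k) (hE.memLp k)
  have hGr := h.memLp_eval hr
  have hS : MemLp (fun ω => ∑ k, score (G ω) (φ k) * φ k r) 2 P :=
    memLp_finsetSum _ fun k _ => (hI k).mul_const (φ k r)
  have h1 : ∀ Z : Ω → ℝ, MemLp Z 2 P →
      ∫ ω, Z ω * ∑ k, score (G ω) (φ k) * φ k r ∂P =
        ∑ k, (∫ ω, Z ω * score (G ω) (φ k) ∂P) * φ k r := by
    intro Z hZ
    simp_rw [Finset.mul_sum, ← mul_assoc]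
    have i0 : ∀ k, Integrable (fun ω => Z ω * score (G ω) (φ k) * φ k r) P := fun k =>
      (hZ.integrable_mul (hI k)).mul_const _
    rw [integral_finsetSum _ fun k _ => i0 k]
    simp_rw [integral_mul_const]
  have hGS : ∫ ω, G ω r * ∑ k, score (G ω) (φ k) * φ k r ∂P = ∑ k, lam k * φ k r ^ 2 := by
    rw [h1 _ hGr]
    refine Finset.sum_congr rfl fun k _ => ?_
    rw [h.integral_eval_mul_score hE hΓ k hr]
    ring
  have hSS : ∫ ω, (∑ k, score (G ω) (φ k) * φ k r) * ∑ k, score (G ω) (φ k) * φ k r ∂P =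
      ∑ k, lam k * φ k r ^ 2 := by
    rw [h1 _ hS]
    refine Finset.sum_congr rfl fun l _ => ?_
    have h2 : ∫ ω, (∑ k, score (G ω) (φ k) * φ k r) * score (G ω) (φ l) ∂P =
        ∑ k, (∫ ω, score (G ω) (φ l) * score (G ω) (φ k) ∂P) * φ k r := by
      rw [← h1 _ (hI l)]
      simp only [mul_comm]
    rw [h2]
    simp_rw [h.integral_score_mul_score hE hφ hΓ l (hE.memLp _), hE.orthonormal]
    simp
    ring
  have h2 : ∀ ω, (G ω r - ∑ k, score (G ω) (φ k) * φ k r) ^ 2 =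
      G ω r * G ω r - 2 * (G ω r * ∑ k, score (G ω) (φ k) * φ k r) +
        (∑ k, score (G ω) (φ k) * φ k r) * ∑ k, score (G ω) (φ k) * φ k r := by
    intro ω; ring
  have i1 : Integrable (fun ω => G ω r * G ω r) P := hGr.integrable_mul hGr
  have i2 : Integrable (fun ω => 2 * (G ω r * ∑ k, score (G ω) (φ k) * φ k r)) P :=
    (hGr.integrable_mul hS).const_mul 2
  have i3 : Integrable (fun ω => (∑ k, score (G ω) (φ k) * φ k r) *
    ∑ k, score (G ω) (φ k) * φ k r) P := hS.integrable_mul hS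
  simp_rw [h2]
  have i4 : Integrable (fun ω => G ω r * G ω r -
    2 * (G ω r * ∑ k, score (G ω) (φ k) * φ k r)) P := i1.sub i2
  rw [integral_add i4 i3, integral_sub i1 i2, integral_const_mul, hGS, hSS, ← hΓ r hr r hr]
  ring

/-- The Karhunen--Loève expansion of a finite-dimensional process, pointwise. -/
theorem karhunen_loeve_of_measurable (h : IsL2Process P G C) (hE : IsEigenSystem Γ lam φ)
    (hφ : ∀ k, Measurable (φ k))
    (hΓ : ∀ r ∈ Set.Icc (0 : ℝ) 1, ∀ r' ∈ Set.Icc (0 : ℝ) 1, Γ r r' = ∫ ω, G ω r * G ω r' ∂P)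
    (hΓc : ContinuousOn (fun z : ℝ × ℝ => Γ z.1 z.2) (Set.Icc (0 : ℝ) 1 ×ˢ Set.Icc (0 : ℝ) 1))
    (hL : 1 ≤ L) (hV : ∃ V : Submodule ℝ (Lp ℝ 2 unitVol), Module.finrank ℝ V = L ∧
      ∀ᵐ ω ∂P, ∃ v ∈ V, G ω =ᵐ[unitVol] v) {r : ℝ} (hr : r ∈ Set.Icc (0 : ℝ) 1) :
    ∑ k, lam k * φ k r ^ 2 = Γ r r ∧
      ∀ᵐ ω ∂P, G ω r = ∑ k, score (G ω) (φ k) * φ k r := by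
  have hm : Measurable fun z : Ω × ℝ => G z.1 z.2 - ∑ k, score (G z.1) (φ k) * φ k z.2 := by
    have h1 := h.measurable
    have h2 : ∀ k, Measurable fun z : Ω × ℝ => score (G z.1) (φ k) := fun k =>
      (h.measurable_score (hφ k)).comp measurable_fst
    have h3 : ∀ k, Measurable fun z : Ω × ℝ => φ k z.2 := fun k =>
      (hφ k).comp measurable_snd
    exact h1.sub (Finset.measurable_fun_sum _ fun k _ => (h2 k).mul (h3 k))
  have hae : ∀ᵐ r ∂unitVol, ∀ᵐ ω ∂P, G ω r - ∑ k, score (G ω) (φ k) * φ k r = 0 := by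
    rw [← Measure.ae_ae_comm (p := fun ω r => G ω r - ∑ k, score (G ω) (φ k) * φ k r = 0)
      (measurableSet_eq_fun hm measurable_const)]
    filter_upwards [h.ae_eq_sum_score hE hφ hΓ hL hV] with ω hω
    filter_upwards [hω] with r hr using sub_eq_zero.2 hr
  -- The expansion holds for almost every r, so the residual variance is zero there. Continuity
  -- extends this to all of [0,1], including the sampling points.
  have hzero : Set.EqOn (fun r => Γ r r - ∑ k, lam k * φ k r ^ 2) (fun _ => 0)
      (Set.Icc (0 : ℝ) 1) := by
    refine Measure.eqOn_Icc_of_ae_eq volume zero_ne_one ?_ ?_ continuousOn_const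
    · filter_upwards [hae, ae_unitVol_mem] with r h1 hr
      rw [← h.integral_residual_sq hE hφ hΓ hr]
      rw [integral_congr_ae (g := fun _ => (0 : ℝ))
        (h1.mono fun ω hω => by simp only [hω]; norm_num), integral_zero]
    · refine ContinuousOn.sub ?_ ?_
      · exact hΓc.comp (f := fun r => (r, r)) (by fun_prop) fun r hr => ⟨hr, hr⟩
      · exact continuousOn_finsetSum _ fun k _ =>
          continuousOn_const.mul ((hE.continuousOn hΓc k).pow 2)
  have h0 := hzero hr
  simp only at h0
  refine ⟨(sub_eq_zero.1 h0).symm, ?_⟩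
  rw [← h.integral_residual_sq hE hφ hΓ hr] at h0
  have hD : MemLp (fun ω => G ω r - ∑ k, score (G ω) (φ k) * φ k r) 2 P :=
    (h.memLp_eval hr).sub (memLp_finsetSum _ fun k _ =>
      (h.memLp_score (hφ k) (hE.memLp k)).mul_const (φ k r))
  rw [integral_eq_zero_iff_of_nonneg (fun ω => sq_nonneg _) hD.integrable_sq] at h0
  filter_upwards [h0] with ω hω
  simpa [sub_eq_zero] using hω

end IsL2Process

end KarhunenLoeve

/-! ### Stationarity, moments and expansion of the signal. -/

section Signal

set_option linter.unusedSectionVars false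

theorem score_congr_right {x φ ψ : ℝ → ℝ} (h : ∀ r ∈ Set.Icc (0 : ℝ) 1, φ r = ψ r) :
    score x φ = score x ψ := by
  refine integral_congr_ae ?_
  filter_upwards [ae_unitVol_mem] with r hr
  rw [h r hr]

theorem score_congr_left {x y φ : ℝ → ℝ} (h : ∀ r ∈ Set.Icc (0 : ℝ) 1, x r = y r) :
    score x φ = score y φ := by
  rw [score_comm x, score_comm y]
  exact score_congr_right h

theorem l2norm_congr {x y : ℝ → ℝ} (h : ∀ r ∈ Set.Icc (0 : ℝ) 1, x r = y r) :
    l2norm x = l2norm y := by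
  refine eLpNorm_congr_ae ?_
  filter_upwards [ae_unitVol_mem] with r hr using h r hr

theorem NoisyFDA.IsEigenSystem.congr {Γ : ℝ → ℝ → ℝ} {L : ℕ} {lam : Fin L → ℝ}
    {φ ψ : Fin L → ℝ → ℝ} (h : IsEigenSystem Γ lam φ)
    (hψ : ∀ k, ∀ r ∈ Set.Icc (0 : ℝ) 1, φ k r = ψ k r) : IsEigenSystem Γ lam ψ where
  memLp k := (memLp_congr_ae (by
    filter_upwards [ae_unitVol_mem] with r hr using hψ k r hr)).1 (h.memLp k)
  orthonormal k l := by
    rw [← score_congr_right (hψ l), ← score_congr_left (hψ k), h.orthonormal]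
  eigen k r hr := by
    rw [← score_congr_right (hψ k), ← hψ k r hr, h.eigen k r hr]
  antitone := h.antitone
  pos := h.pos

/-- Bessel's inequality. -/
theorem NoisyFDA.IsEigenSystem.sum_score_sq_le {Γ : ℝ → ℝ → ℝ} {L : ℕ} {lam : Fin L → ℝ}
    {φ : Fin L → ℝ → ℝ} (h : IsEigenSystem Γ lam φ) {x : ℝ → ℝ} (hx : MemLp x 2 unitVol) :
    ∑ k, score x (φ k) ^ 2 ≤ (l2norm x).toReal ^ 2 := by
  have hon : Orthonormal ℝ fun k => (h.memLp k).toLp (φ k) := by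
    rw [orthonormal_iff_ite]
    intro k l
    rw [inner_toLp_eq_score, h.orthonormal]
  have h1 := hon.sum_inner_products_le (hx.toLp x) (s := Finset.univ)
  rw [Lp.norm_toLp] at h1
  refine le_trans (le_of_eq (Finset.sum_congr rfl fun k _ => ?_)) h1
  rw [inner_toLp_eq_score, Real.norm_eq_abs, sq_abs, score_comm]

theorem norm_factor_sq {L : ℕ} (lam : Fin L → ℝ) (hlam : ∀ k, 0 < lam k) (φ : Fin L → ℝ → ℝ)
    (x : ℝ → ℝ) : ‖factor lam φ x‖ ^ 2 = ∑ k, score x (φ k) ^ 2 / lam k := by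
  rw [EuclideanSpace.norm_sq_eq]
  refine Finset.sum_congr rfl fun k _ => ?_
  simp only [factor, Real.norm_eq_abs, sq_abs, div_pow]
  rw [Real.sq_sqrt (hlam k).le]

theorem NoisyFDA.IsEigenSystem.norm_factor_sq_le {Γ : ℝ → ℝ → ℝ} {L : ℕ} {lam : Fin L → ℝ}
    {φ : Fin L → ℝ → ℝ} (h : IsEigenSystem Γ lam φ) {x : ℝ → ℝ} (hx : MemLp x 2 unitVol) {c : ℝ}
    (hc : 0 < c) (hlam : ∀ k, c ≤ lam k) :
    ‖factor lam φ x‖ ^ 2 ≤ c⁻¹ * (l2norm x).toReal ^ 2 := by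
  rw [norm_factor_sq lam h.pos]
  calc ∑ k, score x (φ k) ^ 2 / lam k ≤ ∑ k, c⁻¹ * score x (φ k) ^ 2 := by
        refine Finset.sum_le_sum fun k _ => ?_
        rw [div_eq_inv_mul]
        exact mul_le_mul_of_nonneg_right (inv_anti₀ hc (hlam k)) (sq_nonneg _)
    _ = c⁻¹ * ∑ k, score x (φ k) ^ 2 := by rw [Finset.mul_sum]
    _ ≤ _ := mul_le_mul_of_nonneg_left (h.sum_score_sq_le hx) (by positivity)

theorem measurable_l2norm_of_uncurry {α : Type*} [MeasurableSpace α] {g : α → ℝ → ℝ}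
    (hg : Measurable fun z : α × ℝ => g z.1 z.2) : Measurable fun z => l2norm (g z) := by
  have h1 : ∀ z, l2norm (g z) = (∫⁻ r, ‖g z r‖ₑ ^ (2 : ℝ) ∂unitVol) ^ (1 / (2 : ℝ)) := by
    intro z
    rw [l2norm, eLpNorm_eq_lintegral_rpow_enorm_toReal (by norm_num) (by norm_num)]
    norm_num
  simp_rw [h1]
  refine Measurable.pow_const ?_ _
  exact Measurable.lintegral_prod_right' (f := fun z : α × ℝ => ‖g z.1 z.2‖ₑ ^ (2 : ℝ))
    (hg.enorm.pow_const _)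

variable {Ω : Type w} [MeasurableSpace Ω] {P : Measure Ω} [IsProbabilityMeasure P]
  {X : ℕ → Ω → ℝ → ℝ}

/-- An approximable series is a fixed measurable function of a stationary series. -/
theorem NoisyFDA.IsL4mApproximable.exists_stationary {K : ℝ≥0}
    (h : IsL4mApproximable.{w, v} P X K) :
    ∃ (S : Type v) (_ : MeasurableSpace S) (g : S → ℝ → ℝ) (Z : ℕ → Ω → S) (μ : Measure S),
      Measurable (fun z : S × ℝ => g z.1 z.2) ∧ (∀ t, Measurable (Z t)) ∧
      (∀ t, P.map (Z t) = μ) ∧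
      ∀ t, ∀ᵐ ω ∂P, ∀ r ∈ Set.Icc (0 : ℝ) 1, X t ω r = g (Z t ω) r := by
  obtain ⟨S, hS, δ, g, hδ, hind, hid, hg, hX, -⟩ := h
  have hZ : ∀ t : ℕ, Measurable fun ω (k : ℕ) => δ ((t : ℤ) - (k : ℤ)) ω := fun t =>
    measurable_pi_lambda _ fun k => hδ _
  -- The state at time t is the whole innovation past. Its law is the infinite product of the common
  -- innovation law, so it does not depend on t.
  refine ⟨ℕ → S, inferInstance, g, fun t ω k => δ ((t : ℤ) - (k : ℤ)) ω,
    Measure.infinitePi fun _ : ℕ => P.map (δ 0), hg, hZ, fun t => ?_, hX⟩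
  have h1 : iIndepFun (fun k : ℕ => δ ((t : ℤ) - (k : ℤ))) P := by
    refine hind.precomp (g := fun k : ℕ => (t : ℤ) - (k : ℤ)) fun k l hkl => ?_
    have : (k : ℤ) = l := by simpa using hkl
    exact_mod_cast this
  rw [h1.map_fun_eq_infinitePi_map₀ (hZ t).aemeasurable]
  congr 1
  funext k
  exact (hid _).map_eq

variable {L : ℕ} {lam : Fin L → ℝ} {φ : Fin L → ℝ → ℝ} {K CX CS : ℝ≥0}

namespace NoisyFDA.SignalAssumption

/-- All curves are one function g of identically distributed pasts. Insensitivity of Ψ outside [0,1]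
permits replacing X_t by g, and measurability is required only along measurable families of curves.
-/
theorem lintegral_functional_eq (h : SignalAssumption.{w, v} P X lam φ K CX CS)
    {Ψ : (ℝ → ℝ) → ℝ≥0∞} (hΨ : ∀ x y, (∀ r ∈ Set.Icc (0 : ℝ) 1, x r = y r) → Ψ x = Ψ y)
    (hΨm : ∀ (S : Type v) (_ : MeasurableSpace S) (g : S → ℝ → ℝ),
      Measurable (fun z : S × ℝ => g z.1 z.2) → Measurable fun z => Ψ (g z)) (t : ℕ) :
    ∫⁻ ω, Ψ (X t ω) ∂P = ∫⁻ ω, Ψ (X 0 ω) ∂P := by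
  obtain ⟨S, hS, g, Z, μ, hg, hZ, hμ, hX⟩ := h.approximable.exists_stationary
  have h1 : ∀ t, ∫⁻ ω, Ψ (X t ω) ∂P = ∫⁻ z, Ψ (g z) ∂μ := by
    intro t
    rw [← hμ t, lintegral_map (hΨm S hS g hg) (hZ t)]
    refine lintegral_congr_ae ?_
    filter_upwards [hX t] with ω hω using hΨ _ _ hω
  rw [h1 t, h1 0]

theorem lintegral_pow_four_le (h : SignalAssumption.{w, v} P X lam φ K CX CS) (t : ℕ) {r : ℝ}
    (hr : r ∈ Set.Icc (0 : ℝ) 1) :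
    ∫⁻ ω, ENNReal.ofReal (X t ω r ^ 4) ∂P ≤ ENNReal.ofReal CX := by
  rw [h.lintegral_functional_eq (Ψ := fun x => ENNReal.ofReal (x r ^ 4))
    (fun x y hxy => by simp only [hxy r hr]) (fun S hS g hg => ?_) t]
  · refine le_trans (le_of_eq (lintegral_congr fun ω => ?_))
      ((h.fourth_moment r hr).trans (by simp))
    rw [← ofReal_norm, ← ENNReal.ofReal_pow (norm_nonneg _)]
    congr 1
    rw [Real.norm_eq_abs, Even.pow_abs (by decide)]
  · have : Measurable fun z => g z r := hg.comp measurable_prodMk_right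
    fun_prop

/-- A maximum over the finite grid is a measurable functional of the curve, so stationarity carries
the bound from the first curve to all others. -/
theorem lintegral_iSup_sq_le (h : SignalAssumption.{w, v} P X lam φ K CX CS) (t : ℕ) {p : ℕ}
    {s : Fin p → ℝ} (hs : ∀ j, s j ∈ Set.Icc (0 : ℝ) 1) :
    ∫⁻ ω, ⨆ j, ENNReal.ofReal (X t ω (s j) ^ 2) ∂P ≤ CS := by
  rw [h.lintegral_functional_eq (Ψ := fun x => ⨆ j, ENNReal.ofReal (x (s j) ^ 2))
    (fun x y hxy => by simp only [hxy _ (hs _)]) (fun S hS g hg => ?_) t]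
  · refine (lintegral_mono fun ω => ?_).trans h.sup_moment
    refine iSup_le fun j => ?_
    refine le_trans (le_of_eq ?_) (le_iSup₂ (f := fun r (_ : r ∈ Set.Icc (0 : ℝ) 1) =>
      ‖X 0 ω r‖ₑ ^ 2) (s j) (hs j))
    rw [← ofReal_norm, ← ENNReal.ofReal_pow (norm_nonneg _), Real.norm_eq_abs, sq_abs]
  · refine Measurable.iSup fun j => ?_
    have : Measurable fun z => g z (s j) := hg.comp measurable_prodMk_right
    fun_prop

theorem lintegral_l2norm_rpow_eq (h : SignalAssumption.{w, v} P X lam φ K CX CS) (q : ℝ) (t : ℕ) :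
    ∫⁻ ω, l2norm (X t ω) ^ q ∂P = ∫⁻ ω, l2norm (X 0 ω) ^ q ∂P :=
  h.lintegral_functional_eq (Ψ := fun x => l2norm x ^ q)
    (fun x y hxy => by simp only [l2norm_congr hxy])
    (fun S hS g hg => (measurable_l2norm_of_uncurry hg).pow_const q) t

theorem aemeasurable_l2norm (h : SignalAssumption.{w, v} P X lam φ K CX CS) (t : ℕ) :
    AEMeasurable (fun ω => l2norm (X t ω)) P := by
  obtain ⟨S, hS, g, Z, μ, hg, hZ, hμ, hX⟩ := h.approximable.exists_stationary
  refine ⟨_, (measurable_l2norm_of_uncurry hg).comp (hZ t), ?_⟩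
  filter_upwards [hX t] with ω hω using l2norm_congr hω

theorem ae_memLp (h : SignalAssumption.{w, v} P X lam φ K CX CS) (t : ℕ) :
    ∀ᵐ ω ∂P, MemLp (X t ω) 2 unitVol := by
  obtain ⟨V, -, hV⟩ := h.finite_dim
  filter_upwards [hV t] with ω ⟨v, _, hv⟩
  exact (memLp_congr_ae hv).2 (Lp.memLp v)

/-- Uniform bound for the norms of the curves. -/
theorem measure_exists_l2norm_le (h : SignalAssumption.{w, v} P X lam φ K CX CS) {q : ℝ}
    (hq : 0 < q) {C : ℝ≥0} (hC : ∫⁻ ω, l2norm (X 0 ω) ^ q ∂P ≤ C) {T : ℕ} (hT : 0 < T) {A : ℝ}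
    (hA : 0 < A) :
    P {ω | ∃ t : Fin T, ENNReal.ofReal (A * (T : ℝ) ^ (1 / q)) < l2norm (X t ω)} ≤
      ENNReal.ofReal (C / A ^ q) := by
  have hT0 : (0 : ℝ) < T := by exact_mod_cast hT
  have h1 : ∀ t : Fin T, P {ω | ENNReal.ofReal (A * (T : ℝ) ^ (1 / q)) < l2norm (X t ω)} ≤
      ENNReal.ofReal (C / (A ^ q * T)) := by
    intro t
    have hsub : {ω | ENNReal.ofReal (A * (T : ℝ) ^ (1 / q)) < l2norm (X t ω)} ⊆
        {ω | ENNReal.ofReal (A ^ q * T) ≤ l2norm (X t ω) ^ q} := by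
      intro ω hω
      simp only [Set.mem_ofPred_eq] at hω ⊢
      have h2 : A ^ q * T = (A * (T : ℝ) ^ (1 / q)) ^ q := by
        rw [Real.mul_rpow hA.le (by positivity), ← Real.rpow_mul hT0.le, one_div,
          inv_mul_cancel₀ hq.ne', Real.rpow_one]
      rw [h2, ← ENNReal.ofReal_rpow_of_pos (by positivity)]
      exact ENNReal.rpow_le_rpow hω.le hq.le
    refine (measure_mono hsub).trans ((meas_ge_le_lintegral_div
      ((h.aemeasurable_l2norm t).pow_const q) (by simp; positivity) (by simp)).trans ?_)
    rw [ENNReal.ofReal_div_of_pos (by positivity), h.lintegral_l2norm_rpow_eq q t]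
    exact ENNReal.div_le_div_right (hC.trans (by simp)) _
  have h2 : {ω | ∃ t : Fin T, ENNReal.ofReal (A * (T : ℝ) ^ (1 / q)) < l2norm (X t ω)} =
      ⋃ t : Fin T, {ω | ENNReal.ofReal (A * (T : ℝ) ^ (1 / q)) < l2norm (X t ω)} := by
    ext; simp
  rw [h2]
  refine (measure_iUnion_fintype_le _ _).trans ((Finset.sum_le_sum fun t _ => h1 t).trans ?_)
  rw [Finset.sum_const, Finset.card_univ, Fintype.card_fin, nsmul_eq_mul, ← ENNReal.ofReal_natCast,
    ← ENNReal.ofReal_mul (by positivity)]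
  refine ENNReal.ofReal_le_ofReal (le_of_eq ?_)
  field_simp

/-- The Karhunen--Loève expansion of the signals. -/
theorem karhunen_loeve (h : SignalAssumption.{w, v} P X lam φ K CX CS) (hL : 1 ≤ L) {r : ℝ}
    (hr : r ∈ Set.Icc (0 : ℝ) 1) :
    ∑ k, lam k * φ k r ^ 2 ≤ 1 + CX ∧
      ∀ t, ∀ᵐ ω ∂P, X t ω r = ∑ k, score (X t ω) (φ k) * φ k r := by
  obtain ⟨S, hS, g, Z, μ, hg, hZ, hμ, hX⟩ := h.approximable.exists_stationary
  -- Cutting φ_k off outside [0,1] makes it Borel measurable on all of ℝ without changing any score.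
  set ψ : Fin L → ℝ → ℝ := fun k => (Set.Icc (0 : ℝ) 1).indicator (φ k)
  have hψ : ∀ k, ∀ r ∈ Set.Icc (0 : ℝ) 1, φ k r = ψ k r := fun k r hr =>
    (Set.indicator_of_mem hr _).symm
  have hψm : ∀ k, Measurable (ψ k) := fun k => by
    classical
    have := (h.eigenSystem.continuousOn h.continuous_cov k).measurable_piecewise
      (g := fun _ => (0 : ℝ)) continuousOn_const measurableSet_Icc
    rwa [show (fun _ : ℝ => (0 : ℝ)) = 0 from rfl, Set.piecewise_eq_indicator] at this
  have hE := h.eigenSystem.congr hψ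
  have hmom : ∀ r ∈ Set.Icc (0 : ℝ) 1,
      ∫⁻ ω, ENNReal.ofReal (X 0 ω r ^ 2) ∂P ≤ ENNReal.ofReal (1 + CX) := by
    intro r hr
    calc ∫⁻ ω, ENNReal.ofReal (X 0 ω r ^ 2) ∂P
        ≤ ∫⁻ ω, (1 + ENNReal.ofReal (X 0 ω r ^ 4)) ∂P := by
          refine lintegral_mono fun ω => ?_
          rw [← ENNReal.ofReal_one, ← ENNReal.ofReal_add zero_le_one (by positivity)]
          refine ENNReal.ofReal_le_ofReal ?_
          nlinarith [sq_nonneg (X 0 ω r ^ 2 - 1), sq_nonneg (X 0 ω r ^ 2 + 1)]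
      _ = 1 + ∫⁻ ω, ENNReal.ofReal (X 0 ω r ^ 4) ∂P := by
          rw [lintegral_add_left measurable_const, lintegral_const, measure_univ, mul_one]
      _ ≤ 1 + ENNReal.ofReal CX := by
          gcongr
          exact h.lintegral_pow_four_le 0 hr
      _ = _ := by rw [ENNReal.ofReal_add zero_le_one (NNReal.coe_nonneg CX), ENNReal.ofReal_one]
  set G : Ω → ℝ → ℝ := fun ω => g (Z 0 ω)
  have hG : IsL2Process P G (1 + CX) := by
    refine ⟨hg.comp (((hZ 0).comp measurable_fst).prodMk measurable_snd), fun r hr => ?_⟩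
    refine le_trans (le_of_eq (lintegral_congr_ae ?_)) (hmom r hr)
    filter_upwards [hX 0] with ω hω
    rw [hω r hr]
  have hXG : ∀ r ∈ Set.Icc (0 : ℝ) 1, (fun ω => X 0 ω r) =ᵐ[P] fun ω => G ω r := by
    intro r hr
    filter_upwards [hX 0] with ω hω using hω r hr
  have hΓ : ∀ r ∈ Set.Icc (0 : ℝ) 1, ∀ r' ∈ Set.Icc (0 : ℝ) 1,
      covKernel P X r r' = ∫ ω, G ω r * G ω r' ∂P := by
    intro r hr r' hr'
    have h1 : ∀ r ∈ Set.Icc (0 : ℝ) 1, MemLp (fun ω => X 0 ω r) 2 P := fun r hr =>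
      (memLp_congr_ae (hXG r hr)).2 (hG.memLp_eval hr)
    rw [covKernel, covariance_eq_sub (h1 r hr) (h1 r' hr'), h.mean_zero 0 r hr, zero_mul, sub_zero]
    refine integral_congr_ae ?_
    filter_upwards [hXG r hr, hXG r' hr'] with ω h2 h3
    rw [Pi.mul_apply, h2, h3]
  have hV : ∃ V : Submodule ℝ (Lp ℝ 2 unitVol), Module.finrank ℝ V = L ∧
      ∀ᵐ ω ∂P, ∃ v ∈ V, G ω =ᵐ[unitVol] v := by
    obtain ⟨V, hVL, hV⟩ := h.finite_dim
    refine ⟨V, hVL, ?_⟩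
    filter_upwards [hV 0, hX 0] with ω ⟨v, hv, hv'⟩ hω
    refine ⟨v, hv, ?_⟩
    filter_upwards [hv', ae_unitVol_mem] with r h1 hr
    rw [← h1, hω r hr]
  obtain ⟨h1, h2⟩ := hG.karhunen_loeve_of_measurable hE hψm hΓ h.continuous_cov hL hV hr
  constructor
  · simp only [hψ _ r hr]
    rw [h1, hΓ r hr r hr]
    simp_rw [← sq]
    rw [integral_eq_lintegral_of_nonneg_ae (ae_of_all _ fun ω => sq_nonneg _)
      ((hG.measurable_eval r).pow_const 2).aestronglyMeasurable]
    exact ENNReal.toReal_le_of_le_ofReal (by positivity) (hG.moment r hr)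
  · have hm : MeasurableSet {z | g z r = ∑ k, score (g z) (ψ k) * ψ k r} := by
      refine measurableSet_eq_fun (hg.comp measurable_prodMk_right) ?_
      exact Finset.measurable_fun_sum _ fun k _ =>
        (measurable_score_of_uncurry hg (hψm k)).mul_const _
    -- The expansion for the first curve is a statement about the common law μ of the pasts, and so
    -- transfers to every t.
    have h3 : ∀ᵐ z ∂μ, g z r = ∑ k, score (g z) (ψ k) * ψ k r := by
      rw [← hμ 0, ae_map_iff (hZ 0).aemeasurable hm]
      exact h2
    intro t
    rw [← hμ t, ae_map_iff (hZ t).aemeasurable hm] at h3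
    filter_upwards [h3, hX t] with ω h4 h5
    rw [h5 r hr, h4]
    refine Finset.sum_congr rfl fun k _ => ?_
    rw [score_congr_left h5, score_congr_right (hψ k), hψ k r hr]

theorem ae_forall_eq_sum_score (h : SignalAssumption.{w, v} P X lam φ K CX CS) (hL : 1 ≤ L)
    {p : ℕ} {s : Fin p → ℝ} (hs : ∀ j, s j ∈ Set.Icc (0 : ℝ) 1) :
    ∀ᵐ ω ∂P, ∀ t j, X t ω (s j) = ∑ k, score (X t ω) (φ k) * φ k (s j) :=
  ae_all_iff.2 fun t => ae_all_iff.2 fun j => (h.karhunen_loeve hL (hs j)).2 t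

/-- Cauchy–Schwarz after distributing √λ_k: the weights satisfy ∑ λ_k φ_k(r)² = Γ(r,r), a second
moment, hence at most 1 + CX uniformly in L. -/
theorem sq_le_mul_norm_factor_sq (h : SignalAssumption.{w, v} P X lam φ K CX CS) (hL : 1 ≤ L)
    {r : ℝ} (hr : r ∈ Set.Icc (0 : ℝ) 1) {t : ℕ} {ω : Ω}
    (hω : X t ω r = ∑ k, score (X t ω) (φ k) * φ k r) :
    X t ω r ^ 2 ≤ (1 + CX) * ‖factor lam φ (X t ω)‖ ^ 2 := by
  rw [norm_factor_sq lam h.eigenSystem.pos, hω]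
  have h1 : ∀ k, score (X t ω) (φ k) * φ k r =
      (√(lam k) * φ k r) * (score (X t ω) (φ k) / √(lam k)) := by
    intro k
    have := Real.sqrt_pos.2 (h.eigenSystem.pos k)
    field_simp
  simp_rw [h1]
  refine (Finset.sum_mul_sq_le_sq_mul_sq _ _ _).trans ?_
  simp_rw [mul_pow, div_pow, Real.sq_sqrt (h.eigenSystem.pos _).le]
  refine mul_le_mul_of_nonneg_right (h.karhunen_loeve hL hr).1 ?_
  exact Finset.sum_nonneg fun k _ => div_nonneg (sq_nonneg _) (h.eigenSystem.pos k).le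

end NoisyFDA.SignalAssumption

end Signal

/-! ### The size conditions and the rate they imply, in the scales τ = T^{1/4} and π = √p. -/

section Regularity

/-- Size conditions, at scale `M`, on the signal and the noise matrix which hold with high
probability. -/
structure IsRegularSample {p T : ℕ} (X U : Matrix (Fin p) (Fin T) ℝ) (M : ℝ) : Prop where
  noise_norm : ∀ v : Fin T → ℝ, ∑ j, (∑ t, U j t * v t) ^ 2 ≤
    (M * ((T : ℝ) ^ (1 / 4 : ℝ) * √p + ((T : ℝ) ^ (1 / 4 : ℝ)) ^ 2)) ^ 2 * ∑ t, v t ^ 2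
  signal_row : ∀ j, ∑ t, X j t ^ 2 ≤ (M * ((T : ℝ) ^ (1 / 4 : ℝ)) ^ 2) ^ 2
  noise_row : ∀ j, ∑ t, U j t ^ 2 ≤ (M * ((T : ℝ) ^ (1 / 4 : ℝ)) ^ 2) ^ 2
  signal_noise_row : ∀ j, ∑ i, (∑ t, X i t * U j t) ^ 2 ≤
    (M * (((T : ℝ) ^ (1 / 4 : ℝ)) ^ 3 * √p)) ^ 2
  signal_noise_col : ∀ t, ∑ s, (∑ i, X i s * U i t) ^ 2 ≤
    (M * ((T : ℝ) ^ (1 / 4 : ℝ) * (((T : ℝ) ^ (1 / 4 : ℝ)) ^ 2 * √p + √p ^ 2))) ^ 2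
  noise_noise_col : ∀ t, ∑ s, (∑ i, U i s * U i t) ^ 2 ≤
    (M * ((T : ℝ) ^ (1 / 4 : ℝ) * (((T : ℝ) ^ (1 / 4 : ℝ)) ^ 2 * √p + √p ^ 2))) ^ 2

theorem one_le_rpow_quarter {T : ℕ} (hT : 1 ≤ T) : 1 ≤ (T : ℝ) ^ (1 / 4 : ℝ) :=
  Real.one_le_rpow (by exact_mod_cast hT) (by norm_num)

theorem rpow_quarter_pow_four (T : ℕ) : ((T : ℝ) ^ (1 / 4 : ℝ)) ^ 4 = T := by
  rw [← Real.rpow_natCast, ← Real.rpow_mul (by positivity)]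
  norm_num

theorem rpow_quarter_sq (T : ℕ) : ((T : ℝ) ^ (1 / 4 : ℝ)) ^ 2 = √(T : ℝ) := by
  rw [← Real.rpow_natCast, ← Real.rpow_mul (by positivity), Real.sqrt_eq_rpow]
  norm_num

theorem rate_nonneg (T p : ℕ) : 0 ≤ rate T p := by
  unfold rate
  positivity

-- With r = 1/τ + τ/π the rate and q = 1/τ + 1/π ≤ r, the noise norm is M τ² π q and the column
-- products divided by a are 2 M² Λ π r. Every term then carries a factor r, and each division by a
-- costs one Λ, at most three in all. The constant is 30 = 24 + 4 + 2 from `h5`, `h6` and `h7`.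
set_option maxHeartbeats 1000000 in
theorem reconstruction_arithmetic {τ π M Lam m : ℝ} (hτ : 1 ≤ τ) (hπ : 1 ≤ π) (hM : 1 ≤ M)
    (hLam : 1 ≤ Lam) (hm : 0 ≤ m) :
    (M * (τ ^ 3 * π) + M * (τ * π + τ ^ 2) * (M * τ ^ 2)) / (τ ^ 2 * π / (M * Lam)) *
        ((π * m + (M * (τ * (τ ^ 2 * π + π ^ 2)) + M * (τ * (τ ^ 2 * π + π ^ 2))) /
          (τ ^ 2 * π / (M * Lam))) / (τ ^ 2 * π / (M * Lam))) +
      2 / (τ ^ 2 * π / (M * Lam)) *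
        (M * τ ^ 2 * ((M * (τ * (τ ^ 2 * π + π ^ 2)) + M * (τ * (τ ^ 2 * π + π ^ 2))) /
          (τ ^ 2 * π / (M * Lam))) +
        2 * (M * (τ * π + τ ^ 2) * (M * τ ^ 2) *
          ((π * m + (M * (τ * (τ ^ 2 * π + π ^ 2)) + M * (τ * (τ ^ 2 * π + π ^ 2))) /
          (τ ^ 2 * π / (M * Lam))) / (τ ^ 2 * π / (M * Lam)))) +
        M * (τ * π + τ ^ 2) * m) ≤
    30 * M ^ 6 * Lam ^ 3 * (1 / τ + τ / π) * (m + 1) := by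
  have hτ0 : 0 < τ := by linarith
  have hπ0 : 0 < π := by linarith
  have hM0 : 0 < M := by linarith
  have hL0 : 0 < Lam := by linarith
  set a := τ ^ 2 * π / (M * Lam) with ha
  set r := 1 / τ + τ / π with hr
  set q := 1 / τ + 1 / π with hq
  have hq0 : 0 < q := by positivity
  have hr0 : 0 < r := by positivity
  have hqr : q ≤ r := by
    have : 1 / π ≤ τ / π := by gcongr
    linarith
  have hq2 : q ≤ 2 := by
    have h1 : 1 / π ≤ 1 := by rw [div_le_one hπ0]; exact hπ
    have h2 : 1 / τ ≤ 1 := by rw [div_le_one hτ0]; exact hτ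
    linarith
  have hW : (M * (τ * (τ ^ 2 * π + π ^ 2)) + M * (τ * (τ ^ 2 * π + π ^ 2))) / a =
      2 * M ^ 2 * Lam * π * r := by
    rw [ha, hr]
    field_simp
    ring
  rw [hW]
  have hh : (π * m + 2 * M ^ 2 * Lam * π * r) / a = M * Lam * (m + 2 * M ^ 2 * Lam * r) / τ ^ 2 := by
    rw [ha]
    field_simp
  rw [hh]
  have hN : M * (τ * π + τ ^ 2) = M * (τ ^ 2 * π * q) := by
    rw [hq]
    field_simp
  rw [hN]
  have h1 : (M * (τ ^ 3 * π) + M * (τ ^ 2 * π * q) * (M * τ ^ 2)) / a *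
      (M * Lam * (m + 2 * M ^ 2 * Lam * r) / τ ^ 2) =
      M ^ 3 * Lam ^ 2 * (1 / τ + M * q) * (m + 2 * M ^ 2 * Lam * r) := by
    rw [ha]
    field_simp
  have h2 : 2 / a * (M * τ ^ 2 * (2 * M ^ 2 * Lam * π * r) + 2 * (M * (τ ^ 2 * π * q) * (M * τ ^ 2) *
      (M * Lam * (m + 2 * M ^ 2 * Lam * r) / τ ^ 2)) + M * (τ ^ 2 * π * q) * m) =
      4 * M ^ 4 * Lam ^ 2 * r + 4 * M ^ 4 * Lam ^ 2 * q * (m + 2 * M ^ 2 * Lam * r) +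
        2 * M ^ 2 * Lam * q * m := by
    rw [ha]
    field_simp
    ring
  rw [h1, h2]
  have hτq : 1 / τ ≤ M * q := by
    have h3 : 1 / τ ≤ q := by
      have : 0 < 1 / π := by positivity
      linarith
    nlinarith
  have h3 : q * (m + 2 * M ^ 2 * Lam * r) ≤ 4 * M ^ 2 * Lam * r * (m + 1) := by
    have e1 : q * m ≤ r * m := by gcongr
    have e2 : q * (2 * M ^ 2 * Lam * r) ≤ 2 * (2 * M ^ 2 * Lam * r) := by gcongr
    have e3 : r * m ≤ 4 * M ^ 2 * Lam * (r * m) := by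
      have : 1 ≤ M ^ 2 * Lam := one_le_mul_of_one_le_of_one_le (one_le_pow₀ hM) hLam
      have : 0 ≤ r * m := by positivity
      nlinarith
    nlinarith
  have h4 : M ^ 3 * Lam ^ 2 * (1 / τ + M * q) * (m + 2 * M ^ 2 * Lam * r) ≤
      2 * M ^ 4 * Lam ^ 2 * (q * (m + 2 * M ^ 2 * Lam * r)) := by
    have : 0 ≤ m + 2 * M ^ 2 * Lam * r := by positivity
    calc M ^ 3 * Lam ^ 2 * (1 / τ + M * q) * (m + 2 * M ^ 2 * Lam * r)
        ≤ M ^ 3 * Lam ^ 2 * (M * q + M * q) * (m + 2 * M ^ 2 * Lam * r) := by gcongr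
      _ = _ := by ring
  have h5 : 6 * M ^ 4 * Lam ^ 2 * (q * (m + 2 * M ^ 2 * Lam * r)) ≤
      24 * (M ^ 6 * Lam ^ 3 * r * (m + 1)) := by
    calc 6 * M ^ 4 * Lam ^ 2 * (q * (m + 2 * M ^ 2 * Lam * r))
        ≤ 6 * M ^ 4 * Lam ^ 2 * (4 * M ^ 2 * Lam * r * (m + 1)) := by gcongr
      _ = _ := by ring
  have h6 : M ^ 4 * Lam ^ 2 * r ≤ M ^ 6 * Lam ^ 3 * r * (m + 1) := by
    have e1 : M ^ 4 * Lam ^ 2 ≤ M ^ 6 * Lam ^ 3 :=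
      mul_le_mul (pow_le_pow_right₀ hM (by norm_num)) (pow_le_pow_right₀ hLam (by norm_num))
        (by positivity) (by positivity)
    calc M ^ 4 * Lam ^ 2 * r = M ^ 4 * Lam ^ 2 * r * 1 := (mul_one _).symm
      _ ≤ _ := by gcongr; linarith
  have h7 : M ^ 2 * Lam * q * m ≤ M ^ 6 * Lam ^ 3 * r * (m + 1) := by
    have e1 : M ^ 2 * Lam ≤ M ^ 6 * Lam ^ 3 :=
      mul_le_mul (pow_le_pow_right₀ hM (by norm_num)) (le_self_pow₀ hLam (by norm_num))
        (by positivity) (by positivity)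
    calc M ^ 2 * Lam * q * m ≤ M ^ 6 * Lam ^ 3 * r * m := by gcongr
      _ ≤ _ := by gcongr; linarith
  linarith

/-- The reconstruction error for regular samples. -/
theorem IsRegularSample.reconstruction_le {p T L : ℕ} {X U : Matrix (Fin p) (Fin T) ℝ} {M : ℝ}
    (h : IsRegularSample X U M) (hM : 1 ≤ M) (hT : 1 ≤ T) (hp : 1 ≤ p) {g : Fin T → ℝ}
    {e : Fin T → EuclideanSpace ℝ (Fin T)} (hPCA : IsPCA (X + U) g e) (hL : 1 ≤ L) (hLT : L ≤ T)
    (hrank : ∃ (B : Matrix (Fin p) (Fin L) ℝ) (F : Matrix (Fin L) (Fin T) ℝ), X = B * F)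
    {Lam : ℝ} (hLam : 1 ≤ Lam) (hg : p ≤ M * Lam ^ 2 * kthEigenvalue g L) (j : Fin p) (t : Fin T)
    {m : ℝ} (hm : ∀ i, |X i t| ≤ m) :
    |signalEstimator (X + U) e L j t - X j t| ≤
      30 * M ^ 6 * Lam ^ 3 * rate T p * (m + 1) := by
  have hτ := one_le_rpow_quarter hT
  have hπ : 1 ≤ √(p : ℝ) := Real.one_le_sqrt.2 (by exact_mod_cast hp)
  have hm0 : 0 ≤ m := (abs_nonneg _).trans (hm j)
  set τ := (T : ℝ) ^ (1 / 4 : ℝ)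
  set π := √(p : ℝ)
  have hTτ : (T : ℝ) = τ ^ 4 := (rpow_quarter_pow_four T).symm
  have hpπ : (p : ℝ) = π ^ 2 := (Real.sq_sqrt (by positivity)).symm
  have hM0 : 0 < M := by linarith
  have hL0 : 0 < Lam := by linarith
  refine (pca_reconstruction_bound hPCA hL hLT (a := τ ^ 2 * π / (M * Lam)) (by positivity) ?_ hrank
    (N := M * (τ * π + τ ^ 2)) (η := M * τ ^ 2) (ξ := M * τ ^ 2) (ζ := M * (τ ^ 3 * π))
    (ω₁ := M * (τ * (τ ^ 2 * π + π ^ 2))) (ω₂ := M * (τ * (τ ^ 2 * π + π ^ 2))) (m := m)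
    (y := π * m) (by positivity) (by positivity) (by positivity) (by positivity) (by positivity)
    (by positivity) (by positivity) h.noise_norm j t (h.noise_row j) (h.signal_row j)
    (h.signal_noise_row j) (h.signal_noise_col t) (h.noise_noise_col t) (hm j) ?_).trans
    (reconstruction_arithmetic hτ hπ hM hLam hm0)
  · rw [div_pow, div_le_iff₀ (by positivity), hTτ]
    rw [hpπ] at hg
    have hg0 : 0 < kthEigenvalue g L := by
      by_contra hcon
      have h1 : M * Lam ^ 2 * kthEigenvalue g L ≤ 0 :=
        mul_nonpos_of_nonneg_of_nonpos (by positivity) (not_lt.1 hcon)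
      have : 0 < π ^ 2 := by positivity
      linarith
    calc (τ ^ 2 * π) ^ 2 = τ ^ 4 * π ^ 2 := by ring
      _ ≤ τ ^ 4 * (M * Lam ^ 2 * kthEigenvalue g L) := by gcongr
      -- M ≤ M² as M ≥ 1; this avoids a square root of M in the choice a = τ² π / (M Λ).
      _ ≤ τ ^ 4 * (M ^ 2 * Lam ^ 2 * kthEigenvalue g L) := by
          gcongr
          nlinarith
      _ = _ := by ring
  · calc ∑ i, X i t ^ 2 ≤ ∑ _i : Fin p, m ^ 2 := by
          refine Finset.sum_le_sum fun i _ => ?_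
          rw [← sq_abs]
          have := hm i
          gcongr
      _ = (π * m) ^ 2 := by
          rw [Finset.sum_const, Finset.card_univ, Fintype.card_fin, nsmul_eq_mul, hpπ]
          ring

/-- In a regular sample with a large `L`-th eigenvalue some signal is bounded away from zero. -/
theorem IsRegularSample.le_of_forall_abs_le {p T L : ℕ} {X U : Matrix (Fin p) (Fin T) ℝ} {M : ℝ}
    (h : IsRegularSample X U M) (hM : 1 ≤ M) (hT : 1 ≤ T) (hp : 1 ≤ p) {g : Fin T → ℝ}
    {e : Fin T → EuclideanSpace ℝ (Fin T)} (hPCA : IsPCA (X + U) g e) (hL : 1 ≤ L) (hLT : L ≤ T)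
    (hg : p ≤ M * kthEigenvalue g L)
    {m : ℝ} (hm0 : 0 ≤ m) (hm : ∀ i t, |X i t| ≤ m) :
    1 / M ≤ m + M * (1 / (T : ℝ) ^ (1 / 4 : ℝ) + 1 / √p) := by
  have hτ := one_le_rpow_quarter hT
  have hπ : 1 ≤ √(p : ℝ) := Real.one_le_sqrt.2 (by exact_mod_cast hp)
  set τ := (T : ℝ) ^ (1 / 4 : ℝ)
  set π := √(p : ℝ)
  have hTτ : (T : ℝ) = τ ^ 4 := (rpow_quarter_pow_four T).symm
  have hpπ : (p : ℝ) = π ^ 2 := (Real.sq_sqrt (by positivity)).symm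
  have hM0 : 0 < M := by linarith
  have h1 := le_frobenius_add_of_kthEigenvalue hPCA hL hLT (a := τ ^ 2 * π / M)
    (N := M * (τ * π + τ ^ 2)) (by positivity) ?_ h.noise_norm
  · have h2 : √(∑ j, ∑ t, X j t ^ 2) ≤ τ ^ 2 * π * m := by
      refine Real.sqrt_le_iff.2 ⟨by positivity, ?_⟩
      calc ∑ j, ∑ t, X j t ^ 2 ≤ ∑ _j : Fin p, ∑ _t : Fin T, m ^ 2 := by
            refine Finset.sum_le_sum fun i _ => Finset.sum_le_sum fun t _ => ?_
            rw [← sq_abs]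
            have := hm i t
            gcongr
        _ = _ := by
            simp only [Finset.sum_const, Finset.card_univ, Fintype.card_fin, nsmul_eq_mul]
            rw [hpπ, hTτ]
            ring
    have h3 : τ ^ 2 * π * (1 / M) ≤ τ ^ 2 * π * (m + M * (1 / τ + 1 / π)) := by
      calc τ ^ 2 * π * (1 / M) = τ ^ 2 * π / M := by ring
        _ ≤ τ ^ 2 * π * m + M * (τ * π + τ ^ 2) := by linarith
        _ = _ := by field_simp
    exact le_of_mul_le_mul_left h3 (by positivity)
  · rw [div_pow, div_le_iff₀ (by positivity), hTτ]
    rw [hpπ] at hg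
    have hg0 : 0 < kthEigenvalue g L := by
      by_contra hcon
      have h1 : M * kthEigenvalue g L ≤ 0 :=
        mul_nonpos_of_nonneg_of_nonpos (by positivity) (not_lt.1 hcon)
      have : 0 < π ^ 2 := by positivity
      linarith
    calc (τ ^ 2 * π) ^ 2 = τ ^ 4 * π ^ 2 := by ring
      _ ≤ τ ^ 4 * (M * kthEigenvalue g L) := by gcongr
      _ ≤ τ ^ 4 * (M ^ 2 * kthEigenvalue g L) := by
          gcongr
          nlinarith
      _ = _ := by ring

end Regularity

/-! ### Regularity holds with probability close to one, uniformly over samples. -/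

section RegularityProbability

set_option linter.unusedSectionVars false

theorem eventually_ofReal_le {f : ℝ → ℝ} (hf : Tendsto f atTop (𝓝 0)) {ε : ℝ≥0∞} (hε : 0 < ε) :
    ∀ᶠ M in atTop, ENNReal.ofReal (f M) ≤ ε := by
  have h := ENNReal.tendsto_ofReal hf
  rw [ENNReal.ofReal_zero] at h
  exact h.eventually_le_const hε

theorem tendsto_const_div_pow_atTop (c : ℝ) {n : ℕ} (hn : n ≠ 0) :
    Tendsto (fun M : ℝ => c / M ^ n) atTop (𝓝 0) :=
  tendsto_const_nhds.div_atTop (tendsto_pow_atTop hn)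

theorem tendsto_exp_sub_atTop (c : ℝ) {f : ℝ → ℝ} (hf : Tendsto f atTop atTop) :
    Tendsto (fun M => Real.exp (c - f M)) atTop (𝓝 0) :=
  Real.tendsto_exp_atBot.comp (tendsto_atBot_add_const_left _ c (tendsto_neg_atTop_atBot.comp hf))

variable {Ω : Type w} [MeasurableSpace Ω] {P : Measure Ω} [IsProbabilityMeasure P]

/-- The distributional facts on a sample of size `T` at `p` points that control its regularity. -/
structure IsSample (P : Measure Ω) (X : ℕ → Ω → ℝ → ℝ) {p : ℕ} (u : ℕ → Ω → Fin p → ℝ)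
    (s : Fin p → ℝ) (γ : ℤ → ℝ) (κ : ℝ) (CX CS : ℝ≥0) (T : ℕ) : Prop where
  noise : NoiseAssumption P X u γ
  one_le_T : 1 ≤ T
  one_le_p : 1 ≤ p
  log_le : Real.log p ≤ κ * √T
  grid : ∀ j, s j ∈ Set.Icc (0 : ℝ) 1
  measurable : ∀ t, ∀ r ∈ Set.Icc (0 : ℝ) 1, Measurable fun ω => X t ω r
  fourth : ∀ t j, ∫⁻ ω, ENNReal.ofReal (X t ω (s j) ^ 4) ∂P ≤ ENNReal.ofReal CX
  sup : ∀ t, ∫⁻ ω, ⨆ j, ENNReal.ofReal (X t ω (s j) ^ 2) ∂P ≤ CS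

namespace IsSample

variable {X : ℕ → Ω → ℝ → ℝ} {p : ℕ} {u : ℕ → Ω → Fin p → ℝ} {s : Fin p → ℝ} {γ : ℤ → ℝ}
  {κ : ℝ} {CX CS : ℝ≥0} {T : ℕ}

theorem p_le_exp (h : IsSample P X u s γ κ CX CS T) : (p : ℝ) ≤ Real.exp (κ * √T) := by
  have hp : (0 : ℝ) < p := by exact_mod_cast h.one_le_p
  rw [← Real.log_le_iff_le_exp hp]
  exact h.log_le

theorem one_le_sqrt (h : IsSample P X u s γ κ CX CS T) : 1 ≤ √(T : ℝ) :=
  Real.one_le_sqrt.2 (by exact_mod_cast h.one_le_T)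

theorem measurable_iSup (h : IsSample P X u s γ κ CX CS T) (t : ℕ) :
    Measurable fun ω => ⨆ j, ENNReal.ofReal (X t ω (s j) ^ 2) := by
  refine Measurable.iSup fun j => ?_
  have := h.measurable t _ (h.grid j)
  fun_prop

theorem measure_iSup_abs_lt_le (h : IsSample P X u s γ κ CX CS T) (t : ℕ) {M : ℝ} (hM : 0 < M) :
    P {ω | M < ⨆ j, |X t ω (s j)|} ≤ ENNReal.ofReal (CS / M ^ 2) := by
  have hne : Nonempty (Fin p) := ⟨⟨0, h.one_le_p⟩⟩
  have hsub : {ω | M < ⨆ j, |X t ω (s j)|} ⊆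
      {ω | ENNReal.ofReal (M ^ 2) ≤ ⨆ j, ENNReal.ofReal (X t ω (s j) ^ 2)} := by
    intro ω hω
    simp only [Set.mem_ofPred_eq] at hω ⊢
    obtain ⟨j, hj⟩ := exists_lt_of_lt_ciSup hω
    refine le_trans (ENNReal.ofReal_le_ofReal ?_)
      (le_iSup (fun j => ENNReal.ofReal (X t ω (s j) ^ 2)) j)
    rw [← sq_abs (X t ω (s j))]
    gcongr
  refine (measure_mono hsub).trans ?_
  refine (meas_ge_le_lintegral_div (h.measurable_iSup t).aemeasurable (by simp [hM.ne'])
    (by simp)).trans ?_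
  rw [ENNReal.ofReal_div_of_pos (by positivity)]
  refine ENNReal.div_le_div_right ((h.sup t).trans (by simp)) _

theorem measure_signal_row_le (h : IsSample P X u s γ κ CX CS T) {M : ℝ} (hM : 0 < M) :
    P {ω | ¬∀ j, ∑ t : Fin T, X t ω (s j) ^ 2 ≤ (M * ((T : ℝ) ^ (1 / 4 : ℝ)) ^ 2) ^ 2} ≤
      ENNReal.ofReal (CS / M ^ 2) := by
  have hT : (0 : ℝ) < T := by exact_mod_cast h.one_le_T
  have hsub : {ω | ¬∀ j, ∑ t : Fin T, X t ω (s j) ^ 2 ≤ (M * ((T : ℝ) ^ (1 / 4 : ℝ)) ^ 2) ^ 2} ⊆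
      {ω | ENNReal.ofReal (M ^ 2 * T) ≤
        ∑ t : Fin T, ⨆ j, ENNReal.ofReal (X t ω (s j) ^ 2)} := by
    intro ω hω
    simp only [Set.mem_ofPred_eq, not_forall, not_le] at hω ⊢
    obtain ⟨j, hj⟩ := hω
    rw [rpow_quarter_sq, mul_pow, Real.sq_sqrt (by positivity)] at hj
    refine (ENNReal.ofReal_le_ofReal hj.le).trans ?_
    rw [ENNReal.ofReal_sum_of_nonneg fun t _ => sq_nonneg _]
    exact Finset.sum_le_sum fun t _ => le_iSup (fun j => ENNReal.ofReal (X t ω (s j) ^ 2)) j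
  refine (measure_mono hsub).trans ?_
  refine (meas_ge_le_lintegral_div (Finset.measurable_fun_sum _ fun (t : Fin T) _ =>
    h.measurable_iSup t).aemeasurable (by simp; positivity) (by simp)).trans ?_
  rw [lintegral_finsetSum _ fun (t : Fin T) _ => h.measurable_iSup t]
  have h1 : ∑ t : Fin T, ∫⁻ ω, ⨆ j, ENNReal.ofReal (X t ω (s j) ^ 2) ∂P ≤
      ENNReal.ofReal (T * CS) := by
    refine (Finset.sum_le_sum fun (t : Fin T) _ => h.sup t).trans ?_
    rw [Finset.sum_const, Finset.card_univ, Fintype.card_fin, nsmul_eq_mul,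
      ENNReal.ofReal_mul (by positivity)]
    simp
  refine (ENNReal.div_le_div_right h1 _).trans ?_
  rw [← ENNReal.ofReal_div_of_pos (by positivity)]
  refine ENNReal.ofReal_le_ofReal (le_of_eq ?_)
  field_simp

/-- The union over p ≤ exp(κ√T) rows is beaten by a tail that is exponential in T. -/
theorem measure_noise_row_le (h : IsSample P X u s γ κ CX CS T) (hγ : Summable fun h => |γ h|)
    {C : ℝ} (hC : ∑' h, |γ h| ≤ C) (hC0 : 0 < C) {M : ℝ} (hM : κ + 1 ≤ M ^ 2 / (4 * C)) :
    P {ω | ¬∀ j, ∑ t : Fin T, u t ω j ^ 2 ≤ (M * ((T : ℝ) ^ (1 / 4 : ℝ)) ^ 2) ^ 2} ≤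
      ENNReal.ofReal (Real.exp (κ + 1 - M ^ 2 / (4 * C))) := by
  have hT : (1 : ℝ) ≤ T := by exact_mod_cast h.one_le_T
  have hset : {ω | ¬∀ j, ∑ t : Fin T, u t ω j ^ 2 ≤ (M * ((T : ℝ) ^ (1 / 4 : ℝ)) ^ 2) ^ 2} =
      {ω | ∃ j, M ^ 2 * T < ∑ t : Fin T, u t ω j ^ 2} := by
    ext ω
    rw [Set.mem_ofPred_eq, rpow_quarter_sq, mul_pow, Real.sq_sqrt (by positivity)]
    simp
  rw [hset]
  refine (h.noise.measure_exists_row_le hγ hC hC0 T _).trans (ENNReal.ofReal_le_ofReal ?_)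
  have hκ : 0 ≤ κ := by
    have h1 : 0 ≤ Real.log p := Real.log_nonneg (by exact_mod_cast h.one_le_p)
    exact nonneg_of_mul_nonneg_left (h1.trans h.log_le) (by linarith [h.one_le_sqrt])
  have h2 : 2 * Real.exp (-(M ^ 2 / (4 * C))) ≤ Real.exp (1 - M ^ 2 / (4 * C)) := by
    rw [sub_eq_add_neg, Real.exp_add]
    gcongr
    linarith [Real.add_one_le_exp (1 : ℝ)]
  have h3 : √(T : ℝ) ≤ T := by
    rw [Real.sqrt_le_iff]
    exact ⟨by positivity, by nlinarith⟩
  calc p * (2 * Real.exp (-(M ^ 2 / (4 * C)))) ^ T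
      ≤ Real.exp (κ * T) * Real.exp (1 - M ^ 2 / (4 * C)) ^ T := by
        refine mul_le_mul ?_ (by gcongr) (by positivity) (by positivity)
        exact h.p_le_exp.trans (Real.exp_le_exp.2 (by gcongr))
    _ = Real.exp (T * (κ + 1 - M ^ 2 / (4 * C))) := by
        rw [← Real.exp_nat_mul, ← Real.exp_add]
        congr 1
        ring
    _ ≤ _ := by
        -- The bracket is nonpositive by `hM`, so its factor T ≥ 1 may be dropped.
        refine Real.exp_le_exp.2 ?_
        nlinarith

/-- Here log p = O(√T) is used at full strength: a threshold √T times the signal energy has Gaussian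
tail exp(-c√T), which has to beat p² ≤ exp(2κ√T). The scale M controls the energy, and M' is then
taken large relative to M. -/
theorem measure_signal_noise_row_le (h : IsSample P X u s γ κ CX CS T)
    (hγ : Summable fun h => |γ h|) {C : ℝ} (hC : ∑' h, |γ h| ≤ C) (hC0 : 0 < C) {M M' : ℝ}
    (hM : 0 < M) (hM' : 0 < M') (hMM : 2 * κ ≤ M' ^ 2 / M ^ 2 / (4 * C)) :
    P {ω | ¬∀ j, ∑ i, (∑ t : Fin T, X t ω (s i) * u t ω j) ^ 2 ≤
        (M' * (((T : ℝ) ^ (1 / 4 : ℝ)) ^ 3 * √p)) ^ 2} ≤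
      ENNReal.ofReal (CS / M ^ 2) +
        ENNReal.ofReal (2 * Real.exp (2 * κ - M' ^ 2 / M ^ 2 / (4 * C))) := by
  have hp0 : (0 : ℝ) < p := by exact_mod_cast h.one_le_p
  have hτ4 := rpow_quarter_pow_four T
  have hτ2 := rpow_quarter_sq T
  have hsub : {ω | ¬∀ j, ∑ i, (∑ t : Fin T, X t ω (s i) * u t ω j) ^ 2 ≤
        (M' * (((T : ℝ) ^ (1 / 4 : ℝ)) ^ 3 * √p)) ^ 2} ⊆
      {ω | ¬∀ j, ∑ t : Fin T, X t ω (s j) ^ 2 ≤ (M * ((T : ℝ) ^ (1 / 4 : ℝ)) ^ 2) ^ 2} ∪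
      {ω | ∃ j, (M' ^ 2 / M ^ 2 * √T) * (∑ i, ∑ t : Fin T, X t ω (s i) ^ 2) <
        ∑ i, (∑ t : Fin T, X t ω (s i) * u t ω j) ^ 2} := by
    intro ω hω
    by_contra hcon
    simp only [Set.mem_union, Set.mem_ofPred_eq, not_or, not_not, not_exists, not_lt] at hcon
    refine hω fun j => (hcon.2 j).trans ?_
    have h1 : ∑ i, ∑ t : Fin T, X t ω (s i) ^ 2 ≤
        p * (M * ((T : ℝ) ^ (1 / 4 : ℝ)) ^ 2) ^ 2 := by
      refine (Finset.sum_le_sum fun i _ => hcon.1 i).trans ?_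
      simp
    refine (mul_le_mul_of_nonneg_left h1 (by positivity)).trans (le_of_eq ?_)
    rw [← hτ2, mul_pow M' , mul_pow _ √(p : ℝ), Real.sq_sqrt hp0.le]
    field_simp
  refine (measure_mono hsub).trans ((measure_union_le _ _).trans
    (add_le_add (h.measure_signal_row_le hM) ?_))
  refine (h.noise.measure_exists_signal_mul_row_le hγ hC hC0 h.grid h.measurable T _).trans
    (ENNReal.ofReal_le_ofReal ?_)
  have h1 := h.one_le_sqrt
  calc (p : ℝ) ^ 2 * (2 * Real.exp (-(M' ^ 2 / M ^ 2 * √T / (4 * C))))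
      ≤ Real.exp (κ * √T) ^ 2 * (2 * Real.exp (-(M' ^ 2 / M ^ 2 * √T / (4 * C)))) := by
        gcongr
        exact h.p_le_exp
    _ = 2 * Real.exp (√T * (2 * κ - M' ^ 2 / M ^ 2 / (4 * C))) := by
        rw [← Real.exp_nat_mul, mul_left_comm, ← Real.exp_add]
        congr 2
        push_cast
        ring
    _ ≤ _ := by
        gcongr
        nlinarith

/-- Samples are regular with high probability. -/
theorem eventually_measure_not_regular_le (hγ : Summable fun h => |γ h|) (κ : ℝ) (CX CS : ℝ≥0)
    {ε : ℝ≥0∞} (hε : 0 < ε) :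
    ∀ᶠ M : ℝ in atTop, ∀ (X : ℕ → Ω → ℝ → ℝ) (p : ℕ) (u : ℕ → Ω → Fin p → ℝ) (s : Fin p → ℝ)
      (T : ℕ), IsSample P X u s γ κ CX CS T →
      P {ω | ¬IsRegularSample (Matrix.of fun j (t : Fin T) => X t ω (s j))
        (Matrix.of fun j (t : Fin T) => u t ω j) M} ≤ ε := by
  have hγ0 : 0 ≤ ∑' h, |γ h| := tsum_nonneg fun _ => abs_nonneg _
  obtain ⟨C, hC, hC0⟩ : ∃ C : ℝ, ∑' h, |γ h| ≤ C ∧ 0 < C :=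
    ⟨∑' h, |γ h| + 1, by linarith, by linarith⟩
  -- Six conditions, one of which, the products of signal and noise rows, costs two shares.
  have hε7 : 0 < ε / 7 := ENNReal.div_pos hε.ne' (by simp)
  have e1 := eventually_ofReal_le (tendsto_const_div_pow_atTop (64 * C ^ 2) (n := 4) (by norm_num))
    hε7
  have e2 := eventually_ofReal_le (tendsto_const_div_pow_atTop (CS : ℝ) (n := 2) (by norm_num)) hε7
  have tq : ∀ c : ℝ, 0 < c → Tendsto (fun M : ℝ => M ^ 2 / c) atTop atTop := fun c hc =>
    (tendsto_pow_atTop (by norm_num)).atTop_div_const hc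
  have e3 := eventually_ofReal_le (tendsto_exp_sub_atTop (κ + 1) (tq (4 * C) (by positivity))) hε7
  have e5 := eventually_ofReal_le (tendsto_const_div_pow_atTop (64 * C ^ 2 * CX) (n := 4)
    (by norm_num)) hε7
  have e6 := eventually_ofReal_le (tendsto_const_div_pow_atTop (16384 * C ^ 4) (n := 4)
    (by norm_num)) hε7
  -- A fixed scale for the signal energy, chosen before M, so that M²/M₀² tends to infinity.
  obtain ⟨M₀, hM₀, hM₀'⟩ := (e2.and (eventually_gt_atTop (0 : ℝ))).exists
  have tq' : Tendsto (fun M : ℝ => M ^ 2 / M₀ ^ 2 / (4 * C)) atTop atTop :=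
    (tq _ (by positivity)).atTop_div_const (by positivity)
  have e4 := eventually_ofReal_le (f := fun M => 2 * Real.exp (2 * κ - M ^ 2 / M₀ ^ 2 / (4 * C)))
    (by simpa using (tendsto_exp_sub_atTop (2 * κ) tq').const_mul 2) hε7
  filter_upwards [e1, e2, e3, e4, e5, e6, eventually_gt_atTop (0 : ℝ),
    (tq (4 * C) (by positivity)).eventually_ge_atTop (κ + 1), tq'.eventually_ge_atTop (2 * κ),
    (tendsto_pow_atTop (α := ℝ) (n := 2) (by norm_num)).eventually_ge_atTop C]
    with M a1 a2 a3 a4 a5 a6 hM b3 b4 b1 X p u s T h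
  have hT0 : (0 : ℝ) < T := by exact_mod_cast h.one_le_T
  have hp0 : (0 : ℝ) < p := by exact_mod_cast h.one_le_p
  have hτ := one_le_rpow_quarter h.one_le_T
  have hτ4 := rpow_quarter_pow_four T
  have hτ2 := rpow_quarter_sq T
  have hπ2 : √(p : ℝ) ^ 2 = p := Real.sq_sqrt hp0.le
  have hπ0 : 0 < √(p : ℝ) := Real.sqrt_pos.2 hp0
  set τ := (T : ℝ) ^ (1 / 4 : ℝ)
  set π := √(p : ℝ)
  have hτ0 : 0 < τ := by linarith
  set X' : Ω → Matrix (Fin p) (Fin T) ℝ := fun ω => Matrix.of fun j (t : Fin T) => X t ω (s j)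
  set U' : Ω → Matrix (Fin p) (Fin T) ℝ := fun ω => Matrix.of fun j (t : Fin T) => u t ω j
  set B1 := {ω | ¬∀ v : Fin T → ℝ, ∑ j, (∑ t : Fin T, u t ω j * v t) ^ 2 ≤
    (M * (τ * π + τ ^ 2)) ^ 2 * ∑ t, v t ^ 2}
  set B2 := {ω | ¬∀ j, ∑ t : Fin T, X t ω (s j) ^ 2 ≤ (M * τ ^ 2) ^ 2}
  set B3 := {ω | ¬∀ j, ∑ t : Fin T, u t ω j ^ 2 ≤ (M * τ ^ 2) ^ 2}
  set B4 := {ω | ¬∀ j, ∑ i, (∑ t : Fin T, X t ω (s i) * u t ω j) ^ 2 ≤ (M * (τ ^ 3 * π)) ^ 2}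
  set B5 := {ω | ¬∀ t : Fin T, ∑ r : Fin T, (∑ i, X r ω (s i) * u t ω i) ^ 2 ≤
    (M * (τ * (τ ^ 2 * π + π ^ 2))) ^ 2}
  set B6 := {ω | ¬∀ t : Fin T, ∑ r : Fin T, (∑ i, u r ω i * u t ω i) ^ 2 ≤
    (M * (τ * (τ ^ 2 * π + π ^ 2))) ^ 2}
  have h1 : P B1 ≤ ε / 7 := by
    refine le_trans (measure_mono ?_) ((h.noise.measure_exists_mulVec_le hγ hC hC0 h.one_le_T
      h.one_le_p (M := M ^ 2) (by positivity)).trans ?_)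
    · intro ω hω
      simp only [B1, Set.mem_ofPred_eq, not_forall, not_le] at hω ⊢
      obtain ⟨v, hv⟩ := hω
      refine ⟨v, lt_of_le_of_lt ?_ hv⟩
      gcongr
      rw [← hτ2, ← hτ4, ← hπ2]
      -- The probabilistic threshold adds the two squared scales, while the regularity condition
      -- squares their sum; C ≤ M² and the nonnegative cross term bridge the gap.
      calc τ ^ 4 * C + M ^ 2 * (π ^ 2 * τ ^ 2) ≤ τ ^ 4 * M ^ 2 + M ^ 2 * (π ^ 2 * τ ^ 2) := by
            gcongr
        _ ≤ τ ^ 4 * M ^ 2 + M ^ 2 * (π ^ 2 * τ ^ 2) + 2 * M ^ 2 * τ ^ 3 * π := by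
            have : 0 ≤ 2 * M ^ 2 * τ ^ 3 * π := by positivity
            linarith
        _ = _ := by ring
    · rwa [← pow_mul]
  have h2 : P B2 ≤ ε / 7 := (h.measure_signal_row_le hM).trans a2
  have h3 : P B3 ≤ ε / 7 := (h.measure_noise_row_le hγ hC hC0 b3).trans a3
  have h4 : P B4 ≤ ε / 7 + ε / 7 :=
    (h.measure_signal_noise_row_le hγ hC hC0 hM₀' hM b4).trans (add_le_add hM₀ a4)
  have h5 : P B5 ≤ ε / 7 := by
    refine le_trans (measure_mono ?_) ((h.noise.measure_exists_signal_mul_col_le hγ hC hC0 h.grid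
      h.measurable h.fourth h.one_le_T h.one_le_p (K := M ^ 2) (by positivity)).trans ?_)
    · intro ω hω
      simp only [B5, Set.mem_ofPred_eq, not_forall, not_le] at hω ⊢
      obtain ⟨t, ht⟩ := hω
      refine ⟨t, lt_of_le_of_lt ?_ ht⟩
      rw [← hτ2, ← hτ4, ← hπ2]
      have : 0 ≤ M ^ 2 * τ ^ 2 * (2 * τ ^ 2 * π ^ 3 + π ^ 4) := by positivity
      calc M ^ 2 * (τ ^ 2 * (τ ^ 4 * π ^ 2)) ≤ M ^ 2 * (τ ^ 2 * (τ ^ 4 * π ^ 2)) +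
            M ^ 2 * τ ^ 2 * (2 * τ ^ 2 * π ^ 3 + π ^ 4) := by linarith
        _ = _ := by ring
    · rwa [← pow_mul]
  have h6 : P B6 ≤ ε / 7 := by
    refine le_trans (measure_mono ?_) ((h.noise.measure_exists_col_mul_col_le hγ hC hC0
      h.one_le_T h.one_le_p (K := M ^ 2) (by positivity)).trans ?_)
    · intro ω hω
      simp only [B6, Set.mem_ofPred_eq, not_forall, not_le] at hω ⊢
      obtain ⟨t, ht⟩ := hω
      refine ⟨t, lt_of_le_of_lt ?_ ht⟩
      rw [← hτ2, ← hτ4, ← hπ2]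
      have : 0 ≤ M ^ 2 * τ ^ 2 * (2 * τ ^ 2 * π ^ 3) := by positivity
      calc M ^ 2 * (τ ^ 2 * (τ ^ 4 * π ^ 2)) + M ^ 2 * (τ ^ 2 * (π ^ 2) ^ 2) ≤
            M ^ 2 * (τ ^ 2 * (τ ^ 4 * π ^ 2)) + M ^ 2 * (τ ^ 2 * (π ^ 2) ^ 2) +
            M ^ 2 * τ ^ 2 * (2 * τ ^ 2 * π ^ 3) := by linarith
        _ = _ := by ring
    · rwa [← pow_mul]
  have hsub : {ω | ¬IsRegularSample (X' ω) (U' ω) M} ⊆ B1 ∪ (B2 ∪ (B3 ∪ (B4 ∪ (B5 ∪ B6)))) := by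
    intro ω hω
    by_contra hcon
    simp only [Set.mem_union, not_or, B1, B2, B3, B4, B5, B6, Set.mem_ofPred_eq, not_not] at hcon
    obtain ⟨c1, c2, c3, c4, c5, c6⟩ := hcon
    exact hω ⟨c1, c2, c3, c4, c5, c6⟩
  calc P {ω | ¬IsRegularSample (X' ω) (U' ω) M}
      ≤ P (B1 ∪ (B2 ∪ (B3 ∪ (B4 ∪ (B5 ∪ B6))))) := measure_mono hsub
    _ ≤ P B1 + (P B2 + (P B3 + (P B4 + (P B5 + P B6)))) :=
        (measure_union_le _ _).trans <| add_le_add le_rfl <| (measure_union_le _ _).trans <|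
          add_le_add le_rfl <| (measure_union_le _ _).trans <| add_le_add le_rfl <|
          (measure_union_le _ _).trans <| add_le_add le_rfl <| measure_union_le _ _
    _ ≤ ε / 7 + (ε / 7 + (ε / 7 + ((ε / 7 + ε / 7) + (ε / 7 + ε / 7)))) := by gcongr
    _ = 7 * (ε / 7) := by ring
    _ = ε := ENNReal.mul_div_cancel (by norm_num) (by norm_num)

end IsSample

end RegularityProbability

/-! ### From good outcomes to rates in probability. -/

section GoodOutcome

set_option linter.unusedSectionVars false

variable {Ω : Type w} [MeasurableSpace Ω] {P : Measure Ω} [IsProbabilityMeasure P]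

/-- The outcomes on which the reconstruction error is controlled by a deterministic bound. -/
structure IsGoodOutcome {p T L : ℕ} (X : ℕ → Ω → ℝ → ℝ) (u : ℕ → Ω → Fin p → ℝ) (s : Fin p → ℝ)
    (φ : Fin L → ℝ → ℝ) (g : Fin T → ℝ) (K : ℕ) (M Lam : ℝ) (ω : Ω) : Prop where
  expansion : ∀ t j, X t ω (s j) = ∑ k, score (X t ω) (φ k) * φ k (s j)
  memLp : ∀ t, MemLp (X t ω) 2 unitVol
  regular : IsRegularSample (Matrix.of fun j (t : Fin T) => X t ω (s j))
    (Matrix.of fun j (t : Fin T) => u t ω j) M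
  eigenvalue : p ≤ M * Lam ^ 2 * kthEigenvalue g L
  number : K = L

namespace IsGoodOutcome

variable {p T L : ℕ} {X : ℕ → Ω → ℝ → ℝ} {u : ℕ → Ω → Fin p → ℝ} {s : Fin p → ℝ}
  {φ : Fin L → ℝ → ℝ} {g : Fin T → ℝ} {e : Fin T → EuclideanSpace ℝ (Fin T)} {K : ℕ} {M Lam : ℝ}
  {ω : Ω}

theorem errorAt_le (h : IsGoodOutcome X u s φ g K M Lam ω) (hM : 1 ≤ M) (hT : 1 ≤ T) (hp : 1 ≤ p)
    (hPCA : IsPCA (dataMatrix X u s T ω) g e) (hL : 1 ≤ L) (hLT : L ≤ T) (hLam : 1 ≤ Lam)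
    (t : Fin T) {m : ℝ} (hm : ∀ j, |X t ω (s j)| ≤ m) :
    errorAt X u s e K t ω ≤ 30 * M ^ 6 * Lam ^ 3 * rate T p * (m + 1) := by
  have hne : Nonempty (Fin p) := ⟨⟨0, hp⟩⟩
  refine ciSup_le fun j => ?_
  rw [h.number]
  refine h.regular.reconstruction_le hM hT hp hPCA hL hLT
    ⟨Matrix.of fun j k => φ k (s j), Matrix.of fun k (t : Fin T) => score (X t ω) (φ k), ?_⟩
    hLam h.eigenvalue j t hm
  ext j t
  rw [Matrix.mul_apply]
  simp only [Matrix.of_apply]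
  rw [h.expansion]
  exact Finset.sum_congr rfl fun k _ => mul_comm _ _

theorem abs_le_mul_norm_factor {lam : Fin L → ℝ} {κ CX CS : ℝ≥0}
    (h : IsGoodOutcome X u s φ g K M Lam ω) (hX : SignalAssumption.{w, v} P X lam φ κ CX CS)
    (hs : ∀ j, s j ∈ Set.Icc (0 : ℝ) 1) (hL : 1 ≤ L) (t : ℕ) (j : Fin p) :
    |X t ω (s j)| ≤ √(1 + CX) * ‖factor lam φ (X t ω)‖ := by
  refine abs_le_of_sq_le_sq ?_ (by positivity)
  rw [mul_pow, Real.sq_sqrt (by positivity)]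
  exact hX.sq_le_mul_norm_factor_sq hL (hs j) (h.expansion t j)

end IsGoodOutcome

theorem abs_errorAt {p T : ℕ} (X : ℕ → Ω → ℝ → ℝ) (u : ℕ → Ω → Fin p → ℝ) (s : Fin p → ℝ)
    (e : Fin T → EuclideanSpace ℝ (Fin T)) (K : ℕ) (t : Fin T) (ω : Ω) :
    |errorAt X u s e K t ω| = errorAt X u s e K t ω :=
  abs_of_nonneg (Real.iSup_nonneg fun _ => abs_nonneg _)

theorem abs_errorUnif {p T : ℕ} (X : ℕ → Ω → ℝ → ℝ) (u : ℕ → Ω → Fin p → ℝ) (s : Fin p → ℝ)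
    (e : Fin T → EuclideanSpace ℝ (Fin T)) (K : ℕ) (ω : Ω) :
    |errorUnif X u s e K ω| = errorUnif X u s e K ω :=
  abs_of_nonneg (Real.iSup_nonneg fun _ => Real.iSup_nonneg fun _ => abs_nonneg _)

variable {p : ℕ → ℕ} {s : (T : ℕ) → Fin (p T) → ℝ} {γ : ℤ → ℝ}
  {u : (T : ℕ) → ℕ → Ω → Fin (p T) → ℝ} {Lhat : ℕ → Ω → ℕ} {L : ℕ → ℕ}
  {X : ℕ → ℕ → Ω → ℝ → ℝ} {lam : (T : ℕ) → Fin (L T) → ℝ}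
  {φ : (T : ℕ) → Fin (L T) → ℝ → ℝ} {K CX CS : ℝ≥0} {g : (T : ℕ) → Ω → Fin T → ℝ}

theorem NoisyFDA.DivergesSubexponentially.exists_isSample (hp : DivergesSubexponentially p)
    (hs : ∀ T, IsGrid (s T)) (hX : ∀ T, SignalAssumption.{w, v} P (X T) (lam T) (φ T) K CX CS)
    (hu : ∀ T, NoiseAssumption P (X T) (u T) γ) :
    ∃ κ : ℝ, ∀ᶠ T in atTop, IsSample P (X T) (u T) (s T) γ κ CX CS T := by
  obtain ⟨κ, hκ⟩ := hp.2.bound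
  refine ⟨κ, ?_⟩
  filter_upwards [hκ, hp.1.eventually_ge_atTop 1, eventually_ge_atTop 1] with T h1 h2 h3
  refine ⟨hu T, h3, h2, ?_, (hs T).2, (hX T).measurable,
    fun t j => (hX T).lintegral_pow_four_le t ((hs T).2 j),
    fun t => (hX T).lintegral_iSup_sq_le t (hs T).2⟩
  -- The constant κ of the O(√T) bound is common to all large T.
  rw [Real.norm_of_nonneg (Real.sqrt_nonneg _)] at h1
  exact (le_abs_self _).trans h1

/-- The outcomes are good with high probability. -/
theorem exists_eventually_measure_not_isGoodOutcome_le (hs : ∀ T, IsGrid (s T))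
    (hγ : Summable fun h => |γ h|) (hLhat : ∀ T, Measurable (Lhat T))
    (hX : ∀ T, SignalAssumption.{w, v} P (X T) (lam T) (φ T) K CX CS) {κ : ℝ}
    (hS : ∀ᶠ T in atTop, IsSample P (X T) (u T) (s T) γ κ CX CS T)
    (hL : ∀ᶠ T in atTop, 1 ≤ L T) {Lam : ℕ → ℝ}
    (hratio : RatioIsBigOP P (fun T => (p T : ℝ)) (fun T ω => kthEigenvalue (g T ω) (L T))
      (fun T => Lam T ^ 2))
    (hlim : Tendsto (fun T => P {ω | Lhat T ω = L T}) atTop (𝓝 1)) {ε : ℝ≥0∞} (hε : 0 < ε) :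
    ∃ M : ℝ, 1 ≤ M ∧ ∀ᶠ T in atTop,
      P {ω | ¬IsGoodOutcome (X T) (u T) (s T) (φ T) (g T ω) (Lhat T ω) M (Lam T) ω} ≤ ε := by
  have hε3 : 0 < ε / 3 := ENNReal.div_pos hε.ne' (by simp)
  obtain ⟨M₁, hM₁, hr⟩ := hratio _ hε3
  obtain ⟨M, hreg, hM1, hMM⟩ := ((IsSample.eventually_measure_not_regular_le (P := P) hγ κ CX CS
    hε3).and ((eventually_ge_atTop 1).and (eventually_ge_atTop M₁))).exists
  have hnum : ∀ᶠ T in atTop, P {ω | ¬Lhat T ω = L T} ≤ ε / 3 := by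
    have h1 := ENNReal.Tendsto.sub (tendsto_const_nhds (x := (1 : ℝ≥0∞))) hlim (by simp)
    rw [tsub_self] at h1
    filter_upwards [h1.eventually_le_const hε3] with T hT
    have h2 : MeasurableSet {ω | Lhat T ω = L T} := hLhat T (measurableSet_singleton _)
    rw [← prob_compl_eq_one_sub h2] at hT
    exact hT
  refine ⟨M, hM1, ?_⟩
  filter_upwards [hS, hL, hr, hnum] with T h1 h2 h3 h4
  have h5 : ∀ᵐ ω ∂P, (∀ t j, X T t ω (s T j) = ∑ k, score (X T t ω) (φ T k) * φ T k (s T j)) ∧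
      ∀ t, MemLp (X T t ω) 2 unitVol :=
    ((hX T).ae_forall_eq_sum_score h2 (hs T).2).and (ae_all_iff.2 (hX T).ae_memLp)
  set B0 := {ω | ¬((∀ t j, X T t ω (s T j) = ∑ k, score (X T t ω) (φ T k) * φ T k (s T j)) ∧
      ∀ t, MemLp (X T t ω) 2 unitVol)}
  set B1 := {ω | ¬IsRegularSample (Matrix.of fun j (t : Fin T) => X T t ω (s T j))
        (Matrix.of fun j (t : Fin T) => u T t ω j) M}
  set B2 := {ω | M₁ * Lam T ^ 2 * kthEigenvalue (g T ω) (L T) < p T}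
  set B3 := {ω | ¬Lhat T ω = L T}
  have hB0 : P B0 = 0 := h5
  have hsub : {ω | ¬IsGoodOutcome (X T) (u T) (s T) (φ T) (g T ω) (Lhat T ω) M (Lam T) ω} ⊆
      B0 ∪ (B1 ∪ (B2 ∪ B3)) := by
    intro ω hω
    by_contra hcon
    simp only [Set.mem_union, not_or, B0, B1, B2, B3, Set.mem_ofPred_eq, not_not, not_lt] at hcon
    obtain ⟨⟨c1, c2⟩, c3, c4, c5⟩ := hcon
    refine hω ⟨c1, c2, c3, c4.trans ?_, c5⟩
    rw [mul_assoc] at c4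
    -- Enlarging M₁ to M preserves the eigenvalue condition only because Λ² γ̂_L is nonnegative,
    -- which that condition itself implies.
    have h6 := nonneg_of_mul_nonneg_right ((Nat.cast_nonneg _).trans c4) hM₁
    rw [mul_assoc, mul_assoc]
    exact mul_le_mul_of_nonneg_right hMM h6
  calc _ ≤ P (B0 ∪ (B1 ∪ (B2 ∪ B3))) := measure_mono hsub
    _ ≤ P B0 + (P B1 + (P B2 + P B3)) :=
        (measure_union_le _ _).trans <| add_le_add le_rfl <| (measure_union_le _ _).trans <|
          add_le_add le_rfl <| measure_union_le _ _
    _ ≤ 0 + (ε / 3 + (ε / 3 + ε / 3)) := by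
        rw [hB0]
        gcongr
        exact hreg _ _ _ _ _ h1
    _ = 3 * (ε / 3) := by ring
    _ = ε := ENNReal.mul_div_cancel (by norm_num) (by norm_num)

variable {e : (T : ℕ) → Ω → Fin T → EuclideanSpace ℝ (Fin T)}

/-- The pointwise rate of reconstruction, for a triangular array of signals. -/
theorem isBigOPForEach_errorAt (hp : DivergesSubexponentially p) (hs : ∀ T, IsGrid (s T))
    (hγ : Summable fun h => |γ h|) (hLhat : ∀ T, Measurable (Lhat T))
    (hX : ∀ T, SignalAssumption.{w, v} P (X T) (lam T) (φ T) K CX CS)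
    (hu : ∀ T, NoiseAssumption P (X T) (u T) γ)
    (hPCA : ∀ T ω, IsPCA (dataMatrix (X T) (u T) (s T) T ω) (g T ω) (e T ω))
    (hL : ∀ᶠ T in atTop, 1 ≤ L T ∧ L T ≤ T) {Lam : ℕ → ℝ} (hLam : ∀ᶠ T in atTop, 1 ≤ Lam T)
    (hratio : RatioIsBigOP P (fun T => (p T : ℝ)) (fun T ω => kthEigenvalue (g T ω) (L T))
      (fun T => Lam T ^ 2))
    (hlim : Tendsto (fun T => P {ω | Lhat T ω = L T}) atTop (𝓝 1)) :
    IsBigOPForEach P (fun T t ω => errorAt (X T) (u T) (s T) (e T ω) (Lhat T ω) t ω)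
      (fun T => Lam T ^ 3 * rate T (p T)) := by
  intro ε hε
  obtain ⟨κ, hS⟩ := hp.exists_isSample hs hX hu
  have hε2 : 0 < ε / 2 := ENNReal.half_pos hε.ne'
  obtain ⟨M, hM, hgood⟩ := exists_eventually_measure_not_isGoodOutcome_le hs hγ hLhat hX hS
    (hL.mono fun _ h => h.1) hratio hlim hε2
  -- At a single t, E sup X_t² ≤ CS makes the signal O_P(1), with a bound m independent of t.
  obtain ⟨m, hm, hm0⟩ := ((eventually_ofReal_le (tendsto_const_div_pow_atTop (CS : ℝ) (n := 2)
    (by norm_num)) hε2).and (eventually_gt_atTop 0)).exists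
  refine ⟨30 * M ^ 6 * (m + 1), ?_⟩
  filter_upwards [hS, hL, hLam, hgood] with T h1 h2 h3 h4 t
  refine (measure_mono (t := {ω | ¬IsGoodOutcome (X T) (u T) (s T) (φ T) (g T ω) (Lhat T ω) M
    (Lam T) ω} ∪ {ω | m < ⨆ j, |X T t ω (s T j)|}) fun ω hω => ?_).trans
    ((measure_union_le _ _).trans ((add_le_add h4 ((h1.measure_iSup_abs_lt_le t hm0).trans
      hm)).trans (ENNReal.add_halves ε).le))
  by_contra hcon
  simp only [Set.mem_union, Set.mem_ofPred_eq, not_or, not_not, not_lt] at hcon hω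
  rw [abs_errorAt] at hω
  refine absurd (hcon.1.errorAt_le hM h1.one_le_T h1.one_le_p (hPCA T ω) h2.1 h2.2 h3 t
    fun j => (le_ciSup (Set.finite_range _).bddAbove j).trans hcon.2) (not_le.2 ?_)
  refine lt_of_le_of_lt (le_of_eq ?_) hω
  ring

theorem tendsto_one_div_rpow_quarter :
    Tendsto (fun T : ℕ => 1 / (T : ℝ) ^ (1 / 4 : ℝ)) atTop (𝓝 0) :=
  tendsto_const_nhds.div_atTop
    ((tendsto_rpow_atTop (by norm_num)).comp tendsto_natCast_atTop_atTop)

theorem tendsto_rate (h : Tendsto (fun T : ℕ => √(T : ℝ) / (p T : ℝ)) atTop (𝓝 0)) :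
    Tendsto (fun T => rate T (p T)) atTop (𝓝 0) := by
  have h1 : Tendsto (fun T : ℕ => (T : ℝ) ^ (1 / 4 : ℝ) / √(p T : ℝ)) atTop (𝓝 0) := by
    have h2 := (Real.continuous_sqrt.tendsto 0).comp h
    rw [Real.sqrt_zero] at h2
    -- The second part of the rate is exactly the square root of √T / p.
    refine h2.congr fun T => ?_
    rw [Function.comp_apply, Real.sqrt_div (Real.sqrt_nonneg _), ← rpow_quarter_sq,
      Real.sqrt_sq (by positivity)]
  simpa only [rate, add_zero] using tendsto_one_div_rpow_quarter.add h1

theorem NoisyFDA.IsBigOPForEach.tendstoZero {Z : (T : ℕ) → Fin T → Ω → ℝ} {r : ℕ → ℝ}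
    (h : IsBigOPForEach P Z r) (hr : Tendsto r atTop (𝓝 0)) : TendstoZeroInProbForEach P Z := by
  intro c hc ε hε
  obtain ⟨M, hM⟩ := h ε hε
  have h1 : Tendsto (fun T => M * r T) atTop (𝓝 0) := by simpa using hr.const_mul M
  filter_upwards [hM, h1.eventually_le_const hc] with T h2 h3 t
  exact (measure_mono fun ω hω => lt_of_le_of_lt h3 hω).trans (h2 t)

/-- The uniform rate of reconstruction, for a fixed number of factors. -/
theorem isBigOP_errorUnif (hp : DivergesSubexponentially p) (hs : ∀ T, IsGrid (s T))
    (hγ : Summable fun h => |γ h|) (hLhat : ∀ T, Measurable (Lhat T))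
    (hX : ∀ T, SignalAssumption.{w, v} P (X T) (lam T) (φ T) K CX CS)
    (hu : ∀ T, NoiseAssumption P (X T) (u T) γ)
    (hPCA : ∀ T ω, IsPCA (dataMatrix (X T) (u T) (s T) T ω) (g T ω) (e T ω))
    (hL : ∀ᶠ T in atTop, 1 ≤ L T ∧ L T ≤ T)
    (hratio : RatioIsBigOP P (fun T => (p T : ℝ)) (fun T ω => kthEigenvalue (g T ω) (L T))
      (fun _ => 1 ^ 2))
    (hlim : Tendsto (fun T => P {ω | Lhat T ω = L T}) atTop (𝓝 1)) :
    IsBigOP P (fun T ω => errorUnif (X T) (u T) (s T) (e T ω) (Lhat T ω) ω)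
      (fun T ω => (⨆ t : Fin T, ‖factor (lam T) (φ T) (X T t ω)‖) * rate T (p T)) := by
  intro ε hε
  obtain ⟨κ, hS⟩ := hp.exists_isSample hs hX hu
  obtain ⟨M, hM, hgood⟩ := exists_eventually_measure_not_isGoodOutcome_le hs hγ hLhat hX hS
    (hL.mono fun _ h => h.1) hratio hlim hε
  have hM0 : 0 < M := by linarith
  have h0 : Tendsto (fun T : ℕ => M * (1 / (T : ℝ) ^ (1 / 4 : ℝ) + 1 / √(p T))) atTop (𝓝 0) := by
    have h1 : Tendsto (fun T => 1 / √(p T : ℝ)) atTop (𝓝 0) :=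
      tendsto_const_nhds.div_atTop (Real.tendsto_sqrt_atTop.comp
        (tendsto_natCast_atTop_atTop.comp hp.1))
    simpa using (tendsto_one_div_rpow_quarter.add h1).const_mul M
  refine ⟨30 * M ^ 6 * (√(1 + CX) * (1 + 2 * M)), ?_⟩
  filter_upwards [hS, hL, hgood, h0.eventually_le_const (u := 1 / (2 * M)) (by positivity)]
    with T h1 h2 h4 h5
  refine (measure_mono fun ω hω => ?_).trans h4
  by_contra hcon
  simp only [Set.mem_ofPred_eq, not_not] at hcon hω
  rw [abs_errorUnif] at hω
  refine absurd ?_ (not_le.2 hω)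
  have hne : Nonempty (Fin T) := ⟨⟨0, h1.one_le_T⟩⟩
  set F := ⨆ t : Fin T, ‖factor (lam T) (φ T) (X T t ω)‖
  have hF : ∀ (t : Fin T) j, |X T t ω (s T j)| ≤ √(1 + CX) * F := fun t j =>
    (hcon.abs_le_mul_norm_factor (hX T) (hs T).2 h2.1 t j).trans (by
      gcongr
      exact le_ciSup (f := fun t : Fin T => ‖factor (lam T) (φ T) (X T t ω)‖)
        (Set.finite_range _).bddAbove t)
  have hF0 : 0 ≤ F := Real.iSup_nonneg fun _ => norm_nonneg _
  -- The eigenvalue bound forces max_t ‖f_t‖ away from zero, since the noise share is eventually at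
  -- most 1/(2M). This absorbs the additive 1 into the random normalisation.
  have h6 : 1 ≤ 2 * M * (√(1 + CX) * F) := by
    have h7 := hcon.regular.le_of_forall_abs_le hM h1.one_le_T h1.one_le_p (hPCA T ω) h2.1 h2.2
      (by simpa using hcon.eigenvalue) (m := √(1 + CX) * F) (by positivity) fun j t => hF t j
    have h8 : 1 / M ≤ √(1 + CX) * F + 1 / (2 * M) := h7.trans (by gcongr)
    have h9 : 1 / M = 2 * (1 / (2 * M)) := by field_simp
    have h10 : 1 / (2 * M) ≤ √(1 + CX) * F := by linarith
    rw [div_le_iff₀ (by positivity)] at h10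
    linarith
  refine ciSup_le fun t => (hcon.errorAt_le hM h1.one_le_T h1.one_le_p (hPCA T ω) h2.1 h2.2 le_rfl
    t (hF t)).trans ?_
  have := rate_nonneg T (p T)
  calc 30 * M ^ 6 * 1 ^ 3 * rate T (p T) * (√(1 + CX) * F + 1)
      ≤ 30 * M ^ 6 * 1 ^ 3 * rate T (p T) * (√(1 + CX) * F + 2 * M * (√(1 + CX) * F)) := by
        gcongr
    _ = _ := by ring

end GoodOutcome

/-! ### The uniform rate for a diverging number of factors. -/

section UniformRate

set_option linter.unusedSectionVars false

variable {Ω : Type w} [MeasurableSpace Ω] {P : Measure Ω} [IsProbabilityMeasure P]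
  {p : ℕ → ℕ} {s : (T : ℕ) → Fin (p T) → ℝ} {γ : ℤ → ℝ}
  {u : (T : ℕ) → ℕ → Ω → Fin (p T) → ℝ} {Lhat : ℕ → Ω → ℕ} {L : ℕ → ℕ}
  {X : ℕ → ℕ → Ω → ℝ → ℝ} {lam : (T : ℕ) → Fin (L T) → ℝ}
  {φ : (T : ℕ) → Fin (L T) → ℝ → ℝ} {K CX CS : ℝ≥0} {g : (T : ℕ) → Ω → Fin T → ℝ}
  {e : (T : ℕ) → Ω → Fin T → EuclideanSpace ℝ (Fin T)}

theorem eventually_mul_rpow_add_le {a b : ℝ} (ha : 0 ≤ a) (hab : a < b) (D E : ℝ) (hE : 0 ≤ E)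
    {c : ℝ} (hc : 0 < c) : ∀ᶠ T : ℕ in atTop, D * (T : ℝ) ^ a + E ≤ c * (T : ℝ) ^ b := by
  have h := ((tendsto_rpow_atTop (sub_pos.2 hab)).comp
    tendsto_natCast_atTop_atTop).eventually_ge_atTop ((D + E) / c)
  filter_upwards [h, eventually_ge_atTop 1] with T h1 h2
  have hT : (1 : ℝ) ≤ T := by exact_mod_cast h2
  rw [Function.comp_apply, div_le_iff₀ hc] at h1
  have h3 : 1 ≤ (T : ℝ) ^ a := Real.one_le_rpow hT ha
  calc D * (T : ℝ) ^ a + E ≤ (D + E) * (T : ℝ) ^ a := by nlinarith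
    _ ≤ ((T : ℝ) ^ (b - a) * c) * (T : ℝ) ^ a := by gcongr
    _ = c * ((T : ℝ) ^ (b - a) * (T : ℝ) ^ a) := by ring
    _ = c * (T : ℝ) ^ b := by rw [← Real.rpow_add (by linarith), sub_add_cancel]

/-- A bound for the standardised scores when the eigenvalues decay at most polynomially. -/
theorem NoisyFDA.SignalAssumption.norm_factor_le {L : ℕ} {X : ℕ → Ω → ℝ → ℝ} {lam : Fin L → ℝ}
    {φ : Fin L → ℝ → ℝ} (hX : SignalAssumption.{w, v} P X lam φ K CX CS) (hL : 1 ≤ L) {ν ρ : ℝ}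
    (hν : 0 < ν) (hρ : 0 < ρ) (hlam : ∀ j : Fin L, ρ * ((j : ℝ) + 1) ^ (-ν) ≤ lam j) {x : ℝ → ℝ}
    (hx : MemLp x 2 unitVol) {N : ℝ} (hN : 0 ≤ N) (hxN : l2norm x ≤ ENNReal.ofReal N) :
    ‖factor lam φ x‖ ≤ √ρ⁻¹ * (L : ℝ) ^ (ν / 2) * N := by
  have hL0 : (0 : ℝ) < L := by exact_mod_cast hL
  -- All eigenvalues are at least the polynomial bound at index L, so Bessel's inequality bounds the
  -- standardised scores at the cost of L^{ν/2}.
  have h1 : ∀ k, ρ * (L : ℝ) ^ (-ν) ≤ lam k := fun k => by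
    refine le_trans ?_ (hlam k)
    refine mul_le_mul_of_nonneg_left ?_ hρ.le
    refine Real.rpow_le_rpow_of_nonpos (by positivity) ?_ (by linarith)
    exact_mod_cast k.2
  refine le_of_sq_le_sq ?_ (by positivity)
  refine (hX.eigenSystem.norm_factor_sq_le hx (by positivity) h1).trans ?_
  have h2 : (l2norm x).toReal ≤ N := ENNReal.toReal_le_of_le_ofReal hN hxN
  have h3 : ((L : ℝ) ^ (ν / 2)) ^ 2 = (L : ℝ) ^ ν := by
    rw [← Real.rpow_mul_natCast hL0.le]
    congr 1
    push_cast
    ring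
  rw [mul_pow, mul_pow, h3, Real.sq_sqrt (by positivity), mul_inv, Real.rpow_neg hL0.le, inv_inv]
  gcongr

/-- The uniform rate of reconstruction, for a triangular array of signals. -/
theorem isLittleOP_errorUnif (hp : DivergesSubexponentially p) (hs : ∀ T, IsGrid (s T))
    (hγ : Summable fun h => |γ h|) (hLhat : ∀ T, Measurable (Lhat T))
    (hX : ∀ T, SignalAssumption.{w, v} P (X T) (lam T) (φ T) K CX CS)
    (hu : ∀ T, NoiseAssumption P (X T) (u T) γ)
    (hPCA : ∀ T ω, IsPCA (dataMatrix (X T) (u T) (s T) T ω) (g T ω) (e T ω))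
    (hL : ∀ᶠ T in atTop, 1 ≤ L T ∧ L T ≤ T) {Lam : ℕ → ℝ} (hLam : ∀ᶠ T in atTop, 1 ≤ Lam T)
    (hratio : RatioIsBigOP P (fun T => (p T : ℝ)) (fun T ω => kthEigenvalue (g T ω) (L T))
      (fun T => Lam T ^ 2))
    (hlim : Tendsto (fun T => P {ω | Lhat T ω = L T}) atTop (𝓝 1))
    {ν ρ : ℝ} (hν : 0 < ν) (hρ : 0 < ρ)
    (hlam : ∀ T (j : Fin (L T)), ρ * ((j : ℝ) + 1) ^ (-ν) ≤ lam T j)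
    {q q' : ℝ} (hq' : 0 < q') (hqq : q' < q) {C : ℝ≥0}
    (hC : ∀ T, ∫⁻ ω, l2norm (X T 0 ω) ^ q ∂P ≤ C) :
    IsLittleOP P (fun T ω => errorUnif (X T) (u T) (s T) (e T ω) (Lhat T ω) ω)
      (fun T => Lam T ^ 3 * (L T : ℝ) ^ (ν / 2) * (T : ℝ) ^ (1 / q') * rate T (p T)) := by
  intro c hc
  rw [ENNReal.tendsto_nhds_zero]
  intro ε hε
  have hq : 0 < q := hq'.trans hqq
  obtain ⟨κ, hS⟩ := hp.exists_isSample hs hX hu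
  have hε2 : 0 < ε / 2 := ENNReal.half_pos hε.ne'
  obtain ⟨M, hM, hgood⟩ := exists_eventually_measure_not_isGoodOutcome_le hs hγ hLhat hX hS
    (hL.mono fun _ h => h.1) hratio hlim hε2
  -- Markov's inequality for the q-th moment and a union bound over t give max_t ‖X_t‖ ≤ A T^{1/q}
  -- up to probability ε/2.
  obtain ⟨A, hAε, hA⟩ := ((eventually_ofReal_le (f := fun A : ℝ => C / A ^ q)
    (tendsto_const_nhds.div_atTop (tendsto_rpow_atTop hq)) hε2).and
    (eventually_gt_atTop 0)).exists
  set D := √(1 + CX) * √ρ⁻¹ * A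
  have hD : 0 < D := by positivity
  -- Since q' < q, the power T^{1/q'} outgrows T^{1/q} and all constants; this turns a bound in
  -- probability into a small-o statement for each c.
  have hexp := eventually_mul_rpow_add_le (a := 1 / q) (b := 1 / q') (by positivity)
    (one_div_lt_one_div_of_lt hq' hqq) (30 * M ^ 6 * D) (30 * M ^ 6) (by positivity) hc
  filter_upwards [hS, hL, hLam, hgood, hexp] with T h1 h2 h3 h4 h5
  refine (measure_mono (t := {ω | ¬IsGoodOutcome (X T) (u T) (s T) (φ T) (g T ω) (Lhat T ω) M
    (Lam T) ω} ∪ {ω | ∃ t : Fin T, ENNReal.ofReal (A * (T : ℝ) ^ (1 / q)) < l2norm (X T t ω)})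
    fun ω hω => ?_).trans ((measure_union_le _ _).trans ((add_le_add h4
      (((hX T).measure_exists_l2norm_le hq (hC T) h1.one_le_T hA).trans hAε)).trans
      (ENNReal.add_halves ε).le))
  by_contra hcon
  simp only [Set.mem_union, Set.mem_ofPred_eq, not_or, not_not, not_exists, not_lt] at hcon hω
  obtain ⟨hgo, hnorm⟩ := hcon
  rw [abs_errorUnif] at hω
  refine absurd ?_ (not_le.2 hω)
  have hne : Nonempty (Fin T) := ⟨⟨0, h1.one_le_T⟩⟩
  have hm : ∀ (t : Fin T) j, |X T t ω (s T j)| ≤ D * (L T : ℝ) ^ (ν / 2) * (T : ℝ) ^ (1 / q) :=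
    fun t j => (hgo.abs_le_mul_norm_factor (hX T) (hs T).2 h2.1 t j).trans <| by
      refine (mul_le_mul_of_nonneg_left ((hX T).norm_factor_le h2.1 hν hρ (hlam T) (hgo.memLp t)
        (by positivity) (hnorm t)) (by positivity)).trans (le_of_eq ?_)
      ring
  refine ciSup_le fun t => (hgo.errorAt_le hM h1.one_le_T h1.one_le_p (hPCA T ω) h2.1 h2.2 h3
    t (hm t)).trans ?_
  have h6 := rate_nonneg T (p T)
  have h7 : 1 ≤ (L T : ℝ) ^ (ν / 2) :=
    Real.one_le_rpow (by exact_mod_cast h2.1) (by positivity)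
  calc 30 * M ^ 6 * Lam T ^ 3 * rate T (p T) * (D * (L T : ℝ) ^ (ν / 2) * (T : ℝ) ^ (1 / q) + 1)
      ≤ 30 * M ^ 6 * Lam T ^ 3 * rate T (p T) *
          (D * (L T : ℝ) ^ (ν / 2) * (T : ℝ) ^ (1 / q) + (L T : ℝ) ^ (ν / 2)) := by gcongr
    _ = Lam T ^ 3 * (L T : ℝ) ^ (ν / 2) * rate T (p T) *
          (30 * M ^ 6 * D * (T : ℝ) ^ (1 / q) + 30 * M ^ 6) := by ring
    _ ≤ Lam T ^ 3 * (L T : ℝ) ^ (ν / 2) * rate T (p T) * (c * (T : ℝ) ^ (1 / q')) := by gcongr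
    _ = _ := by ring

theorem NoisyFDA.IsBigOPForEach.mono {Z : (T : ℕ) → Fin T → Ω → ℝ} {r r' : ℕ → ℝ}
    (h : IsBigOPForEach P Z r) (hr0 : ∀ᶠ T in atTop, 0 ≤ r T) (hr : ∀ᶠ T in atTop, r T ≤ r' T) :
    IsBigOPForEach P Z r' := by
  intro ε hε
  obtain ⟨M, hM⟩ := h ε hε
  refine ⟨max M 0, ?_⟩
  filter_upwards [hM, hr0, hr] with T h1 h2 h3 t
  refine le_trans (measure_mono fun ω (hω : max M 0 * r' T < |Z T t ω|) =>
    lt_of_le_of_lt ?_ hω) (h1 t)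
  calc M * r T ≤ max M 0 * r T := mul_le_mul_of_nonneg_right (le_max_left _ _) h2
    _ ≤ max M 0 * r' T := mul_le_mul_of_nonneg_left h3 (le_max_right _ _)

theorem NoisyFDA.IsLittleOP.mono {Z : ℕ → Ω → ℝ} {r r' : ℕ → ℝ} (h : IsLittleOP P Z r)
    (hr : ∀ᶠ T in atTop, r T ≤ r' T) : IsLittleOP P Z r' := fun c hc =>
  tendsto_of_tendsto_of_tendsto_of_le_of_le' tendsto_const_nhds (h c hc)
    (Eventually.of_forall fun _ => zero_le) (hr.mono fun _ h1 => measure_mono fun _ hω =>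
      lt_of_le_of_lt (mul_le_mul_of_nonneg_left h1 hc.le) hω)

theorem NoisyFDA.DivergesSubpolynomially.eventually_le (hL : DivergesSubpolynomially L) :
    ∀ᶠ T in atTop, 1 ≤ L T ∧ L T ≤ T := by
  have h := (hL.2 1 one_pos).bound one_pos
  filter_upwards [h, hL.1.eventually_ge_atTop 1] with T h1 h2
  refine ⟨h2, ?_⟩
  simpa using h1

end UniformRate

/-! ### The two regimes, as specialisations of the triangular array results. -/

theorem corollary1 {Ω : Type w} [MeasurableSpace Ω] (P : Measure Ω) [IsProbabilityMeasure P]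
    -- number of sampling points and sampling points, for each sample size `T`
    (p : ℕ → ℕ) (hp : DivergesSubexponentially p)
    (s : (T : ℕ) → Fin (p T) → ℝ) (hs : ∀ T, IsGrid (s T))
    -- noise
    (γ : ℤ → ℝ) (hγ : Summable (fun h => |γ h|))
    (u : (T : ℕ) → ℕ → Ω → Fin (p T) → ℝ)
    -- the estimated number of factors
    (Lhat : ℕ → Ω → ℕ) (hLhat : ∀ T, Measurable (Lhat T)) :
    -- fixed number of factors
    (∀ (L : ℕ) (X : ℕ → Ω → ℝ → ℝ) (lam : Fin L → ℝ) (φ : Fin L → ℝ → ℝ) (K CX CS : ℝ≥0)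
        (g : (T : ℕ) → Ω → Fin T → ℝ) (e : (T : ℕ) → Ω → Fin T → EuclideanSpace ℝ (Fin T)),
      1 ≤ L →
      SignalAssumption.{w, v} P X lam φ K CX CS →
      (∀ T, NoiseAssumption P X (u T) γ) →
      (∃ C : ℝ, ∀ᶠ T in atTop, ∀ k l, |(∑ i, φ k (s T i) * φ l (s T i)) / (p T : ℝ)| ≤ C) →
      (∀ T ω, IsPCA (dataMatrix X (u T) (s T) T ω) (g T ω) (e T ω)) →
      RatioIsBigOP P (fun T => (p T : ℝ)) (fun T ω => kthEigenvalue (g T ω) L) (fun _ => 1) →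
      Tendsto (fun T => P {ω | Lhat T ω = L}) atTop (𝓝 1) →
      IsBigOPForEach P
          (fun T t ω => errorAt X (u T) (s T) (e T ω) (Lhat T ω) t ω)
          (fun T => rate T (p T)) ∧
        (Tendsto (fun T : ℕ => √(T : ℝ) / (p T : ℝ)) atTop (𝓝 0) →
          TendstoZeroInProbForEach P
            (fun T t ω => errorAt X (u T) (s T) (e T ω) (Lhat T ω) t ω)) ∧
        IsBigOP P
          (fun T ω => errorUnif X (u T) (s T) (e T ω) (Lhat T ω) ω)
          (fun T ω => (⨆ t : Fin T, ‖factor lam φ (X t ω)‖) * rate T (p T))) ∧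
    -- diverging number of factors; the signals form a triangular array
    (∀ (L : ℕ → ℕ) (X : ℕ → ℕ → Ω → ℝ → ℝ) (lam : (T : ℕ) → Fin (L T) → ℝ)
        (φ : (T : ℕ) → Fin (L T) → ℝ → ℝ) (K CX CS : ℝ≥0)
        (g : (T : ℕ) → Ω → Fin T → ℝ) (e : (T : ℕ) → Ω → Fin T → EuclideanSpace ℝ (Fin T))
        (ν ρ β : ℝ),
      DivergesSubpolynomially L →
      (∀ T, SignalAssumption.{w, v} P (X T) (lam T) (φ T) K CX CS) →
      (∀ T, NoiseAssumption P (X T) (u T) γ) →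
      (∃ C : ℝ, ∀ᶠ T in atTop, ∀ k l,
        |(∑ i, φ T k (s T i) * φ T l (s T i)) / (p T : ℝ)| ≤ C) →
      (∀ T ω, IsPCA (dataMatrix (X T) (u T) (s T) T ω) (g T ω) (e T ω)) →
      0 < ν → 0 < ρ → (∀ T (j : Fin (L T)), ρ * ((j : ℝ) + 1) ^ (-ν) ≤ lam T j) →
      0 < β →
      RatioIsBigOP P (fun T => (p T : ℝ)) (fun T ω => kthEigenvalue (g T ω) (L T))
        (fun T => (L T : ℝ) ^ β) →
      Tendsto (fun T => P {ω | Lhat T ω = L T}) atTop (𝓝 1) →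
      IsBigOPForEach P
          (fun T t ω => errorAt (X T) (u T) (s T) (e T ω) (Lhat T ω) t ω)
          (fun T => (L T : ℝ) ^ (2 * β + 5 / 2 + ν / 2) * rate T (p T)) ∧
        (∀ q : ℝ, 4 < q →
          (∃ C : ℝ≥0, ∀ T, ∫⁻ ω, (l2norm (X T 0 ω)) ^ q ∂P ≤ C) →
          ∀ q' : ℝ, 0 < q' → q' < q →
            IsLittleOP P
              (fun T ω => errorUnif (X T) (u T) (s T) (e T ω) (Lhat T ω) ω)
              (fun T => (L T : ℝ) ^ (2 * β + 5 / 2 + ν) * (T : ℝ) ^ (1 / q') *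
                rate T (p T)))) := by
  refine ⟨?_, ?_⟩
  · intro L X lam φ K CX CS g e hL hX hu _ hPCA hratio hlim
    have hLT : ∀ᶠ T in atTop, 1 ≤ L ∧ L ≤ T :=
      (eventually_ge_atTop L).mono fun T hT => ⟨hL, hT⟩
    have hratio' : RatioIsBigOP P (fun T => (p T : ℝ)) (fun T ω => kthEigenvalue (g T ω) L)
      (fun _ => 1 ^ 2) := by simpa using hratio
    have h1 := isBigOPForEach_errorAt (L := fun _ => L) (X := fun _ => X) (lam := fun _ => lam)
      (φ := fun _ => φ) hp hs hγ hLhat (fun _ => hX) hu hPCA hLT (Lam := fun _ => 1)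
      (Eventually.of_forall fun _ => le_rfl) hratio' hlim
    simp only [one_pow, one_mul] at h1
    exact ⟨h1, fun h => h1.tendstoZero (tendsto_rate h),
      isBigOP_errorUnif (L := fun _ => L) (X := fun _ => X) (lam := fun _ => lam)
        (φ := fun _ => φ) hp hs hγ hLhat (fun _ => hX) hu hPCA hLT hratio' hlim⟩
  · intro L X lam φ K CX CS g e ν ρ β hL hX hu _ hPCA hν hρ hlam hβ hratio hlim
    have hLT := hL.eventually_le
    -- The eigenvalue ratio is O_P(Λ²), so Λ = L^{β/2} matches the assumed L^β.
    have hLam : ∀ᶠ T in atTop, 1 ≤ (L T : ℝ) ^ (β / 2) := hLT.mono fun T hT =>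
      Real.one_le_rpow (by exact_mod_cast hT.1) (by positivity)
    have hpow : ∀ T (n : ℕ), ((L T : ℝ) ^ (β / 2)) ^ n = (L T : ℝ) ^ (β / 2 * n) := fun T n =>
      (Real.rpow_mul_natCast (Nat.cast_nonneg _) _ _).symm
    have hratio' : RatioIsBigOP P (fun T => (p T : ℝ))
        (fun T ω => kthEigenvalue (g T ω) (L T)) (fun T => ((L T : ℝ) ^ (β / 2)) ^ 2) := by
      simp_rw [hpow]
      simpa using hratio
    have hrate := fun T => rate_nonneg T (p T)
    refine ⟨(isBigOPForEach_errorAt hp hs hγ hLhat hX hu hPCA hLT hLam hratio' hlim).mono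
      ?_ ?_, ?_⟩
    · exact Eventually.of_forall fun T => mul_nonneg (by positivity) (hrate T)
    · filter_upwards [hLT] with T hT
      rw [hpow]
      refine mul_le_mul_of_nonneg_right ?_ (hrate T)
      -- The exponent obtained is 3β/2, below 2β + 5/2 + ν/2, and L ≥ 1.
      refine Real.rpow_le_rpow_of_exponent_le (by exact_mod_cast hT.1) ?_
      push_cast
      linarith
    · rintro q hq ⟨C, hC⟩ q' hq' hqq
      refine (isLittleOP_errorUnif hp hs hγ hLhat hX hu hPCA hLT hLam hratio' hlim hν hρ hlam hq'
        hqq hC).mono ?_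
      filter_upwards [hLT] with T hT
      rw [hpow, ← Real.rpow_add (by exact_mod_cast hT.1)]
      refine mul_le_mul_of_nonneg_right (mul_le_mul_of_nonneg_right ?_ (by positivity)) (hrate T)
      -- The exponent obtained is 3β/2 + ν/2, below 2β + 5/2 + ν.
      refine Real.rpow_le_rpow_of_exponent_le (by exact_mod_cast hT.1) ?_
      push_cast
      linarith
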